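/- Let $T>0$, $r>0$, $\rho>0$, and let $H=\mathbb R\times L^2([-T,0];\mathbb R)$, with elements $\eta=(\eta_0,\eta_1)$, $H_+=\{\eta:\eta_0>0\}$ and $H_{++}=\{\eta:\eta_0>0,\ \eta_1\ge 0\text{ a.e.}\}$. Assume: (a) $a\in W^{1,2}([-T,0];\mathbb R)$, $a\ge 0$, $a(-T)=0$; $f_0:[0,\infty)\times\mathbb R\to\mathbb R$ is jointly concave, nondecreasing in its second variable, satisfies $|f_0(x,y)-f_0(x',y')|\le C_{f_0}(|x-x'|+|y-y'|)$, and $f_0(0,y)>0$ for all $y>0$. (b) $U_1\in C([0,\infty))\cap C^2((0,\infty))$ is bounded, with $U_1'>0$, $U_1''<0$, $U_1'(0^+)=+\infty$; $U_2\in C((0,\infty))$ is nondecreasing, concave, bounded from above, and $\int_0^{\infty}e^{-\rho t}U_2(e^{-C_{f_0}t})\,dt>-\infty$. For $\eta\in H_+$ let $\mathcal C(\eta)$ be the set of $c\in L^1_{loc}([0,\infty);[0,\infty))$ for which the solution $x(\cdot)=x(\cdot;\eta,c)$ of $$x'(t)=rx(t)+f_0\Big(x(t),\int_{-T}^0a(\xi)x(t+\xi)\,d\xi\Big)-c(t),\qquad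 x(0)=\eta_0,\quad x(s)=\eta_1(s),\ s\in[-T,0),$$ (understood in integral form for $t\ge 0$) is strictly positive on $[0,\infty)$. Put $$J(\eta;c)=\int_0^\infty e^{-\rho t}\,[U_1(c(t))+U_2(x(t))]\,dt\in[-\infty,\infty),\qquad V(\eta)=\sup_{c\in\mathcal C(\eta)}J(\eta;c)\quad(\sup\emptyset=-\infty),$$ $\mathcal D(V)=\{\eta\in H_+: V(\eta)>-\infty\}$, and, for $\eta\in\mathcal D(V)$, let $$C(\eta)=\operatorname{argmax}_{c\ge 0}\,\big(U_1(c)-c\,V_{\eta_0}(\eta)\big)$$ be the (unique) maximizer, where $V_{\eta_0}$ is the derivative of $V$ in the direction $(1,0)$. Assume moreover that $U_2$ is not integrable at $0^+$ and that $\int_{-\varepsilon}^0a(\xi)\,d\xi>0$ for every $\varepsilon\in(0,T]$. Then for every $\eta\in H_{++}$ the closed-loop delay equation $$x'(t)=rx(t)+f_0\Big(x(t),\int_{-T}^0a(\xi)x(t+\xi)\,d\xi\Big)-C\big((x(t),x(t+\xi)|_{\xi\in[-T,0]})\big),\quad t\ge 0,\qquad x(0)=\eta_0,\quad x(s)=\eta_1(s),\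 s\in[-T,0),$$ has a solution $x^*\in C^1([0,\infty);\mathbb R)$ such that, for all $t\ge0$, $x^*(t)>0$, $X^*(t):=(x^*(t),x^*(t+\xi)|_{\xi\in[-T,0]})\in\mathcal D(V)$, and $V_{\eta_0}(X^*(t))$ and $C(X^*(t))$ exist. The feedback strategy $c^*(t)=C(X^*(t))$ is admissible, i.e. $c^*\in\mathcal C(\eta)$, and optimal, i.e. $J(\eta;c^*)=V(\eta)$. -/

import Mathlib

open MeasureTheory Set Filter Topology

namespace DelayControl

noncomputable section

/-- The data of the problem: delay horizon `T`, linear rate `r`, discount rate `ρ`, delay kernel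
`a` (used on `[-T, 0]`), nonlinearity `f₀` (used on `[0, ∞) × ℝ`), its Lipschitz constant `Cf`,
and the utilities `U₁` (used on `[0, ∞)`) and `U₂` (used on `(0, ∞)`). -/
structure Problem where
  T : ℝ
  r : ℝ
  ρ : ℝ
  a : ℝ → ℝ
  f₀ : ℝ → ℝ → ℝ
  Cf : ℝ
  U₁ : ℝ → ℝ
  U₂ : ℝ → ℝ

/-- `a` is (the continuous representative of) an element of `W^{1,2}([-T, 0]; ℝ)`: it is a
primitive of a square integrable function, its weak derivative. -/
def MemW12 (T : ℝ) (a : ℝ → ℝ) : Prop :=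
  ∃ a' : ℝ → ℝ, MemLp a' 2 (volume.restrict (Icc (-T) 0)) ∧
    ∀ ξ ∈ Icc (-T) 0, a ξ = a (-T) + ∫ u in (-T)..ξ, a' u

/-- The integral of a function whose positive part has finite integral, with values in
`[-∞, ∞)`: integral of the positive part minus integral of the negative part. -/
def eintegral (μ : Measure ℝ) (f : ℝ → ℝ) : EReal :=
  ((∫⁻ t, ENNReal.ofReal (f t) ∂μ : ENNReal) : EReal)
    - ((∫⁻ t, ENNReal.ofReal (-f t) ∂μ : ENNReal) : EReal)

namespace Problem

variable (P : Problem)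

/-- Assumptions on the state equation. -/
structure StateHypotheses : Prop where
  T_pos : 0 < P.T
  r_pos : 0 < P.r
  a_mem : MemW12 P.T P.a
  a_nonneg : ∀ ξ ∈ Icc (-P.T) 0, 0 ≤ P.a ξ
  a_left : P.a (-P.T) = 0
  f₀_concave : ConcaveOn ℝ (Ici (0 : ℝ) ×ˢ (univ : Set ℝ)) (fun p : ℝ × ℝ => P.f₀ p.1 p.2)
  f₀_mono : ∀ x, 0 ≤ x → Monotone (P.f₀ x)
  f₀_lipschitz : ∀ x x' y y', 0 ≤ x → 0 ≤ x' →
    |P.f₀ x y - P.f₀ x' y'| ≤ P.Cf * (|x - x'| + |y - y'|)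
  f₀_pos : ∀ y, 0 < y → 0 < P.f₀ 0 y

/-- Assumptions on the discount rate and the utilities. -/
structure UtilityHypotheses : Prop where
  ρ_pos : 0 < P.ρ
  U₁_cont : ContinuousOn P.U₁ (Ici 0)
  U₁_C2 : ContDiffOn ℝ 2 P.U₁ (Ioi 0)
  U₁_deriv_pos : ∀ c, 0 < c → 0 < deriv P.U₁ c
  U₁_deriv_zero : Tendsto (deriv P.U₁) (𝓝[>] 0) atTop
  U₁_deriv2_neg : ∀ c, 0 < c → deriv (deriv P.U₁) c < 0
  U₁_bdd : ∃ K, ∀ c, 0 ≤ c → |P.U₁ c| ≤ K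
  U₂_cont : ContinuousOn P.U₂ (Ioi 0)
  U₂_mono : MonotoneOn P.U₂ (Ioi 0)
  U₂_concave : ConcaveOn ℝ (Ioi 0) P.U₂
  U₂_bdd : ∃ K, ∀ x, 0 < x → P.U₂ x ≤ K
  -- the integrand is bounded above by an integrable function, so that its integral is `> -∞`
  -- exactly when it is integrable
  U₂_int : IntegrableOn (fun t => Real.exp (-P.ρ * t) * P.U₂ (Real.exp (-P.Cf * t))) (Ioi 0)

/-- The Hilbert space `H = ℝ × L²([-T, 0]; ℝ)`, with the Hilbert sum norm. -/
abbrev H : Type := WithLp 2 (ℝ × Lp ℝ 2 (volume.restrict (Icc (-P.T) 0)))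

/-- `H₊ = (0, ∞) × L²`. -/
def HPlus : Set P.H := {η | 0 < η.fst}

/-- `H₊₊`: positive present and almost everywhere nonnegative past. -/
def HPlusPlus : Set P.H :=
  {η | 0 < η.fst ∧ ∀ᵐ ξ ∂(volume.restrict (Icc (-P.T) 0)), 0 ≤ η.snd ξ}

/-- `ζ = (x(t), x(t + ξ)|_{ξ ∈ [-T, 0]})` in `H` (in particular the segment of `x` is square
integrable). -/
def IsSegment (x : ℝ → ℝ) (t : ℝ) (ζ : P.H) : Prop :=
  ζ.fst = x t ∧ ζ.snd =ᵐ[volume.restrict (Icc (-P.T) 0)] fun ξ => x (t + ξ)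

/-- The path `x` has the initial datum `η`: `x(0) = η₀` and `x(s) = η₁(s)` for (almost every)
`s ∈ [-T, 0)`. -/
def HasInitialDatum (η : P.H) (x : ℝ → ℝ) : Prop :=
  x 0 = η.fst ∧ x =ᵐ[volume.restrict (Ico (-P.T) 0)] η.snd

/-- The uncontrolled drift `r x(t) + f₀(x(t), ∫_{-T}^0 a(ξ) x(t + ξ) dξ)`. -/
def drift (x : ℝ → ℝ) (t : ℝ) : ℝ :=
  P.r * x t + P.f₀ (x t) (∫ ξ in (-P.T)..0, P.a ξ * x (t + ξ))

/-- `c ∈ L¹_loc([0, ∞); [0, ∞))`. -/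
def IsControl (c : ℝ → ℝ) : Prop :=
  LocallyIntegrableOn c (Ici 0) ∧ ∀ t, 0 ≤ t → 0 ≤ c t

/-- `x` is the solution `x(·; η, c)` of the state equation and it satisfies the state constraint
`x > 0` on `[0, ∞)`. Such an `x` is unique on `[0, ∞)`. -/
structure IsPositiveTrajectory (η : P.H) (c x : ℝ → ℝ) : Prop where
  initial : P.HasInitialDatum η x
  cont : ContinuousOn x (Ici 0)
  pos : ∀ t, 0 ≤ t → 0 < x t
  eqn : ∀ t, 0 ≤ t → x t = η.fst + (∫ s in (0 : ℝ)..t, P.drift x s) - ∫ s in (0 : ℝ)..t, c s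

/-- The class `𝒞(η)` of the admissible controls. -/
def admissible (η : P.H) : Set (ℝ → ℝ) :=
  {c | IsControl c ∧ ∃ x, P.IsPositiveTrajectory η c x}

/-- `∫_0^∞ e^{-ρ t} [U₁(c(t)) + U₂(x(t))] dt`. -/
def payoff (c x : ℝ → ℝ) : EReal :=
  eintegral (volume.restrict (Ioi 0))
    (fun t => Real.exp (-P.ρ * t) * (P.U₁ (c t) + P.U₂ (x t)))

/-- The objective functional `J(η; c)` for `c ∈ 𝒞(η)`: the payoff of `c` along the trajectory
`x(·; η, c)`. (That trajectory being unique, the supremum is over a single value.) -/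
def J (η : P.H) (c : ℝ → ℝ) : EReal :=
  ⨆ (x : ℝ → ℝ) (_ : P.IsPositiveTrajectory η c x), P.payoff c x

/-- The value function, with `sup ∅ = -∞`. -/
def V (η : P.H) : EReal := ⨆ c ∈ P.admissible η, P.J η c

/-- The domain `𝒟(V)` of the value function. -/
def domV : Set P.H := {η | η ∈ P.HPlus ∧ ⊥ < P.V η}

/-- `p` is the derivative `V_{η₀}(ζ)` of the value function in the direction `(1, 0)` at
`ζ ∈ 𝒟(V)`. -/
def HasPresentDerivAt (ζ : P.H) (p : ℝ) : Prop :=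
  HasDerivAt (fun s : ℝ => (P.V (WithLp.toLp 2 (s, ζ.snd))).toReal) p ζ.fst

/-- `c = C(ζ)`, where `C(ζ) = argmax_{c ≥ 0} (U₁(c) - c V_{η₀}(ζ))` is the candidate optimal
feedback map on `𝒟(V)`: the derivative `V_{η₀}(ζ)` exists, and `c` is the unique maximizer. -/
def IsFeedback (ζ : P.H) (c : ℝ) : Prop :=
  ζ ∈ P.domV ∧ ∃ p, P.HasPresentDerivAt ζ p ∧ 0 ≤ c ∧
    ∀ c', 0 ≤ c' → c' ≠ c → P.U₁ c' - c' * p < P.U₁ c - c * p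

/-- `x` is a `C¹([0, ∞))` solution of the closed-loop delay state equation
`x'(t) = r x(t) + f₀(x(t), ∫_{-T}^0 a(ξ) x(t + ξ) dξ) - C((x(t), x(t + ξ)|_{ξ ∈ [-T, 0]}))`
with initial datum `η`, whose segments are `X(t)`, all in `𝒟(V)` (as `C` is defined there), and `c` is the associated feedback
strategy `c(t) = C(X(t))`. -/
structure IsClosedLoopSolution (η : P.H) (x : ℝ → ℝ) (X : ℝ → P.H) (c : ℝ → ℝ) : Prop where
  initial : P.HasInitialDatum η x
  smooth : ContDiffOn ℝ 1 x (Ici 0)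
  segment : ∀ t, 0 ≤ t → P.IsSegment x t (X t)
  feedback : ∀ t, 0 ≤ t → P.IsFeedback (X t) (c t)
  eqn : ∀ t, 0 ≤ t → HasDerivWithinAt x (P.drift x t - c t) (Ici 0) t

end Problem

end

end DelayControl

/-! ### Primitives on the half-line; elementary properties of the kernel, the delay term and the
drift -/

namespace DelayControl

/-! The closed loop is not solved directly. An optimal pair `(c, x)` is constructed first, the
derivative of the value function in the present is then computed along it by perturbation, and the
feedback turns out to reproduce the optimal control.

Existence (`exists_optimal_pair`). Since `f₀` is jointly concave, a convex combination of
trajectories is a trajectory whose consumption exceeds the combined one. Strict concavity of `U₁`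
then forces almost optimal controls to be close to each other, so a suitably fast maximizing
sequence has controls converging almost everywhere (`exists_maximizing_sequence`), and no weak
compactness is needed. The trajectories are replaced by their upper envelopes, which decrease to a
limit. Fatou's lemma shows that this limit is a subsolution of the state equation with the limit
control (`envelope_subsolution`). Adding `Cf x` makes the drift monotone, so monotone iteration
produces a solution above the subsolution (`exists_solution_ge`). A zero of this solution at time
`t₀` would give a bound `x(t) ≤ L (t - t₀)` just afterwards. A finite payoff would then make `U₂`
integrable at `0⁺`, which is excluded (`pos_and_payoff₂_ge`).

Regularity. By dynamic programming every tail of the optimal pair is optimal (`tail_optimal`). The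
value function is concave in the present, so it has supergradients `q` in the direction `(1, 0)`.
The trajectory is perturbed by a multiple of a tent that equals `1` at time `0` and vanishes before
`0` and after `δ`: this changes the present and leaves the past untouched. Upward tents release
consumption at a rate about `1/δ` on `[0, δ]` and bound the average of `U₁'(c)` over `[0, δ]`
essentially by `q` (`lintegral_marginal_le`). As `q` is bounded a priori, `U₁'(c)` is locally
bounded, and `c` is locally bounded away from `0`. This makes downward tents admissible, and they
give the reverse bound (`supergradient_le`). The delay term contributes only order `δ`, because the
kernel is bounded and the tent has mass of order `δ`. Hence `q` differs from the average of `U₁'(c)`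
over `[t, t + δ]` by at most `K δ`, locally uniformly in `t` (`abs_supergradient_sub_le`). Letting
`δ → 0`, the supergradient is unique, so `V_{η₀}(X(t))` exists; it is continuous in `t` as a uniform
limit of continuous averages, and it equals `U₁'(c(t))` almost everywhere (`exists_presentDeriv`).

Conclusion. The maximizer of `U₁(c) - c p` is `(U₁')⁻¹(p)`. The feedback along the trajectory is
therefore continuous and agrees almost everywhere with the optimal control, so it drives the same
trajectory, which is now `C¹`, with the same payoff. -/

theorem locallyIntegrableOn_Ici_iff {g : ℝ → ℝ} :
    LocallyIntegrableOn g (Ici 0) ↔ ∀ S, 0 ≤ S → IntervalIntegrable g volume 0 S := by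
  rw [locallyIntegrableOn_iff isClosed_Ici.isLocallyClosed]
  constructor
  · intro h S hS
    rw [intervalIntegrable_iff_integrableOn_Icc_of_le hS]
    exact h _ (fun x hx => hx.1) isCompact_Icc
  · intro h K hK hKc
    obtain ⟨S, hS⟩ := hKc.isBounded.bddAbove
    have h1 := (intervalIntegrable_iff_integrableOn_Icc_of_le (le_max_right S 0)).1
      (h (max S 0) (le_max_right _ _))
    exact h1.mono_set fun x hx => ⟨hK hx, (hS hx).trans (le_max_left _ _)⟩

theorem LocallyIntegrableOn.intervalIntegrable_Ici {g : ℝ → ℝ} (h : LocallyIntegrableOn g (Ici 0))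
    {s t : ℝ} (hs : 0 ≤ s) (ht : 0 ≤ t) : IntervalIntegrable g volume s t :=
  (locallyIntegrableOn_Ici_iff.1 h s hs).symm.trans (locallyIntegrableOn_Ici_iff.1 h t ht)

theorem continuousOn_primitive_Ici {g : ℝ → ℝ} (h : LocallyIntegrableOn g (Ici 0)) (x₀ : ℝ) :
    ContinuousOn (fun t => x₀ + ∫ s in (0 : ℝ)..t, g s) (Ici 0) := by
  refine continuousOn_const.add ?_
  intro t ht
  have ht' : (0 : ℝ) ≤ t := ht
  have h1 : IntegrableOn g (uIcc 0 (t + 1)) := by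
    rw [uIcc_of_le (by linarith)]
    exact (intervalIntegrable_iff_integrableOn_Icc_of_le (by linarith)).1
      (locallyIntegrableOn_Ici_iff.1 h (t + 1) (by linarith))
  have h2 := intervalIntegral.continuousOn_primitive_interval h1
  rw [uIcc_of_le (by linarith)] at h2
  refine (h2 t ⟨ht, by linarith⟩).mono_of_mem_nhdsWithin ?_
  have : Icc 0 (t + 1) = Ici 0 ∩ Iic (t + 1) := by ext; simp
  rw [this]
  exact inter_mem self_mem_nhdsWithin (mem_nhdsWithin_of_mem_nhds (Iic_mem_nhds (by linarith)))

/-- If `w` is a primitive of `g` on `[0, ∞)`, then `exp (k t) w` is a primitive of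
`exp (k t) (g + k w)`. -/
theorem exp_mul_primitive {g w : ℝ → ℝ} {w₀ : ℝ} (k : ℝ) (hg : LocallyIntegrableOn g (Ici 0))
    (hw : ∀ t, 0 ≤ t → w t = w₀ + ∫ s in (0 : ℝ)..t, g s) {t : ℝ} (ht : 0 ≤ t) :
    Real.exp (k * t) * w t = w₀ + ∫ s in (0 : ℝ)..t, Real.exp (k * s) * (g s + k * w s) := by
  have hgi := locallyIntegrableOn_Ici_iff.1 hg t ht
  have hac : AbsolutelyContinuousOnInterval (fun x => ∫ s in (0 : ℝ)..x, g s) 0 t :=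
    hgi.absolutelyContinuousOnInterval_intervalIntegral left_mem_uIcc
  have hac1 : AbsolutelyContinuousOnInterval (fun x => w₀ + ∫ s in (0 : ℝ)..x, g s) 0 t := by
    have : AbsolutelyContinuousOnInterval (fun _ : ℝ => w₀) 0 t :=
      (contDiff_const.contDiffOn).absolutelyContinuousOnInterval
    exact this.add hac
  have hexp : AbsolutelyContinuousOnInterval (fun s => Real.exp (k * s)) 0 t :=
    ContDiffOn.absolutelyContinuousOnInterval (by fun_prop)
  -- Integration by parts for absolutely continuous functions: `g` is merely integrable, so `w` is
  -- differentiable only almost everywhere.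
  have key := hexp.integral_deriv_mul_eq_sub hac1
  have e : ∫ x in (0 : ℝ)..t, deriv (fun s => Real.exp (k * s)) x * (w₀ + ∫ s in (0 : ℝ)..x, g s)
      + Real.exp (k * x) * deriv (fun x => w₀ + ∫ s in (0 : ℝ)..x, g s) x
      = ∫ s in (0 : ℝ)..t, Real.exp (k * s) * (g s + k * w s) := by
    apply intervalIntegral.integral_congr_ae
    filter_upwards [hgi.ae_hasDerivAt_integral] with x hx hxt
    have hxI : x ∈ uIcc 0 t := uIoc_subset_uIcc hxt
    have h1 := (hx hxI 0 left_mem_uIcc).const_add w₀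
    have h2 : HasDerivAt (fun s => Real.exp (k * s)) (Real.exp (k * x) * k) x := by
      have := ((hasDerivAt_id x).const_mul k).exp
      simpa using this
    rw [h1.deriv, h2.deriv]
    rw [uIoc_of_le ht] at hxt
    rw [hw x hxt.1.le]
    ring
  rw [← e, key, ← hw t ht]
  simp

namespace Problem

variable (P : Problem)

/-- The delay term of the state equation. -/
noncomputable def delay (x : ℝ → ℝ) (t : ℝ) : ℝ := ∫ ξ in (-P.T)..0, P.a ξ * x (t + ξ)

theorem drift_def (x : ℝ → ℝ) (t : ℝ) :
    P.drift x t = P.r * x t + P.f₀ (x t) (P.delay x t) := rfl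

/-- Integrability on the bounded subintervals of `[-T, ∞)`. -/
def PathIntegrable (x : ℝ → ℝ) : Prop := ∀ S, IntegrableOn x (Icc (-P.T) S)

variable {P}

theorem MemW12.continuousOn {T : ℝ} {a : ℝ → ℝ} (hT : 0 < T) (h : MemW12 T a) :
    ContinuousOn a (Icc (-T) 0) := by
  obtain ⟨a', ha', h⟩ := h
  have hi : IntegrableOn a' (Icc (-T) 0) := ha'.integrable (by norm_num)
  have : ContinuousOn (fun ξ => a (-T) + ∫ u in (-T)..ξ, a' u) (Icc (-T) 0) := by
    refine continuousOn_const.add ?_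
    have := intervalIntegral.continuousOn_primitive_interval (f := a') (a := -T) (b := 0)
      (by rwa [uIcc_of_le (by linarith)])
    rwa [uIcc_of_le (by linarith)] at this
  exact this.congr h

namespace StateHypotheses

theorem Cf_nonneg (hs : P.StateHypotheses) : 0 ≤ P.Cf := by
  have := hs.f₀_lipschitz 1 0 0 0 zero_le_one le_rfl
  have h2 := abs_nonneg (P.f₀ 1 0 - P.f₀ 0 0)
  norm_num at this
  linarith

theorem a_continuousOn (hs : P.StateHypotheses) : ContinuousOn P.a (Icc (-P.T) 0) :=
  MemW12.continuousOn hs.T_pos hs.a_mem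

theorem exists_a_bound (hs : P.StateHypotheses) :
    ∃ A, 0 ≤ A ∧ ∀ ξ ∈ Icc (-P.T) 0, P.a ξ ≤ A := by
  obtain ⟨A, hA⟩ := isCompact_Icc.bddAbove_image hs.a_continuousOn
  refine ⟨max A 0, le_max_right _ _, fun ξ hξ => ?_⟩
  exact (hA (mem_image_of_mem _ hξ)).trans (le_max_left _ _)

/-- A continuous function on the line that agrees with the kernel on `[-T, 0]`. -/
theorem exists_a_ext (hs : P.StateHypotheses) :
    ∃ (b : ℝ → ℝ) (A : ℝ), Continuous b ∧ (∀ ξ ∈ Icc (-P.T) 0, b ξ = P.a ξ) ∧ 0 ≤ A ∧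
      (∀ ξ, 0 ≤ b ξ ∧ b ξ ≤ A) := by
  have hT : -P.T ≤ 0 := by linarith [hs.T_pos]
  obtain ⟨A, hA0, hA⟩ := hs.exists_a_bound
  refine ⟨IccExtend hT ((Icc (-P.T) 0).domRestrict P.a), A,
    hs.a_continuousOn.domRestrict.Icc_extend', fun ξ hξ => ?_, hA0, fun ξ => ?_⟩
  · rw [IccExtend_of_mem hT _ hξ]; rfl
  · simp only [IccExtend, Function.comp]
    exact ⟨hs.a_nonneg _ (projIcc _ _ hT ξ).2, hA _ (projIcc _ _ hT ξ).2⟩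

/-- Positivity is assumed only for `y > 0`; the value at `y = 0` is the limit from the right of
positive numbers. -/
theorem f₀_zero_nonneg (hs : P.StateHypotheses) : 0 ≤ P.f₀ 0 0 := by
  have h1 : ContinuousWithinAt (fun y => P.f₀ 0 y) (Ioi 0) 0 := by
    have : LipschitzWith (Real.toNNReal P.Cf) (fun y => P.f₀ 0 y) := by
      refine LipschitzWith.of_dist_le_mul fun y y' => ?_
      have := hs.f₀_lipschitz 0 0 y y' le_rfl le_rfl
      simpa [Real.dist_eq, Real.coe_toNNReal _ hs.Cf_nonneg] using this
    exact this.continuous.continuousWithinAt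
  refine ge_of_tendsto h1 ?_
  filter_upwards [self_mem_nhdsWithin] with y hy
  exact (hs.f₀_pos y hy).le

theorem f₀_le (hs : P.StateHypotheses) {x y : ℝ} (hx : 0 ≤ x) (hy : 0 ≤ y) :
    P.f₀ x y ≤ P.f₀ 0 0 + P.Cf * (x + y) := by
  have := (abs_le.1 (hs.f₀_lipschitz x 0 y 0 hx le_rfl)).2
  rw [sub_zero, sub_zero, abs_of_nonneg hx, abs_of_nonneg hy] at this
  linarith

/-- Monotonicity reduces to `y = 0`, and the Lipschitz bound compares with `f₀ 0 0 ≥ 0`. This is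
what makes the decay `exp (-Cf t)` sustainable without any knowledge of the past beyond its sign. -/
theorem f₀_ge (hs : P.StateHypotheses) {x y : ℝ} (hx : 0 ≤ x) (hy : 0 ≤ y) :
    -P.Cf * x ≤ P.f₀ x y := by
  have := (abs_le.1 (hs.f₀_lipschitz x 0 0 0 hx le_rfl)).1
  rw [sub_zero, sub_zero, abs_of_nonneg hx, abs_zero] at this
  have h2 := hs.f₀_mono x hx hy
  have h3 := hs.f₀_zero_nonneg
  linarith

/-- Adding `Cf x` makes the drift monotone in the state. -/
theorem f₀_add_mono (hs : P.StateHypotheses) {x x' y y' : ℝ} (hx : 0 ≤ x) (hxx : x ≤ x')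
    (hyy : y ≤ y') : P.f₀ x y + P.Cf * x ≤ P.f₀ x' y' + P.Cf * x' := by
  have := (abs_le.1 (hs.f₀_lipschitz x' x y y (hx.trans hxx) hx)).1
  rw [sub_self, abs_zero, abs_of_nonneg (by linarith : 0 ≤ x' - x)] at this
  have h2 := hs.f₀_mono x' (hx.trans hxx) hyy
  linarith

theorem f₀_continuousOn (hs : P.StateHypotheses) :
    ContinuousOn (fun p : ℝ × ℝ => P.f₀ p.1 p.2) (Ici 0 ×ˢ univ) := by
  rw [Metric.continuousOn_iff]
  intro p hp ε hε
  have hC := hs.Cf_nonneg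
  refine ⟨ε / (2 * (P.Cf + 1)), by positivity, fun q hq hqp => ?_⟩
  have h1 := hs.f₀_lipschitz q.1 p.1 q.2 p.2 hq.1 hp.1
  rw [Prod.dist_eq, max_lt_iff, Real.dist_eq, Real.dist_eq] at hqp
  rw [Real.dist_eq]
  have h3 : ε / (2 * (P.Cf + 1)) * (2 * (P.Cf + 1)) = ε := by field_simp
  have h4 : 0 < ε / (2 * (P.Cf + 1)) := by positivity
  nlinarith [hqp.1, hqp.2, abs_nonneg (q.1 - p.1), abs_nonneg (q.2 - p.2)]

section delay

variable (hs : P.StateHypotheses)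
include hs

theorem delay_intervalIntegrable {x : ℝ → ℝ} (hx : P.PathIntegrable x) {t : ℝ} (ht : 0 ≤ t) :
    IntervalIntegrable (fun ξ => P.a ξ * x (t + ξ)) volume (-P.T) 0 := by
  have hT := hs.T_pos
  have h1 : IntervalIntegrable x volume (t + -P.T) (t + 0) := by
    rw [intervalIntegrable_iff_integrableOn_Icc_of_le (by linarith)]
    exact (hx t).mono_set fun u hu => ⟨by linarith [hu.1], by linarith [hu.2]⟩
  have h2 : IntervalIntegrable (fun ξ => x (t + ξ)) volume (-P.T) 0 := by
    have := h1.comp_add_left t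
    simpa using this
  have h3 : ContinuousOn P.a (uIcc (-P.T) 0) := by
    rw [uIcc_of_le (by linarith)]; exact hs.a_continuousOn
  exact h2.continuousOn_mul h3

theorem delay_mono {x y : ℝ → ℝ} (hx : P.PathIntegrable x) (hy : P.PathIntegrable y)
    (hxy : ∀ s, x s ≤ y s) {t : ℝ} (ht : 0 ≤ t) : P.delay x t ≤ P.delay y t := by
  refine intervalIntegral.integral_mono_on (by linarith [hs.T_pos])
    (hs.delay_intervalIntegrable hx ht) (hs.delay_intervalIntegrable hy ht) fun ξ hξ => ?_
  exact mul_le_mul_of_nonneg_left (hxy _) (hs.a_nonneg ξ hξ)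

theorem delay_congr {x y : ℝ → ℝ} (hxy : ∀ᵐ s, -P.T ≤ s → x s = y s) {t : ℝ} (ht : 0 ≤ t) :
    P.delay x t = P.delay y t := by
  refine intervalIntegral.integral_congr_ae ?_
  have := (quasiMeasurePreserving_add_left volume t).ae hxy
  filter_upwards [this] with ξ h hξ
  rw [uIoc_of_le (by linarith [hs.T_pos])] at hξ
  rw [h (by linarith [hξ.1])]

theorem delay_nonneg {x : ℝ → ℝ} (hx : ∀ᵐ s, -P.T ≤ s → 0 ≤ x s) {t : ℝ} (ht : 0 ≤ t) :
    0 ≤ P.delay x t := by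
  unfold delay
  rw [intervalIntegral.integral_of_le (by linarith [hs.T_pos])]
  refine setIntegral_nonneg_of_ae_restrict ?_
  have := (quasiMeasurePreserving_add_left volume t).ae hx
  rw [Filter.EventuallyLE, ae_restrict_iff' measurableSet_Ioc]
  filter_upwards [this] with ξ h hξ
  exact mul_nonneg (hs.a_nonneg ξ (Ioc_subset_Icc_self hξ)) (h (by linarith [hξ.1]))

theorem delay_comb {x y : ℝ → ℝ} (hx : P.PathIntegrable x) (hy : P.PathIntegrable y) (α β : ℝ)
    {t : ℝ} (ht : 0 ≤ t) :
    P.delay (fun s => α * x s + β * y s) t = α * P.delay x t + β * P.delay y t := by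
  unfold delay
  rw [← intervalIntegral.integral_const_mul, ← intervalIntegral.integral_const_mul,
    ← intervalIntegral.integral_add ((hs.delay_intervalIntegrable hx ht).const_mul α)
      ((hs.delay_intervalIntegrable hy ht).const_mul β)]
  congr 1; ext ξ; ring

/-- The past of `x` is only integrable, so continuity must come from the kernel. The substitution `u
= t + ξ` moves the dependence on `t` to `b (u - t)` and to the window `(t - T, t]`. As `t → t₀` the
integrand converges except possibly at the two endpoints of the window, and dominated convergence
applies. -/
theorem delay_continuousOn {x : ℝ → ℝ} (hx : P.PathIntegrable x) :
    ContinuousOn (P.delay x) (Ici 0) := by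
  obtain ⟨b, A, hb, hba, hA, hbA⟩ := hs.exists_a_ext
  have hT := hs.T_pos
  intro t₀ ht₀
  set S := t₀ + 1
  have hrep : ∀ t ∈ Ici (0 : ℝ) ∩ Iic S, P.delay x t
      = ∫ u in Icc (-P.T) S, (Ioc (t - P.T) t).indicator (fun u => b (u - t) * x u) u := by
    intro t ht
    rw [setIntegral_indicator measurableSet_Ioc]
    have : Icc (-P.T) S ∩ Ioc (t - P.T) t = Ioc (t - P.T) t := by
      refine inter_eq_right.2 fun u hu => ⟨?_, ?_⟩
      · have := ht.1; simp only [mem_Ici] at this; linarith [hu.1]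
      · have := ht.2; simp only [mem_Iic] at this; linarith [hu.2]
    rw [this, ← intervalIntegral.integral_of_le (by linarith)]
    unfold delay
    have h := intervalIntegral.integral_comp_add_left (a := -P.T) (b := 0)
      (fun u => b (u - t) * x u) t
    rw [show t - P.T = t + -P.T by ring, show (∫ u in t + -P.T..t, b (u - t) * x u)
      = ∫ u in t + -P.T..t + 0, b (u - t) * x u by simp, ← h]
    refine intervalIntegral.integral_congr fun ξ hξ => ?_
    rw [uIcc_of_le (by linarith)] at hξ
    simp [hba ξ hξ]
  have hnhds : Ici (0 : ℝ) ∩ Iic S ∈ 𝓝[Ici 0] t₀ :=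
    inter_mem self_mem_nhdsWithin (mem_nhdsWithin_of_mem_nhds (Iic_mem_nhds (by simp [S])))
  have hS : t₀ ∈ Ici (0 : ℝ) ∩ Iic S := ⟨ht₀, by simp [S]⟩
  have hxS := hx S
  have : ContinuousWithinAt (fun t => ∫ u in Icc (-P.T) S,
      (Ioc (t - P.T) t).indicator (fun u => b (u - t) * x u) u) (Ici 0) t₀ := by
    refine continuousWithinAt_of_dominated (bound := fun u => A * ‖x u‖) ?_ ?_ ?_ ?_
    · refine Eventually.of_forall fun t => ?_
      refine AEStronglyMeasurable.indicator ?_ measurableSet_Ioc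
      exact (hb.comp (continuous_id.sub continuous_const)).aestronglyMeasurable.mul
        hxS.aestronglyMeasurable
    · refine Eventually.of_forall fun t => Eventually.of_forall fun u => ?_
      refine (norm_indicator_le_norm_self _ _).trans ?_
      rw [norm_mul, Real.norm_of_nonneg (hbA _).1]
      exact mul_le_mul_of_nonneg_right (hbA _).2 (norm_nonneg _)
    · exact hxS.norm.const_mul A
    · have hne : ∀ᵐ u ∂(volume.restrict (Icc (-P.T) S)), u ≠ t₀ ∧ u ≠ t₀ - P.T := by
        refine ae_restrict_of_ae ?_
        have h1 : ∀ᵐ u : ℝ, u ≠ t₀ := by simp [ae_iff, measure_singleton]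
        have h2 : ∀ᵐ u : ℝ, u ≠ t₀ - P.T := by simp [ae_iff, measure_singleton]
        filter_upwards [h1, h2] with u h1 h2 using ⟨h1, h2⟩
      filter_upwards [hne] with u hu
      refine ContinuousAt.continuousWithinAt ?_
      by_cases hmem : u ∈ Ioo (t₀ - P.T) t₀
      · have hev : ∀ᶠ t in 𝓝 t₀, u ∈ Ioc (t - P.T) t := by
          have h1 : ∀ᶠ t in 𝓝 t₀, t < u + P.T := eventually_lt_nhds (by linarith [hmem.1])
          have h2 : ∀ᶠ t in 𝓝 t₀, u < t := eventually_gt_nhds hmem.2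
          filter_upwards [h1, h2] with t h1 h2 using ⟨by linarith, h2.le⟩
        have hc : ContinuousAt (fun t => b (u - t) * x u) t₀ := by fun_prop
        refine hc.congr ?_
        filter_upwards [hev] with t ht
        rw [indicator_of_mem ht]
      · have hev : ∀ᶠ t in 𝓝 t₀, u ∉ Ioc (t - P.T) t := by
          rw [mem_Ioo, not_and_or, not_lt, not_lt] at hmem
          rcases hmem with h | h
          · have h' : u < t₀ - P.T := lt_of_le_of_ne h hu.2
            have h1 : ∀ᶠ t in 𝓝 t₀, u + P.T < t := eventually_gt_nhds (by linarith)
            filter_upwards [h1] with t h1 h2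
            linarith [h2.1]
          · have h' : t₀ < u := lt_of_le_of_ne h (Ne.symm hu.1)
            have h1 : ∀ᶠ t in 𝓝 t₀, t < u := eventually_lt_nhds h'
            filter_upwards [h1] with t h1 h2
            linarith [h2.2]
        refine (continuousAt_const (y := (0 : ℝ))).congr ?_
        filter_upwards [hev] with t ht
        rw [indicator_of_notMem ht]
  refine this.congr_of_eventuallyEq ?_ (hrep t₀ hS)
  filter_upwards [hnhds] with t ht using hrep t ht

theorem drift_continuousOn {x : ℝ → ℝ} (hx : P.PathIntegrable x) (hc : ContinuousOn x (Ici 0))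
    (hpos : ∀ t, 0 ≤ t → 0 ≤ x t) : ContinuousOn (P.drift x) (Ici 0) := by
  have h2 : ContinuousOn (fun t => P.f₀ (x t) (P.delay x t)) (Ici 0) :=
    hs.f₀_continuousOn.comp (hc.prodMk (hs.delay_continuousOn hx))
      fun t ht => ⟨hpos t ht, mem_univ _⟩
  exact (continuousOn_const.mul hc).add h2

end delay

end StateHypotheses

end Problem

end DelayControl

/-! ### Trajectories: convex combinations, choice of the past, a feasible exponential -/

namespace DelayControl

namespace Problem

variable {P : Problem}

/-- `c` is a control and `x` the corresponding trajectory. -/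
structure IsPair (P : Problem) (η : P.H) (c x : ℝ → ℝ) : Prop where
  control : IsControl c
  traj : P.IsPositiveTrajectory η c x

theorem integrableOn_snd (η : P.H) : IntegrableOn η.snd (Icc (-P.T) 0) :=
  (Lp.memLp η.snd).integrable (by norm_num)

theorem HasInitialDatum.ae {η : P.H} {x : ℝ → ℝ} (h : P.HasInitialDatum η x) :
    ∀ᵐ s, s ∈ Ico (-P.T) 0 → x s = η.snd s :=
  (ae_restrict_iff' measurableSet_Ico).1 h.2

theorem hasInitialDatum_of_ae {η : P.H} {x : ℝ → ℝ} (h0 : x 0 = η.fst)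
    (h : ∀ᵐ s, s ∈ Ico (-P.T) 0 → x s = η.snd s) : P.HasInitialDatum η x :=
  ⟨h0, (ae_restrict_iff' measurableSet_Ico).2 h⟩

theorem HasInitialDatum.pathIntegrable {η : P.H} {x : ℝ → ℝ} (h : P.HasInitialDatum η x)
    (hx : LocallyIntegrableOn x (Ici 0)) : P.PathIntegrable x := by
  intro S
  have h1 : IntegrableOn x (Ico (-P.T) 0) :=
    ((integrableOn_snd η).mono_set Ico_subset_Icc_self).congr h.2.symm
  have h2 : IntegrableOn x (Icc 0 (max S 0)) :=
    (intervalIntegrable_iff_integrableOn_Icc_of_le (le_max_right _ _)).1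
      (locallyIntegrableOn_Ici_iff.1 hx _ (le_max_right _ _))
  refine (h1.union h2).mono_set fun s hs => ?_
  rcases lt_or_ge s 0 with h | h
  · exact Or.inl ⟨hs.1, h⟩
  · exact Or.inr ⟨h, hs.2.trans (le_max_left _ _)⟩

theorem _root_.ContinuousOn.locallyIntegrableOn_Ici {g : ℝ → ℝ} (h : ContinuousOn g (Ici 0)) :
    LocallyIntegrableOn g (Ici 0) :=
  h.locallyIntegrableOn measurableSet_Ici

theorem IsPositiveTrajectory.pathIntegrable {η : P.H} {c x : ℝ → ℝ}
    (h : P.IsPositiveTrajectory η c x) : P.PathIntegrable x :=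
  h.initial.pathIntegrable h.cont.locallyIntegrableOn_Ici

theorem IsPositiveTrajectory.ae_nonneg {η : P.H} (hη : η ∈ P.HPlusPlus) {c x : ℝ → ℝ}
    (h : P.IsPositiveTrajectory η c x) : ∀ᵐ s, -P.T ≤ s → 0 ≤ x s := by
  filter_upwards [h.initial.ae, (ae_restrict_iff' measurableSet_Icc).1 hη.2] with s h1 h2 hs
  rcases lt_or_ge s 0 with h' | h'
  · rw [h1 ⟨hs, h'⟩]; exact h2 ⟨hs, h'.le⟩
  · exact (h.pos s h').le

theorem IsPositiveTrajectory.drift_continuousOn (hs : P.StateHypotheses) {η : P.H} {c x : ℝ → ℝ}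
    (h : P.IsPositiveTrajectory η c x) : ContinuousOn (P.drift x) (Ici 0) :=
  hs.drift_continuousOn h.pathIntegrable h.cont fun t ht => (h.pos t ht).le

theorem IsPair.rate_integrable (hs : P.StateHypotheses) {η : P.H} {c x : ℝ → ℝ}
    (h : P.IsPair η c x) : LocallyIntegrableOn (fun t => P.drift x t - c t) (Ici 0) :=
  (h.traj.drift_continuousOn hs).locallyIntegrableOn_Ici.sub h.control.1

theorem IsPair.eq_primitive (hs : P.StateHypotheses) {η : P.H} {c x : ℝ → ℝ}
    (h : P.IsPair η c x) {t : ℝ} (ht : 0 ≤ t) :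
    x t = η.fst + ∫ s in (0 : ℝ)..t, (P.drift x s - c s) := by
  rw [intervalIntegral.integral_sub, h.traj.eqn t ht]
  · ring
  · exact locallyIntegrableOn_Ici_iff.1 (h.traj.drift_continuousOn hs).locallyIntegrableOn_Ici t ht
  · exact locallyIntegrableOn_Ici_iff.1 h.control.1 t ht

/-- A positive path whose rate of change lies below the drift is a trajectory. -/
theorem isPair_of_rate_le (hs : P.StateHypotheses) {η : P.H} {w x : ℝ → ℝ}
    (hi : P.HasInitialDatum η x) (hpos : ∀ t, 0 ≤ t → 0 < x t)
    (hw : LocallyIntegrableOn w (Ici 0))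
    (heq : ∀ t, 0 ≤ t → x t = η.fst + ∫ s in (0 : ℝ)..t, w s)
    (hle : ∀ t, 0 ≤ t → w t ≤ P.drift x t) : P.IsPair η (fun t => P.drift x t - w t) x := by
  have hcont : ContinuousOn x (Ici 0) := (continuousOn_primitive_Ici hw η.fst).congr heq
  have hd : LocallyIntegrableOn (P.drift x) (Ici 0) :=
    (hs.drift_continuousOn (hi.pathIntegrable hcont.locallyIntegrableOn_Ici) hcont
      fun t ht => (hpos t ht).le).locallyIntegrableOn_Ici
  refine ⟨⟨hd.sub hw, fun t ht => sub_nonneg.2 (hle t ht)⟩, hi, hcont, hpos, fun t ht => ?_⟩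
  rw [intervalIntegral.integral_sub (locallyIntegrableOn_Ici_iff.1 hd t ht)
    (locallyIntegrableOn_Ici_iff.1 hw t ht), heq t ht]
  ring

theorem IsPair.congr_control {η : P.H} {c c' x : ℝ → ℝ} (h : P.IsPair η c x)
    (hc : ∀ᵐ t ∂(volume.restrict (Ici (0 : ℝ))), c t = c' t) (hc' : ∀ t, 0 ≤ t → 0 ≤ c' t) :
    P.IsPair η c' x := by
  refine ⟨⟨(locallyIntegrableOn_congr hc).1 h.control.1, hc'⟩, h.traj.initial, h.traj.cont,
    h.traj.pos, fun t ht => ?_⟩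
  rw [h.traj.eqn t ht]
  congr 1
  refine intervalIntegral.integral_congr_ae ?_
  filter_upwards [(ae_restrict_iff' measurableSet_Ici).1 hc] with s hs hst
  rw [uIoc_of_le ht] at hst
  exact hs hst.1.le

/-- Convex combinations of trajectories with the same past are trajectories, with a control above
the convex combination of the controls. -/
theorem IsPair.convexCombination (hs : P.StateHypotheses) {η η' ζ : P.H} {c c' x x' : ℝ → ℝ}
    (h : P.IsPair η c x) (h' : P.IsPair η' c' x') {α β : ℝ} (hα : 0 ≤ α) (hβ : 0 ≤ β)
    (hαβ : α + β = 1) (hζ : ζ.fst = α * η.fst + β * η'.fst) (hζ₁ : ζ.snd = η.snd)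
    (hζ₂ : ζ.snd = η'.snd) :
    ∃ d, P.IsPair ζ d (fun t => α * x t + β * x' t) ∧
      ∀ t, 0 ≤ t → α * c t + β * c' t ≤ d t := by
  set w : ℝ → ℝ := fun t => α * (P.drift x t - c t) + β * (P.drift x' t - c' t)
  -- Linearity of the delay and joint concavity of `f₀`: the combined path has a drift at least as
  -- large as the combined drifts, and the surplus can be consumed.
  have hdr : ∀ t, 0 ≤ t → α * P.drift x t + β * P.drift x' t
      ≤ P.drift (fun t => α * x t + β * x' t) t := by
    intro t ht
    simp only [drift_def]
    rw [hs.delay_comb h.traj.pathIntegrable h'.traj.pathIntegrable α β ht]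
    have := hs.f₀_concave.2 (x := (x t, P.delay x t)) (y := (x' t, P.delay x' t))
      ⟨(h.traj.pos t ht).le, mem_univ _⟩ ⟨(h'.traj.pos t ht).le, mem_univ _⟩ hα hβ hαβ
    simp only [smul_eq_mul, Prod.smul_mk, Prod.mk_add_mk] at this
    linarith
  have key := isPair_of_rate_le (η := ζ) (w := w) (x := fun t => α * x t + β * x' t) hs ?_ ?_ ?_ ?_ ?_
  · refine ⟨_, key, fun t ht => ?_⟩
    have := hdr t ht
    simp only [w]
    linarith
  · refine hasInitialDatum_of_ae ?_ ?_
    · simp only [h.traj.initial.1, h'.traj.initial.1, hζ]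
    · filter_upwards [h.traj.initial.ae, h'.traj.initial.ae] with s h1 h2 hs
      rw [h1 hs, h2 hs, ← hζ₁, ← hζ₂, ← add_mul, hαβ, one_mul]
  · intro t ht
    have h1 := h.traj.pos t ht
    have h2 := h'.traj.pos t ht
    rcases hα.eq_or_lt with h0 | h0
    · have : β = 1 := by linarith
      simp [← h0, this, h2]
    · have := mul_pos h0 h1
      have := mul_nonneg hβ h2.le
      linarith
  · exact ((h.rate_integrable hs).smul α).add ((h'.rate_integrable hs).smul β)
  · intro t ht
    have i1 := locallyIntegrableOn_Ici_iff.1 (h.rate_integrable hs) t ht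
    have i2 := locallyIntegrableOn_Ici_iff.1 (h'.rate_integrable hs) t ht
    simp only [w]
    rw [intervalIntegral.integral_add (i1.const_mul α) (i2.const_mul β),
      intervalIntegral.integral_const_mul, intervalIntegral.integral_const_mul, hζ]
    rw [h.eq_primitive hs ht, h'.eq_primitive hs ht]
    ring
  · intro t ht
    have := hdr t ht
    have h1 := h.control.2 t ht
    have h2 := h'.control.2 t ht
    simp only [w]
    nlinarith [mul_nonneg hα h1, mul_nonneg hβ h2]

/-- The path that follows the past of `η` and then `z`. -/
noncomputable def glue (η : P.H) (z : ℝ → ℝ) : ℝ → ℝ := fun s => if s < 0 then η.snd s else z s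

theorem glue_of_nonneg (η : P.H) (z : ℝ → ℝ) {s : ℝ} (hs : 0 ≤ s) : glue η z s = z s := by
  simp [glue, not_lt.2 hs]

theorem glue_of_neg (η : P.H) (z : ℝ → ℝ) {s : ℝ} (hs : s < 0) : glue η z s = η.snd s := by
  simp [glue, hs]

theorem glue_hasInitialDatum (η : P.H) {z : ℝ → ℝ} (h0 : z 0 = η.fst) :
    P.HasInitialDatum η (glue η z) :=
  hasInitialDatum_of_ae (by rw [glue_of_nonneg _ _ le_rfl, h0])
    (Eventually.of_forall fun _ hs => glue_of_neg _ _ hs.2)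

/-- The trajectory may be taken equal to the chosen representative of the past. -/
theorem IsPair.glue (hs : P.StateHypotheses) {η : P.H} {c x : ℝ → ℝ} (h : P.IsPair η c x) :
    P.IsPair η c (glue η x) := by
  have e : ∀ᵐ s, -P.T ≤ s → x s = Problem.glue η x s := by
    filter_upwards [h.traj.initial.ae] with s h1 h2
    rcases lt_or_ge s 0 with h' | h'
    · rw [glue_of_neg _ _ h', h1 ⟨h2, h'⟩]
    · rw [glue_of_nonneg _ _ h']
  have hd : ∀ t, 0 ≤ t → P.drift (Problem.glue η x) t = P.drift x t := by
    intro t ht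
    rw [drift_def, drift_def, hs.delay_congr e ht, glue_of_nonneg _ _ ht]
  refine ⟨h.control, glue_hasInitialDatum η h.traj.initial.1,
    h.traj.cont.congr fun t ht => glue_of_nonneg _ _ ht,
    fun t ht => by rw [glue_of_nonneg _ _ ht]; exact h.traj.pos t ht, fun t ht => ?_⟩
  rw [glue_of_nonneg _ _ ht, h.traj.eqn t ht]
  congr 2
  refine intervalIntegral.integral_congr fun s hs => ?_
  rw [uIcc_of_le ht] at hs
  exact (hd s hs.1).symm

/-- The rate `-Cf z` lies below the drift, because `f₀ x y ≥ -Cf x` when the delay term is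
nonnegative; everything above it is consumed. The integrability hypothesis on `U₂` is about exactly
this decay, so the pair bounds the value function from below. -/
theorem exists_exponential_pair (hs : P.StateHypotheses) {η : P.H} (hη : η ∈ P.HPlusPlus) :
    ∃ c x, P.IsPair η c x ∧ ∀ t, 0 ≤ t → x t = η.fst * Real.exp (-P.Cf * t) := by
  set z : ℝ → ℝ := fun t => η.fst * Real.exp (-P.Cf * t)
  have hz : ∀ t, HasDerivAt z (-P.Cf * z t) t := by
    intro t
    have := (((hasDerivAt_id t).const_mul (-P.Cf)).exp).const_mul η.fst
    convert! this using 1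
    simp [z]; ring
  have hzc : Continuous z := by fun_prop
  have hz0 : z 0 = η.fst := by simp [z]
  have hpos : ∀ t, 0 < z t := fun t => mul_pos hη.1 (Real.exp_pos _)
  have hi := glue_hasInitialDatum η hz0
  have hnn : ∀ᵐ s, -P.T ≤ s → 0 ≤ glue η z s := by
    filter_upwards [(ae_restrict_iff' measurableSet_Icc).1 hη.2] with s h2 hs
    rcases lt_or_ge s 0 with h' | h'
    · rw [glue_of_neg _ _ h']; exact h2 ⟨hs, h'.le⟩
    · rw [glue_of_nonneg _ _ h']; exact (hpos s).le
  refine ⟨_, glue η z, isPair_of_rate_le (w := fun t => -P.Cf * z t) hs hi ?_ ?_ ?_ ?_, ?_⟩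
  · intro t ht; rw [glue_of_nonneg _ _ ht]; exact hpos t
  · exact (ContinuousOn.locallyIntegrableOn_Ici (by fun_prop))
  · intro t ht
    rw [glue_of_nonneg _ _ ht, intervalIntegral.integral_eq_sub_of_hasDerivAt (fun s _ => hz s)
      (Continuous.intervalIntegrable (by fun_prop) _ _), hz0]
    ring
  · intro t ht
    rw [drift_def, glue_of_nonneg _ _ ht]
    have h1 := hs.f₀_ge (hpos t).le (hs.delay_nonneg hnn ht)
    have h2 := mul_pos hs.r_pos (hpos t)
    linarith
  · intro t ht; rw [glue_of_nonneg _ _ ht]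

end Problem

end DelayControl

/-! ### Payoffs, finiteness of the value function, near-optimal pairs -/

namespace DelayControl

theorem eintegral_of_integrable {μ : Measure ℝ} {f : ℝ → ℝ} (hf : Integrable f μ) :
    eintegral μ f = ((∫ t, f t ∂μ : ℝ) : EReal) := by
  have h1 := hf.lintegral_lt_top
  have h2 := hf.neg.lintegral_lt_top
  rw [integral_eq_lintegral_pos_part_sub_lintegral_neg_part hf, EReal.coe_sub]
  unfold eintegral
  simp only [Pi.neg_apply] at h2
  rw [← EReal.coe_ennreal_toReal h1.ne, ← EReal.coe_ennreal_toReal h2.ne]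

/-- The bound `g` keeps the positive part finite, so non-integrability can only come from an
infinite negative part. -/
theorem eintegral_of_not_integrable {μ : Measure ℝ} {f g : ℝ → ℝ} (hfm : AEStronglyMeasurable f μ)
    (hg : Integrable g μ) (hfg : ∀ᵐ t ∂μ, f t ≤ g t) (hf : ¬ Integrable f μ) :
    eintegral μ f = ⊥ := by
  have h1 : ∫⁻ t, ENNReal.ofReal (f t) ∂μ < ⊤ := by
    refine lt_of_le_of_lt (lintegral_mono_ae ?_) hg.lintegral_lt_top
    filter_upwards [hfg] with t ht using ENNReal.ofReal_le_ofReal ht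
  have h2 : ∫⁻ t, ENNReal.ofReal (-f t) ∂μ = ⊤ := by
    by_contra hne
    refine hf ⟨hfm, ?_⟩
    rw [hasFiniteIntegral_iff_norm]
    have : ∀ t, ENNReal.ofReal ‖f t‖ ≤ ENNReal.ofReal (f t) + ENNReal.ofReal (-f t) := by
      intro t
      rw [Real.norm_eq_abs]
      rcases le_total 0 (f t) with h | h
      · rw [abs_of_nonneg h]; exact le_self_add
      · rw [abs_of_nonpos h]; exact le_add_self
    refine lt_of_le_of_lt (lintegral_mono this) ?_
    rw [lintegral_add_left' hfm.aemeasurable.ennreal_ofReal]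
    exact ENNReal.add_lt_top.2 ⟨h1, lt_top_iff_ne_top.2 hne⟩
  unfold eintegral
  rw [h2, EReal.coe_ennreal_top, EReal.sub_top]

namespace Problem

variable {P : Problem}

/-- The discounted utility of a consumption path. -/
noncomputable def payoff₁ (P : Problem) (c : ℝ → ℝ) : ℝ :=
  ∫ t in Ioi (0 : ℝ), Real.exp (-P.ρ * t) * P.U₁ (c t)

/-- The discounted utility of a state path. -/
noncomputable def payoff₂ (P : Problem) (x : ℝ → ℝ) : ℝ :=
  ∫ t in Ioi (0 : ℝ), Real.exp (-P.ρ * t) * P.U₂ (x t)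

/-- The state path has a finite discounted utility. -/
def FinitePayoff₂ (P : Problem) (x : ℝ → ℝ) : Prop :=
  IntegrableOn (fun t => Real.exp (-P.ρ * t) * P.U₂ (x t)) (Ioi 0)

/-- The value function as a real number. -/
noncomputable def val (P : Problem) (η : P.H) : ℝ := (P.V η).toReal

namespace UtilityHypotheses

variable (hu : P.UtilityHypotheses)
include hu

theorem integrable_discount (K : ℝ) :
    IntegrableOn (fun t => Real.exp (-P.ρ * t) * K) (Ioi 0) :=
  (exp_neg_integrableOn_Ioi 0 hu.ρ_pos).mul_const K

theorem aestronglyMeasurable_U₁ {s : Set ℝ} (hs : MeasurableSet s) {c : ℝ → ℝ}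
    (hc : AEStronglyMeasurable c (volume.restrict s))
    (hpos : ∀ t ∈ s, 0 ≤ c t) :
    AEStronglyMeasurable (fun t => P.U₁ (c t)) (volume.restrict s) := by
  have hcont : Continuous (fun y => P.U₁ (max y 0)) :=
    hu.U₁_cont.comp_continuous (by fun_prop) fun y => le_max_right y 0
  refine (hcont.comp_aestronglyMeasurable hc).congr ?_
  refine (ae_restrict_iff' hs).2 (Eventually.of_forall fun t ht => ?_)
  simp [max_eq_left (hpos t ht)]

theorem aestronglyMeasurable_U₂ {s : Set ℝ} (hs : MeasurableSet s) {x : ℝ → ℝ}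
    (hx : AEStronglyMeasurable x (volume.restrict s)) (hpos : ∀ t ∈ s, 0 < x t) :
    AEStronglyMeasurable (fun t => P.U₂ (x t)) (volume.restrict s) := by
  classical
  have hm : Measurable ((Ioi (0 : ℝ)).piecewise P.U₂ 0) :=
    hu.U₂_cont.measurable_piecewise continuousOn_const measurableSet_Ioi
  refine (hm.comp_aemeasurable hx.aemeasurable).aestronglyMeasurable.congr ?_
  refine (ae_restrict_iff' hs).2 (Eventually.of_forall fun t ht => ?_)
  simp [hpos t ht]

theorem integrable₁ {c : ℝ → ℝ} (hc : IsControl c) :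
    IntegrableOn (fun t => Real.exp (-P.ρ * t) * P.U₁ (c t)) (Ioi 0) := by
  obtain ⟨K, hK⟩ := hu.U₁_bdd
  refine Integrable.mono' (hu.integrable_discount K) ?_ ?_
  · exact (Continuous.aestronglyMeasurable (by fun_prop)).mul
      (hu.aestronglyMeasurable_U₁ measurableSet_Ioi
        (hc.1.aestronglyMeasurable.mono_measure (Measure.restrict_mono Ioi_subset_Ici_self le_rfl))
        fun t ht => hc.2 t (le_of_lt ht))
  · refine (ae_restrict_iff' measurableSet_Ioi).2 (Eventually.of_forall fun t ht => ?_)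
    rw [norm_mul, Real.norm_of_nonneg (Real.exp_pos _).le]
    exact mul_le_mul_of_nonneg_left (hK _ (hc.2 t (le_of_lt ht))) (Real.exp_pos _).le

theorem payoff₁_mono {c d : ℝ → ℝ} (hc : IsControl c) (hd : IsControl d)
    (h : ∀ᵐ t ∂(volume.restrict (Ioi (0 : ℝ))), P.U₁ (c t) ≤ P.U₁ (d t)) :
    P.payoff₁ c ≤ P.payoff₁ d := by
  refine integral_mono_ae (hu.integrable₁ hc) (hu.integrable₁ hd) ?_
  filter_upwards [h] with t ht
  exact mul_le_mul_of_nonneg_left ht (Real.exp_pos _).le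

theorem integrable₂_of_ge {g x : ℝ → ℝ} (hg : IntegrableOn g (Ioi 0))
    (hx : AEStronglyMeasurable x (volume.restrict (Ioi 0))) (hpos : ∀ t, 0 < t → 0 < x t)
    (hgx : ∀ t, 0 < t → g t ≤ Real.exp (-P.ρ * t) * P.U₂ (x t)) : P.FinitePayoff₂ x := by
  obtain ⟨K, hK⟩ := hu.U₂_bdd
  refine Integrable.mono' (hg.norm.add (hu.integrable_discount |K|)) ?_ ?_
  · exact (Continuous.aestronglyMeasurable (by fun_prop)).mul
      (hu.aestronglyMeasurable_U₂ measurableSet_Ioi hx hpos)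
  · refine (ae_restrict_iff' measurableSet_Ioi).2 (Eventually.of_forall fun t ht => ?_)
    have h1 := hgx t ht
    have h2 : Real.exp (-P.ρ * t) * P.U₂ (x t) ≤ Real.exp (-P.ρ * t) * |K| :=
      mul_le_mul_of_nonneg_left ((hK _ (hpos t ht)).trans (le_abs_self K)) (Real.exp_pos _).le
    have h3 : 0 ≤ Real.exp (-P.ρ * t) * |K| := by positivity
    simp only [Pi.add_apply, Real.norm_eq_abs]
    rw [abs_le]
    constructor
    · linarith [neg_abs_le (g t)]
    · linarith [abs_nonneg (g t)]

theorem payoff₂_mono {x y : ℝ → ℝ} (hy : P.FinitePayoff₂ y)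
    (hx : AEStronglyMeasurable x (volume.restrict (Ioi 0))) (hpos : ∀ t, 0 < t → 0 < y t)
    (hyx : ∀ t, 0 < t → y t ≤ x t) : P.FinitePayoff₂ x ∧ P.payoff₂ y ≤ P.payoff₂ x := by
  have h1 : ∀ t, 0 < t → Real.exp (-P.ρ * t) * P.U₂ (y t) ≤ Real.exp (-P.ρ * t) * P.U₂ (x t) :=
    fun t ht => mul_le_mul_of_nonneg_left
      (hu.U₂_mono (hpos t ht) ((hpos t ht).trans_le (hyx t ht)) (hyx t ht)) (Real.exp_pos _).le
  have h2 := hu.integrable₂_of_ge hy hx (fun t ht => (hpos t ht).trans_le (hyx t ht)) h1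
  exact ⟨h2, setIntegral_mono_on hy h2 measurableSet_Ioi fun t ht => h1 t ht⟩

/-- For `b ≥ 1` this is monotonicity of `U₂`. For `b < 1` and `Cf > 0` the factor `b` is a time
shift: `b = exp (-Cf τ)` with `τ > 0`, and the discount absorbs the shift. For `Cf = 0` the path is
constant. -/
theorem exp_finitePayoff₂ (hs : P.StateHypotheses) {b : ℝ} (hb : 0 < b) :
    P.FinitePayoff₂ (fun t => b * Real.exp (-P.Cf * t)) := by
  rcases le_or_gt 1 b with h1 | h1
  · refine (hu.payoff₂_mono (y := fun t => Real.exp (-P.Cf * t)) hu.U₂_int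
      (Continuous.aestronglyMeasurable (by fun_prop)) (fun t _ => Real.exp_pos _)
      fun t _ => ?_).1
    have := Real.exp_pos (-P.Cf * t)
    nlinarith
  · rcases hs.Cf_nonneg.eq_or_lt with h0 | h0
    · unfold FinitePayoff₂
      simpa [← h0] using hu.integrable_discount (P.U₂ b)
    · set τ := -Real.log b / P.Cf
      have hτ : 0 < τ := div_pos (by linarith [Real.log_neg hb h1]) h0
      have hbτ : b = Real.exp (-P.Cf * τ) := by
        rw [show -P.Cf * τ = Real.log b by simp only [τ]; field_simp, Real.exp_log hb]
      have h2 : IntegrableOn (fun t => Real.exp (-P.ρ * t) * P.U₂ (Real.exp (-P.Cf * t)))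
          (Ioi τ) := hu.U₂_int.mono_set (Ioi_subset_Ioi hτ.le)
      have h3 := (measurePreserving_add_right volume τ).integrableOn_comp_preimage
        (measurableEmbedding_addRight τ) (s := Ioi τ)
        (f := fun t => Real.exp (-P.ρ * t) * P.U₂ (Real.exp (-P.Cf * t)))
      have h4 := (h3.2 h2).const_mul (Real.exp (P.ρ * τ))
      have h5 : (fun x => x + τ) ⁻¹' Ioi τ = Ioi 0 := by ext; simp
      rw [h5] at h4
      refine h4.congr (Eventually.of_forall fun t => ?_)
      simp only [Function.comp]
      rw [← mul_assoc, ← Real.exp_add, hbτ, ← Real.exp_add]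
      ring_nf

theorem payoff_eq {η : P.H} {c x : ℝ → ℝ} (h : P.IsPair η c x) (hf : P.FinitePayoff₂ x) :
    P.payoff c x = ((P.payoff₁ c + P.payoff₂ x : ℝ) : EReal) := by
  have h1 := hu.integrable₁ h.control
  have e : (fun t => Real.exp (-P.ρ * t) * (P.U₁ (c t) + P.U₂ (x t)))
    = fun t => Real.exp (-P.ρ * t) * P.U₁ (c t) + Real.exp (-P.ρ * t) * P.U₂ (x t) := by
      ext; ring
  unfold payoff
  rw [e]
  refine (eintegral_of_integrable (h1.add hf)).trans ?_
  congr 1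
  exact integral_add h1 hf

theorem payoff_eq_bot {η : P.H} {c x : ℝ → ℝ} (h : P.IsPair η c x) (hf : ¬ P.FinitePayoff₂ x) :
    P.payoff c x = ⊥ := by
  have h1 := hu.integrable₁ h.control
  obtain ⟨K, hK⟩ := hu.U₂_bdd
  have e : (fun t => Real.exp (-P.ρ * t) * (P.U₁ (c t) + P.U₂ (x t)))
    = fun t => Real.exp (-P.ρ * t) * P.U₁ (c t) + Real.exp (-P.ρ * t) * P.U₂ (x t) := by
      ext; ring
  have hm : AEStronglyMeasurable (fun t => Real.exp (-P.ρ * t) * P.U₂ (x t))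
      (volume.restrict (Ioi 0)) :=
    (Continuous.aestronglyMeasurable (by fun_prop)).mul
      (hu.aestronglyMeasurable_U₂ measurableSet_Ioi
        ((h.traj.cont.mono Ioi_subset_Ici_self).aestronglyMeasurable measurableSet_Ioi)
        fun t ht => h.traj.pos t (le_of_lt ht))
  unfold payoff
  rw [e]
  refine eintegral_of_not_integrable (h1.aestronglyMeasurable.add hm)
    (h1.add (hu.integrable_discount K)) ?_ ?_
  · refine (ae_restrict_iff' measurableSet_Ioi).2 (Eventually.of_forall fun t ht => ?_)
    have := mul_le_mul_of_nonneg_left (hK _ (h.traj.pos t (le_of_lt ht)))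
      (Real.exp_pos (-P.ρ * t)).le
    simp only [Pi.add_apply]
    linarith
  · intro hi
    refine hf ?_
    have := hi.sub h1
    refine this.congr (Eventually.of_forall fun t => ?_)
    simp

theorem exists_payoff_bound : ∃ B : ℝ, ∀ (η : P.H) (c x : ℝ → ℝ), P.IsPair η c x →
    P.payoff c x ≤ (B : EReal) ∧
    (P.FinitePayoff₂ x → P.payoff₁ c + P.payoff₂ x ≤ B) := by
  obtain ⟨K₁, hK₁⟩ := hu.U₁_bdd
  obtain ⟨K₂, hK₂⟩ := hu.U₂_bdd
  set B := (∫ t in Ioi (0 : ℝ), Real.exp (-P.ρ * t) * K₁)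
    + ∫ t in Ioi (0 : ℝ), Real.exp (-P.ρ * t) * K₂
  have key : ∀ (η : P.H) (c x : ℝ → ℝ), P.IsPair η c x → P.FinitePayoff₂ x →
      P.payoff₁ c + P.payoff₂ x ≤ B := by
    intro η c x h hf
    refine add_le_add ?_ ?_
    · refine setIntegral_mono_on (hu.integrable₁ h.control) (hu.integrable_discount _)
        measurableSet_Ioi fun t ht => ?_
      exact mul_le_mul_of_nonneg_left ((le_abs_self _).trans (hK₁ _ (h.control.2 t (le_of_lt ht))))
        (Real.exp_pos _).le
    · refine setIntegral_mono_on hf (hu.integrable_discount _)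
        measurableSet_Ioi fun t ht => ?_
      exact mul_le_mul_of_nonneg_left (hK₂ _ (h.traj.pos t (le_of_lt ht))) (Real.exp_pos _).le
  refine ⟨B, fun η c x h => ⟨?_, key η c x h⟩⟩
  by_cases hf : P.FinitePayoff₂ x
  · rw [hu.payoff_eq h hf]; exact_mod_cast key η c x h hf
  · rw [hu.payoff_eq_bot h hf]; exact bot_le

end UtilityHypotheses

theorem payoff_le_J {η : P.H} {c x : ℝ → ℝ} (h : P.IsPair η c x) : P.payoff c x ≤ P.J η c :=
  le_iSup₂_of_le x h.traj le_rfl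

theorem J_le_V {η : P.H} {c : ℝ → ℝ} (h : c ∈ P.admissible η) : P.J η c ≤ P.V η :=
  le_iSup₂_of_le c h le_rfl

theorem IsPair.mem_admissible {η : P.H} {c x : ℝ → ℝ} (h : P.IsPair η c x) : c ∈ P.admissible η :=
  ⟨h.control, x, h.traj⟩

theorem payoff_le_V {η : P.H} {c x : ℝ → ℝ} (h : P.IsPair η c x) : P.payoff c x ≤ P.V η :=
  (payoff_le_J h).trans (J_le_V h.mem_admissible)

theorem V_le {η : P.H} {b : EReal} (h : ∀ c x, P.IsPair η c x → P.payoff c x ≤ b) : P.V η ≤ b :=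
  iSup₂_le fun c hc => iSup₂_le fun x hx => h c x ⟨hc.1, hx⟩

section value

variable (hs : P.StateHypotheses) (hu : P.UtilityHypotheses)
include hs hu

omit hs in
theorem exists_val_bound : ∃ B : ℝ, ∀ η ∈ P.HPlusPlus, P.V η ≤ (B : EReal) := by
  obtain ⟨B, hB⟩ := hu.exists_payoff_bound
  exact ⟨B, fun η _ => V_le fun c x h => (hB η c x h).1⟩

/-- The constant does not depend on `η`: consumption contributes at least the discounted lower bound
of `U₁`, and the state utility of the exponential pair depends on `η` only through its present. -/
theorem V_ge_exponential : ∃ B : ℝ, ∀ η ∈ P.HPlusPlus,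
    ((B + P.payoff₂ (fun t => η.fst * Real.exp (-P.Cf * t)) : ℝ) : EReal) ≤ P.V η := by
  obtain ⟨K₁, hK₁⟩ := hu.U₁_bdd
  refine ⟨∫ t in Ioi (0 : ℝ), Real.exp (-P.ρ * t) * (-K₁), fun η hη => ?_⟩
  obtain ⟨c, x, h, hx⟩ := exists_exponential_pair hs hη
  have hf := hu.exp_finitePayoff₂ hs hη.1
  have hcong : ∀ t ∈ Ioi (0 : ℝ), Real.exp (-P.ρ * t) * P.U₂ (η.fst * Real.exp (-P.Cf * t))
      = Real.exp (-P.ρ * t) * P.U₂ (x t) := fun t ht => by rw [hx t (le_of_lt ht)]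
  have hf' : P.FinitePayoff₂ x := IntegrableOn.congr_fun hf hcong measurableSet_Ioi
  have e : P.payoff₂ (fun t => η.fst * Real.exp (-P.Cf * t)) = P.payoff₂ x :=
    setIntegral_congr_fun measurableSet_Ioi hcong
  refine le_trans ?_ (payoff_le_V h)
  rw [hu.payoff_eq h hf', e]
  refine EReal.coe_le_coe_iff.2 (add_le_add_left ?_ _)
  refine setIntegral_mono_on (hu.integrable_discount _) (hu.integrable₁ h.control)
    measurableSet_Ioi fun t ht => ?_
  exact mul_le_mul_of_nonneg_left (neg_le_of_abs_le (hK₁ _ (h.control.2 t (le_of_lt ht))))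
    (Real.exp_pos _).le

theorem bot_lt_V {η : P.H} (hη : η ∈ P.HPlusPlus) : ⊥ < P.V η := by
  obtain ⟨B, hB⟩ := V_ge_exponential hs hu
  exact (EReal.bot_lt_coe _).trans_le (hB η hη)

theorem mem_domV {η : P.H} (hη : η ∈ P.HPlusPlus) : η ∈ P.domV := ⟨hη.1, bot_lt_V hs hu hη⟩

theorem coe_val {η : P.H} (hη : η ∈ P.HPlusPlus) : ((P.val η : ℝ) : EReal) = P.V η := by
  obtain ⟨B, hB⟩ := exists_val_bound hu
  exact EReal.coe_toReal ((hB η hη).trans_lt (EReal.coe_lt_top B)).ne (bot_lt_V hs hu hη).ne'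

theorem payoff_le_val {η : P.H} (hη : η ∈ P.HPlusPlus) {c x : ℝ → ℝ} (h : P.IsPair η c x)
    (hf : P.FinitePayoff₂ x) : P.payoff₁ c + P.payoff₂ x ≤ P.val η := by
  have := payoff_le_V h
  rw [hu.payoff_eq h hf, ← coe_val hs hu hη] at this
  exact_mod_cast this

theorem exists_val_sub_lt {η : P.H} (hη : η ∈ P.HPlusPlus) {ε : ℝ} (hε : 0 < ε) :
    ∃ c x, P.IsPair η c x ∧ P.FinitePayoff₂ x ∧ P.val η - ε < P.payoff₁ c + P.payoff₂ x := by
  by_contra hcon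
  push Not at hcon
  have h1 : P.V η ≤ ((P.val η - ε : ℝ) : EReal) := by
    refine V_le fun c x h => ?_
    by_cases hf : P.FinitePayoff₂ x
    · rw [hu.payoff_eq h hf]; exact_mod_cast hcon c x h hf
    · rw [hu.payoff_eq_bot h hf]; exact bot_le
  rw [← coe_val hs hu hη] at h1
  have h2 : P.val η ≤ P.val η - ε := by exact_mod_cast h1
  linarith

theorem J_eq_V_of_le {η : P.H} (hη : η ∈ P.HPlusPlus) {c x : ℝ → ℝ} (h : P.IsPair η c x)
    (hf : P.FinitePayoff₂ x) (hle : P.val η ≤ P.payoff₁ c + P.payoff₂ x) : P.J η c = P.V η := by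
  refine le_antisymm (J_le_V h.mem_admissible) (le_trans ?_ (payoff_le_J h))
  rw [hu.payoff_eq h hf, ← coe_val hs hu hη]
  exact_mod_cast hle

theorem val_bounds : ∃ B : ℝ, ∀ η ∈ P.HPlusPlus, P.val η ≤ B ∧
    -B + P.payoff₂ (fun t => η.fst * Real.exp (-P.Cf * t)) ≤ P.val η := by
  obtain ⟨B₁, h1⟩ := exists_val_bound hu
  obtain ⟨B₂, h2⟩ := V_ge_exponential hs hu
  refine ⟨max B₁ (-B₂), fun η hη => ?_⟩
  have e := coe_val hs hu hη
  have h3 := h1 η hη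
  have h4 := h2 η hη
  rw [← e] at h3 h4
  have h3' : P.val η ≤ B₁ := by exact_mod_cast h3
  have h4' : B₂ + P.payoff₂ (fun t => η.fst * Real.exp (-P.Cf * t)) ≤ P.val η := by
    exact_mod_cast h4
  have := le_max_left B₁ (-B₂)
  have := le_max_right B₁ (-B₂)
  constructor <;> linarith

end value

end Problem

end DelayControl

/-! ### Marginal utility, quantitative strict concavity, concavity of the value function -/

namespace DelayControl

/-- A sequence of reals whose increments are geometrically small while the sequence stays below
the identity, and which is frequently bounded, converges. -/
theorem exists_tendsto_of_increments {d : ℕ → ℝ}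
    (h1 : ∀ᶠ k in atTop, d k ≤ k → |d k - d (k + 1)| < (1 / 2) ^ k)
    (h2 : ∃ R, ∃ᶠ k in atTop, d k ≤ R) : ∃ l, Tendsto d atTop (𝓝 l) := by
  obtain ⟨R, hR⟩ := h2
  obtain ⟨N, hN⟩ := eventually_atTop.1 h1
  -- The increments after an index `k₀` sum to at most `2`. Starting below `R` at some `k₀ ≥ R + 2`,
  -- the sequence stays below `R + 2 ≤ k` forever, so the increment estimate never ceases to apply.
  obtain ⟨M, hM⟩ := exists_nat_ge (R + 2)
  obtain ⟨k₀, hk₀, hdk⟩ := frequently_atTop.1 hR (max N M)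
  have hkM : R + 2 ≤ k₀ := hM.trans (by exact_mod_cast (le_max_right N M).trans hk₀)
  have hkN : N ≤ k₀ := (le_max_left N M).trans hk₀
  have hpow : ∀ j : ℕ, ((1 : ℝ) / 2) ^ (k₀ + j) ≤ (1 / 2) ^ j := fun j =>
    pow_le_pow_of_le_one (by norm_num) (by norm_num) (by omega)
  have hbd : ∀ j : ℕ, d (k₀ + j) ≤ R + 2 - 2 * (1 / 2) ^ j := by
    intro j
    induction j with
    | zero => simpa using hdk
    | succ j ih =>
      have hpos : (0 : ℝ) < (1 / 2) ^ j := by positivity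
      have h3 : d (k₀ + j) ≤ ((k₀ + j : ℕ) : ℝ) := by push_cast; linarith [Nat.cast_nonneg (α := ℝ) j]
      have h4 := hN (k₀ + j) (by omega) h3
      have h5 := (abs_lt.1 h4).1
      have h6 := hpow j
      rw [pow_succ, ← add_assoc]
      linarith
  have hstep : ∀ j : ℕ, dist (d (j + k₀)) (d (j + 1 + k₀)) ≤ 1 * (1 / 2) ^ j := by
    intro j
    have h3 : d (k₀ + j) ≤ ((k₀ + j : ℕ) : ℝ) := by
      have := hbd j
      have hpos : (0 : ℝ) < (1 / 2) ^ j := by positivity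
      push_cast; linarith [Nat.cast_nonneg (α := ℝ) j]
    have h4 := hN (k₀ + j) (by omega) h3
    rw [Real.dist_eq, show j + k₀ = k₀ + j by omega, show j + 1 + k₀ = k₀ + j + 1 by omega]
    linarith [hpow j]
  have hc := cauchySeq_of_le_geometric (1 / 2) 1 (by norm_num) hstep
  obtain ⟨l, hl⟩ := cauchySeq_tendsto_of_complete hc
  exact ⟨l, (tendsto_add_atTop_iff_nat k₀).1 hl⟩

namespace Problem

variable {P : Problem}

namespace UtilityHypotheses

variable (hu : P.UtilityHypotheses)
include hu

theorem differentiableAt_U₁ {c : ℝ} (hc : 0 < c) : DifferentiableAt ℝ P.U₁ c :=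
  (hu.U₁_C2.contDiffAt (Ioi_mem_nhds hc)).differentiableAt (by norm_num)

theorem continuousOn_deriv_U₁ : ContinuousOn (deriv P.U₁) (Ioi 0) :=
  (hu.U₁_C2.continuousOn_deriv_of_isOpen isOpen_Ioi (by norm_num))

theorem strictConcaveOn_U₁ : StrictConcaveOn ℝ (Ici 0) P.U₁ := by
  refine strictConcaveOn_of_deriv2_neg (convex_Ici 0) hu.U₁_cont fun c hc => ?_
  rw [interior_Ici] at hc
  exact hu.U₁_deriv2_neg c hc

theorem strictMonoOn_U₁ : StrictMonoOn P.U₁ (Ici 0) := by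
  refine strictMonoOn_of_deriv_pos (convex_Ici 0) hu.U₁_cont fun c hc => ?_
  rw [interior_Ici] at hc
  exact hu.U₁_deriv_pos c hc

theorem strictAntiOn_deriv_U₁ : StrictAntiOn (deriv P.U₁) (Ioi 0) :=
  (hu.strictConcaveOn_U₁.subset Ioi_subset_Ici_self (convex_Ioi 0)).strictAntiOn_deriv
    fun _ hc => hu.differentiableAt_U₁ hc

theorem mul_deriv_le {c h : ℝ} (hc : 0 ≤ c) (hh : 0 < h) :
    h * deriv P.U₁ (c + h) ≤ P.U₁ (c + h) - P.U₁ c := by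
  have := hu.strictConcaveOn_U₁.concaveOn.deriv_le_slope (x := c) (y := c + h) hc
    (by simp only [mem_Ici]; linarith) (by linarith) (hu.differentiableAt_U₁ (by linarith))
  rw [slope_def_field, le_div_iff₀ (by linarith)] at this
  linarith

theorem sub_le_mul_deriv {c : ℝ} (hc : 0 < c) {c' : ℝ} (hc' : 0 ≤ c') (hne : c' ≠ c) :
    P.U₁ c' - P.U₁ c < (c' - c) * deriv P.U₁ c := by
  rcases lt_or_gt_of_ne hne with h | h
  · have := hu.strictConcaveOn_U₁.deriv_lt_slope (x := c') (y := c) hc' hc.le h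
      (hu.differentiableAt_U₁ hc)
    rw [slope_def_field, lt_div_iff₀ (by linarith)] at this
    linarith
  · have := hu.strictConcaveOn_U₁.slope_lt_deriv (x := c) (y := c') hc.le hc' h
      (hu.differentiableAt_U₁ hc)
    rw [slope_def_field, div_lt_iff₀ (by linarith)] at this
    linarith

/-- By concavity `c U₁'(c) ≤ U₁(c) - U₁(0)`, which is bounded. With the blow-up at `0⁺`, this makes
`U₁'` a decreasing bijection of `(0, ∞)`. -/
theorem tendsto_deriv_U₁_atTop : Tendsto (deriv P.U₁) atTop (𝓝 0) := by
  obtain ⟨K, hK⟩ := hu.U₁_bdd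
  have h1 : ∀ᶠ c in atTop, deriv P.U₁ c ≤ 2 * K / c := by
    filter_upwards [eventually_gt_atTop 0] with c hc
    have := hu.mul_deriv_le le_rfl hc
    rw [zero_add] at this
    rw [le_div_iff₀ hc]
    have h2 := (abs_le.1 (hK c hc.le)).2
    have h3 := (abs_le.1 (hK 0 le_rfl)).1
    linarith
  have h2 : ∀ᶠ c in atTop, 0 ≤ deriv P.U₁ c := by
    filter_upwards [eventually_gt_atTop 0] with c hc using (hu.U₁_deriv_pos c hc).le
  exact tendsto_of_tendsto_of_tendsto_of_le_of_le' tendsto_const_nhds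
    (tendsto_const_nhds.div_atTop tendsto_id) h2 h1

theorem exists_deriv_eq {p : ℝ} (hp : 0 < p) : ∃ c, 0 < c ∧ deriv P.U₁ c = p := by
  obtain ⟨b, hb0, hb⟩ := ((eventually_gt_atTop 0).and
    (hu.tendsto_deriv_U₁_atTop.eventually_lt_const hp)).exists
  have h2 : ∀ᶠ c in 𝓝[>] (0 : ℝ), c < b :=
    mem_nhdsWithin_of_mem_nhds (Iio_mem_nhds hb0)
  obtain ⟨a, ha, hab, ha0⟩ := ((hu.U₁_deriv_zero.eventually_gt_atTop p).and
    (h2.and self_mem_nhdsWithin)).exists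
  have ha0' : 0 < a := ha0
  have hsub : Icc a b ⊆ Ioi 0 := fun c hc => ha0'.trans_le hc.1
  obtain ⟨c, hc, hcp⟩ := intermediate_value_Icc' hab.le (hu.continuousOn_deriv_U₁.mono hsub)
    ⟨hb.le, ha.le⟩
  exact ⟨c, hsub hc, hcp⟩

/-- The inverse of the marginal utility. -/
theorem exists_inverse_deriv : ∃ φ : ℝ → ℝ, ContinuousOn φ (Ioi 0) ∧
    (∀ p, 0 < p → 0 < φ p ∧ deriv P.U₁ (φ p) = p) ∧ ∀ c, 0 < c → φ (deriv P.U₁ c) = c := by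
  have h : ∀ p : ℝ, ∃ c, 0 < p → 0 < c ∧ deriv P.U₁ c = p := fun p => by
    by_cases hp : 0 < p
    · obtain ⟨c, hc⟩ := hu.exists_deriv_eq hp
      exact ⟨c, fun _ => hc⟩
    · exact ⟨0, fun h => absurd h hp⟩
  choose φ hφ using h
  have hinv : ∀ c, 0 < c → φ (deriv P.U₁ c) = c := fun c hc => by
    have := hφ _ (hu.U₁_deriv_pos c hc)
    exact hu.strictAntiOn_deriv_U₁.injOn this.1 hc this.2
  refine ⟨φ, fun p hp => ?_, hφ, hinv⟩
  have hmono : MonotoneOn (fun p => -φ p) (Ioi 0) := by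
    intro p hp q hq hpq
    simp only [neg_le_neg_iff]
    by_contra hlt
    rw [not_le] at hlt
    have := hu.strictAntiOn_deriv_U₁ (hφ p hp).1 (hφ q hq).1 hlt
    rw [(hφ p hp).2, (hφ q hq).2] at this
    linarith
  have hp0 := (hφ p hp).1
  have hc : ContinuousAt (fun p => -φ p) p := by
    refine continuousAt_of_monotoneOn_of_image_mem_nhds hmono (Ioi_mem_nhds hp) ?_
    have : Iio (0 : ℝ) ⊆ (fun p => -φ p) '' Ioi 0 := by
      intro y hy
      have hy' : 0 < -y := by simpa using hy
      exact ⟨deriv P.U₁ (-y), hu.U₁_deriv_pos _ hy', by simp [hinv _ hy']⟩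
    exact mem_of_superset (Iio_mem_nhds (by simpa using hp0)) this
  have e : φ = -fun p => -φ p := by ext; simp
  exact ContinuousAt.continuousWithinAt (e ▸ hc.neg)

theorem midpoint_nonneg {a b : ℝ} (ha : 0 ≤ a) (hb : 0 ≤ b) :
    0 ≤ P.U₁ (1 / 2 * a + 1 / 2 * b) - (1 / 2 * P.U₁ a + 1 / 2 * P.U₁ b) := by
  have := hu.strictConcaveOn_U₁.concaveOn.2 (x := a) ha (y := b) hb
    (by norm_num : (0 : ℝ) ≤ 1 / 2) (by norm_num : (0 : ℝ) ≤ 1 / 2) (by norm_num)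
  simp only [smul_eq_mul] at this
  linarith

/-- Quantitative strict concavity. -/
theorem exists_midpoint_gap {R ε : ℝ} (hR : 0 ≤ R) (hε : 0 < ε) :
    ∃ g, 0 < g ∧ ∀ a b, 0 ≤ a → 0 ≤ b → a ≤ R → ε ≤ |a - b| →
      g ≤ P.U₁ (1 / 2 * a + 1 / 2 * b) - (1 / 2 * P.U₁ a + 1 / 2 * P.U₁ b) := by
  set G : ℝ → ℝ → ℝ := fun a b =>
    P.U₁ (1 / 2 * a + 1 / 2 * b) - (1 / 2 * P.U₁ a + 1 / 2 * P.U₁ b) with hG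
  have hpos : ∀ a, 0 ≤ a → 0 < G a (a + ε) := by
    intro a ha
    have := hu.strictConcaveOn_U₁.2 (x := a) ha (y := a + ε) (by simp only [mem_Ici]; linarith)
      (by linarith) (by norm_num : (0 : ℝ) < 1 / 2) (by norm_num : (0 : ℝ) < 1 / 2) (by norm_num)
    simp only [smul_eq_mul] at this
    simp only [hG]
    linarith
  have hcont : ContinuousOn (fun a => G a (a + ε)) (Icc 0 R) := by
    have hU : ∀ f : ℝ → ℝ, Continuous f → (∀ a, 0 ≤ a → 0 ≤ f a) →
        ContinuousOn (fun a => P.U₁ (f a)) (Icc 0 R) := fun f hf hf0 =>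
      hu.U₁_cont.comp hf.continuousOn fun a ha => hf0 a ha.1
    refine (hU (fun a => 1 / 2 * a + 1 / 2 * (a + ε)) (by fun_prop) fun a ha => by linarith).sub
      (((hU (fun a => a) (by fun_prop) fun a ha => ha).const_smul (1 / 2 : ℝ)).add
      ((hU (fun a => a + ε) (by fun_prop) fun a ha => by linarith).const_smul (1 / 2 : ℝ)))
  obtain ⟨a₀, ha₀, hmin⟩ := isCompact_Icc.exists_isMinOn ⟨0, left_mem_Icc.2 hR⟩ hcont
  -- The second argument is unbounded, so compactness alone does not suffice. For `b > a` the
  -- derivative of the gap in `b` is half of `U₁'` at the midpoint minus `U₁'(b)`, which is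
  -- nonnegative; the gap is thus smallest at `b = a + ε`, where only `a ∈ [0, R]` varies.
  have hmono : ∀ a, 0 ≤ a → MonotoneOn (G a) (Ici a) := by
    intro a ha
    have hder : ∀ b, a < b → HasDerivAt (G a)
        (deriv P.U₁ (1 / 2 * a + 1 / 2 * b) * (1 / 2) - 1 / 2 * deriv P.U₁ b) b := by
      intro b hb
      have h1 := (hu.differentiableAt_U₁ (c := 1 / 2 * a + 1 / 2 * b) (by linarith)).hasDerivAt
      have h2 := (hu.differentiableAt_U₁ (c := b) (by linarith)).hasDerivAt
      have h3 : HasDerivAt (fun b => 1 / 2 * a + 1 / 2 * b) (1 / 2) b := by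
        simpa using ((hasDerivAt_id b).const_mul (1 / 2 : ℝ)).const_add (1 / 2 * a)
      exact (h1.comp b h3).sub ((h2.const_mul (1 / 2)).const_add (1 / 2 * P.U₁ a))
    refine monotoneOn_of_deriv_nonneg (convex_Ici a) ?_ ?_ ?_
    · refine ContinuousOn.sub (hu.U₁_cont.comp (by fun_prop) fun b hb => ?_) ?_
      · simp only [mem_Ici] at hb ⊢; linarith
      · exact continuousOn_const.add (continuousOn_const.mul
          (hu.U₁_cont.mono fun b hb => ha.trans hb))
    · rw [interior_Ici]
      exact fun b hb => (hder b hb).differentiableAt.differentiableWithinAt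
    · rw [interior_Ici]
      intro b hb
      have hb' : a < b := hb
      rw [(hder b hb).deriv]
      have := hu.strictAntiOn_deriv_U₁.antitoneOn (a := 1 / 2 * a + 1 / 2 * b) (b := b)
        (by simp only [mem_Ioi]; linarith) (by simp only [mem_Ioi]; linarith) (by linarith)
      linarith
  have hord : ∀ a b, 0 ≤ a → a ≤ R → a + ε ≤ b → G a₀ (a₀ + ε) ≤ G a b := fun a b ha haR hb =>
    le_trans (hmin ⟨ha, haR⟩)
      (hmono a ha (by simp only [mem_Ici]; linarith) (by simp only [mem_Ici]; linarith) hb)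
  refine ⟨G a₀ (a₀ + ε), hpos a₀ ha₀.1, fun a b ha hb haR hab => ?_⟩
  rcases le_total a b with h | h
  · rw [abs_of_nonpos (by linarith)] at hab
    exact hord a b ha haR (by linarith)
  -- By symmetry of the gap the roles are exchanged; the smaller point `b` is again at most `R`.
  · rw [abs_of_nonneg (by linarith)] at hab
    have := hord b a hb (by linarith) (by linarith)
    simp only [hG] at this ⊢
    rw [add_comm (1 / 2 * a), add_comm (1 / 2 * P.U₁ a)]
    exact this

end UtilityHypotheses

section concave

theorem fiber_mem {ζ : P.H} (hζ : ζ ∈ P.HPlusPlus) {s : ℝ} (hpos : 0 < s) :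
    (WithLp.toLp 2 (s, ζ.snd) : P.H) ∈ P.HPlusPlus := ⟨hpos, hζ.2⟩

/-- The value function is concave in the present. -/
theorem concaveOn_val (hs : P.StateHypotheses) (hu : P.UtilityHypotheses) {ζ : P.H} (hζ : ζ ∈ P.HPlusPlus) :
    ConcaveOn ℝ (Ioi 0) (fun s : ℝ => P.val (WithLp.toLp 2 (s, ζ.snd))) := by
  refine ⟨convex_Ioi 0, fun s hs0 s' hs0' α β hα hβ hαβ => ?_⟩
  have hm := fiber_mem hζ hs0
  have hm' := fiber_mem hζ hs0'
  have hm'' := fiber_mem hζ (convex_Ioi (0 : ℝ) hs0 hs0' hα hβ hαβ)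
  simp only [smul_eq_mul] at hm'' ⊢
  refine le_of_forall_pos_le_add fun ε hε => ?_
  obtain ⟨c, x, hp, hf, hlt⟩ := exists_val_sub_lt hs hu hm hε
  obtain ⟨c', x', hp', hf', hlt'⟩ := exists_val_sub_lt hs hu hm' hε
  obtain ⟨d, hd, hle⟩ := hp.convexCombination (ζ := WithLp.toLp 2 (α * s + β * s', ζ.snd)) hs hp'
    hα hβ hαβ rfl rfl rfl
  have hU₂ : ∀ t, 0 < t →
      α * (Real.exp (-P.ρ * t) * P.U₂ (x t)) + β * (Real.exp (-P.ρ * t) * P.U₂ (x' t))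
      ≤ Real.exp (-P.ρ * t) * P.U₂ (α * x t + β * x' t) := by
    intro t ht
    have := hu.U₂_concave.2 (x := x t) (y := x' t) (hp.traj.pos t ht.le) (hp'.traj.pos t ht.le)
      hα hβ hαβ
    simp only [smul_eq_mul] at this
    nlinarith [Real.exp_pos (-P.ρ * t)]
  have hU₁ : ∀ t, 0 < t →
      α * (Real.exp (-P.ρ * t) * P.U₁ (c t)) + β * (Real.exp (-P.ρ * t) * P.U₁ (c' t))
      ≤ Real.exp (-P.ρ * t) * P.U₁ (d t) := by
    intro t ht
    have h0 := hp.control.2 t ht.le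
    have h0' := hp'.control.2 t ht.le
    have := hu.strictConcaveOn_U₁.concaveOn.2 (x := c t) (y := c' t) h0 h0' hα hβ hαβ
    simp only [smul_eq_mul] at this
    have h3 := hu.strictMonoOn_U₁.monotoneOn
      (a := α * c t + β * c' t) (b := d t) (by simp only [mem_Ici]; positivity)
      (hd.control.2 t ht.le) (hle t ht.le)
    nlinarith [Real.exp_pos (-P.ρ * t)]
  have hint : IntegrableOn (fun t => α * (Real.exp (-P.ρ * t) * P.U₂ (x t))
      + β * (Real.exp (-P.ρ * t) * P.U₂ (x' t))) (Ioi 0) := (hf.const_mul α).add (hf'.const_mul β)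
  have hfd : P.FinitePayoff₂ (fun t => α * x t + β * x' t) :=
    hu.integrable₂_of_ge hint
      ((hd.traj.cont.mono Ioi_subset_Ici_self).aestronglyMeasurable measurableSet_Ioi)
      (fun t ht => hd.traj.pos t ht.le) hU₂
  have h1 := payoff_le_val hs hu hm'' hd hfd
  have i1 := hu.integrable₁ hp.control
  have i1' := hu.integrable₁ hp'.control
  have h2 : α * P.payoff₂ x + β * P.payoff₂ x' ≤ P.payoff₂ (fun t => α * x t + β * x' t) := by
    unfold payoff₂
    rw [← integral_const_mul, ← integral_const_mul,
      ← integral_add (hf.const_mul α) (hf'.const_mul β)]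
    exact setIntegral_mono_on hint hfd measurableSet_Ioi hU₂
  have h3 : α * P.payoff₁ c + β * P.payoff₁ c' ≤ P.payoff₁ d := by
    unfold payoff₁
    rw [← integral_const_mul, ← integral_const_mul,
      ← integral_add (i1.const_mul α) (i1'.const_mul β)]
    exact setIntegral_mono_on ((i1.const_mul α).add (i1'.const_mul β)) (hu.integrable₁ hd.control)
      measurableSet_Ioi hU₁
  have h4 := mul_le_mul_of_nonneg_left hlt.le hα
  have h5 := mul_le_mul_of_nonneg_left hlt'.le hβ
  have h6 : α * ε + β * ε = ε := by rw [← add_mul, hαβ, one_mul]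
  linarith

end concave

end Problem

end DelayControl

/-! ### A priori growth bounds -/

namespace DelayControl

namespace Problem

variable {P : Problem}

/-- The drift, made monotone by the addition of `Cf x`. -/
noncomputable def monoDrift (P : Problem) (z : ℝ → ℝ) (s : ℝ) : ℝ := P.drift z s + P.Cf * z s

/-- A measurable nonnegative path with past `η` and with at most exponential growth. -/
structure IsDominated (P : Problem) (η : P.H) (B l : ℝ) (z : ℝ → ℝ) : Prop where
  meas : Measurable z
  past : ∀ s, s < 0 → z s = η.snd s
  nonneg : ∀ s, 0 ≤ s → 0 ≤ z s
  le : ∀ s, 0 ≤ s → z s ≤ B * Real.exp (l * s)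

theorem measurable_snd (η : P.H) : Measurable (fun s => η.snd s) :=
  (Lp.stronglyMeasurable η.snd).measurable

theorem glue_measurable (η : P.H) {z : ℝ → ℝ} (hz : ContinuousOn z (Ici 0)) :
    Measurable (glue η z) := by
  classical
  have h : Measurable ((Ici (0 : ℝ)).piecewise z 0) :=
    hz.measurable_piecewise continuousOn_const measurableSet_Ici
  have e : glue η z = fun s => if s < 0 then η.snd s else (Ici (0 : ℝ)).piecewise z 0 s := by
    ext s
    unfold glue
    split_ifs with h'
    · rfl
    · simp [not_lt.1 h']
  rw [e]
  exact Measurable.ite measurableSet_Iio (measurable_snd η) h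

theorem pathIntegrable_of_past {η : P.H} {z : ℝ → ℝ} (hp : ∀ s, s < 0 → z s = η.snd s)
    (hz : LocallyIntegrableOn z (Ici 0)) : P.PathIntegrable z := by
  have h : P.HasInitialDatum (WithLp.toLp 2 (z 0, η.snd)) z :=
    hasInitialDatum_of_ae rfl (Eventually.of_forall fun s hs => hp s hs.2)
  exact h.pathIntegrable hz

theorem IsDominated.locallyIntegrableOn {η : P.H} {B l : ℝ} {z : ℝ → ℝ}
    (h : P.IsDominated η B l z) : LocallyIntegrableOn z (Ici 0) := by
  rw [locallyIntegrableOn_Ici_iff]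
  intro S hS
  refine IntervalIntegrable.mono_fun' (g := fun s => B * Real.exp (l * s))
    (Continuous.intervalIntegrable (by fun_prop) _ _) h.meas.aestronglyMeasurable ?_
  refine (ae_restrict_iff' measurableSet_uIoc).2 (Eventually.of_forall fun s hs => ?_)
  rw [uIoc_of_le hS] at hs
  exact (Real.norm_of_nonneg (h.nonneg s hs.1.le)).trans_le (h.le s hs.1.le)

theorem IsDominated.pathIntegrable {η : P.H} {B l : ℝ} {z : ℝ → ℝ}
    (h : P.IsDominated η B l z) : P.PathIntegrable z :=
  pathIntegrable_of_past h.past h.locallyIntegrableOn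

theorem ae_nonneg_of_past {η : P.H} (hη : η ∈ P.HPlusPlus) {z : ℝ → ℝ}
    (hp : ∀ s, s < 0 → z s = η.snd s) (hz : ∀ s, 0 ≤ s → 0 ≤ z s) :
    ∀ᵐ s, -P.T ≤ s → 0 ≤ z s := by
  filter_upwards [(ae_restrict_iff' measurableSet_Icc).1 hη.2] with s h2 hs
  rcases lt_or_ge s 0 with h' | h'
  · rw [hp s h']; exact h2 ⟨hs, h'.le⟩
  · exact hz s h'

theorem monoDrift_nonneg (hs : P.StateHypotheses) {η : P.H} (hη : η ∈ P.HPlusPlus) {z : ℝ → ℝ}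
    (hp : ∀ s, s < 0 → z s = η.snd s) (hz : ∀ s, 0 ≤ s → 0 ≤ z s) {t : ℝ} (ht : 0 ≤ t) :
    0 ≤ P.monoDrift z t := by
  unfold monoDrift
  rw [drift_def]
  have h1 := hs.f₀_ge (hz t ht) (hs.delay_nonneg (ae_nonneg_of_past hη hp hz) ht)
  have h2 := mul_nonneg hs.r_pos.le (hz t ht)
  linarith

theorem monoDrift_mono (hs : P.StateHypotheses) {z z' : ℝ → ℝ} (hz : P.PathIntegrable z)
    (hz' : P.PathIntegrable z') (hpos : ∀ s, 0 ≤ s → 0 ≤ z s) (hle : ∀ s, z s ≤ z' s)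
    {t : ℝ} (ht : 0 ≤ t) : P.monoDrift z t ≤ P.monoDrift z' t := by
  unfold monoDrift
  rw [drift_def, drift_def]
  have h1 := hs.f₀_add_mono (hpos t ht) (hle t) (hs.delay_mono hz hz' hle ht)
  have h2 := mul_le_mul_of_nonneg_left (hle t) hs.r_pos.le
  linarith

/-- The past contributes at most `A` times the `L¹` norm of the history and the window after time
`0` at most `A T m`. Both constants are independent of `t` and of the path. -/
theorem exists_delay_bound (hs : P.StateHypotheses) (η : P.H) :
    ∃ D E, 0 ≤ D ∧ 0 ≤ E ∧ ∀ (z : ℝ → ℝ) (m t : ℝ), 0 ≤ t → 0 ≤ m → P.PathIntegrable z →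
      (∀ s, s < 0 → z s = η.snd s) → (∀ s, 0 ≤ s → s ≤ t → z s ≤ m) →
      P.delay z t ≤ D + E * m := by
  obtain ⟨A, hA0, hA⟩ := hs.exists_a_bound
  have hT := hs.T_pos
  set hist : ℝ → ℝ := (Ico (-P.T) 0).indicator (fun s => |η.snd s|)
  have hhist : Integrable hist :=
    (integrable_indicator_iff measurableSet_Ico).2
      ((integrableOn_snd η).mono_set Ico_subset_Icc_self).abs
  have hhist0 : ∀ s, 0 ≤ hist s := fun s => indicator_nonneg (fun _ _ => abs_nonneg _) s
  refine ⟨A * ∫ s, hist s, A * P.T, mul_nonneg hA0 (integral_nonneg hhist0),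
    mul_nonneg hA0 hT.le, fun z m t ht hm hz hp hle => ?_⟩
  have hsh : Integrable (fun ξ => hist (t + ξ)) := hhist.comp_add_left t
  have h1 : P.delay z t ≤ ∫ ξ in (-P.T)..0, A * (hist (t + ξ) + m) := by
    refine intervalIntegral.integral_mono_on (by linarith) (hs.delay_intervalIntegrable hz ht)
      ((hsh.intervalIntegrable.add intervalIntegrable_const).const_mul A) fun ξ hξ => ?_
    have ha0 := hs.a_nonneg ξ hξ
    have ha := hA ξ hξ
    have hzb : z (t + ξ) ≤ hist (t + ξ) + m := by
      rcases lt_or_ge (t + ξ) 0 with h' | h'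
      · rw [hp _ h']
        have : hist (t + ξ) = |η.snd (t + ξ)| :=
          indicator_of_mem (show t + ξ ∈ Ico (-P.T) 0 from ⟨by linarith [hξ.1], h'⟩) _
        rw [this]
        linarith [le_abs_self (η.snd (t + ξ))]
      · linarith [hle (t + ξ) h' (by linarith [hξ.2]), hhist0 (t + ξ)]
    calc P.a ξ * z (t + ξ) ≤ P.a ξ * (hist (t + ξ) + m) := mul_le_mul_of_nonneg_left hzb ha0
      _ ≤ A * (hist (t + ξ) + m) :=
        mul_le_mul_of_nonneg_right ha (by linarith [hhist0 (t + ξ)])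
  refine h1.trans ?_
  rw [intervalIntegral.integral_const_mul,
    intervalIntegral.integral_add hsh.intervalIntegrable intervalIntegrable_const,
    intervalIntegral.integral_const, smul_eq_mul]
  have h2 : ∫ ξ in (-P.T)..0, hist (t + ξ) ≤ ∫ s, hist s := by
    rw [intervalIntegral.integral_of_le (by linarith), ← integral_add_left_eq_self hist t]
    exact setIntegral_le_integral hsh (Eventually.of_forall fun _ => hhist0 _)
  nlinarith [mul_le_mul_of_nonneg_left h2 hA0]

theorem exists_monoDrift_bound (hs : P.StateHypotheses) {η : P.H} (hη : η ∈ P.HPlusPlus) :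
    ∃ D E, 0 ≤ D ∧ 0 ≤ E ∧ ∀ (z : ℝ → ℝ) (m t : ℝ), 0 ≤ t → 0 ≤ m → P.PathIntegrable z →
      (∀ s, s < 0 → z s = η.snd s) → (∀ s, 0 ≤ s → 0 ≤ z s) →
      (∀ s, 0 ≤ s → s ≤ t → z s ≤ m) → P.monoDrift z t ≤ D + E * m := by
  obtain ⟨D, E, hD, hE, h⟩ := exists_delay_bound hs η
  have hC := hs.Cf_nonneg
  have hr := hs.r_pos
  refine ⟨P.f₀ 0 0 + P.Cf * D, P.r + 2 * P.Cf + P.Cf * E, ?_, by positivity,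
    fun z m t ht hm hz hp hnn hle => ?_⟩
  · have := hs.f₀_zero_nonneg; positivity
  have h1 := h z m t ht hm hz hp hle
  have h2 := hs.f₀_le (hnn t ht) (hs.delay_nonneg (ae_nonneg_of_past hη hp hnn) ht)
  have h3 := hle t ht le_rfl
  unfold monoDrift
  rw [drift_def]
  have h4 := mul_le_mul_of_nonneg_left h1 hC
  have h5 := mul_le_mul_of_nonneg_left h3 hC
  have h6 := mul_le_mul_of_nonneg_left h3 hr.le
  nlinarith

theorem monoDrift_continuousOn (hs : P.StateHypotheses) {x : ℝ → ℝ} (hx : P.PathIntegrable x)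
    (hc : ContinuousOn x (Ici 0)) (hpos : ∀ t, 0 ≤ t → 0 ≤ x t) :
    ContinuousOn (P.monoDrift x) (Ici 0) :=
  (hs.drift_continuousOn hx hc hpos).add (continuousOn_const.mul hc)

/-- An a priori exponential bound for the subsolutions of the state equation. -/
theorem exists_growth_bound (hs : P.StateHypotheses) {η : P.H} (hη : η ∈ P.HPlusPlus) :
    ∃ B l, 0 ≤ B ∧ 0 < l ∧ ∀ x : ℝ → ℝ, (∀ s, s < 0 → x s = η.snd s) →
      ContinuousOn x (Ici 0) → (∀ t, 0 ≤ t → 0 ≤ x t) →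
      (∀ t, 0 ≤ t → Real.exp (P.Cf * t) * x t
        ≤ η.fst + ∫ s in (0 : ℝ)..t, Real.exp (P.Cf * s) * P.monoDrift x s) →
      ∀ t, 0 ≤ t → x t ≤ B * Real.exp (l * t) := by
  obtain ⟨D, E, hD, hE, hDE⟩ := exists_monoDrift_bound hs hη
  have hC := hs.Cf_nonneg
  -- Gronwall with an exponential weight: let `m` be the maximum of `x(t) exp (-l t)` on `[0, S]`
  -- and evaluate the integral inequality at a maximizer. With this `l` the integral contributes at
  -- most `(D + m / 2) exp ((Cf + l) t)`, so `m ≤ η₀ + D + m / 2`, that is, `m ≤ 2 (η₀ + D)`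
  -- independently of `S`.
  obtain ⟨l, hl⟩ : ∃ l, l = 2 * E + 1 := ⟨_, rfl⟩
  have hl0 : 0 < l := by rw [hl]; positivity
  have hη0 : 0 < η.fst := hη.1
  refine ⟨2 * (η.fst + D), l, by positivity, by positivity, fun x hp hc hnn hsub S hS => ?_⟩
  have hpi := pathIntegrable_of_past hp hc.locallyIntegrableOn_Ici
  have hcont : ContinuousOn (fun t => x t * Real.exp (-(l * t))) (Icc 0 S) :=
    (hc.mono fun t ht => ht.1).mul (by fun_prop)
  obtain ⟨t, ht, hmax⟩ := isCompact_Icc.exists_isMaxOn ⟨0, left_mem_Icc.2 hS⟩ hcont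
  set m := x t * Real.exp (-(l * t)) with hm
  have hm0 : 0 ≤ m := mul_nonneg (hnn t ht.1) (Real.exp_pos _).le
  have hle : ∀ s, 0 ≤ s → s ≤ S → x s ≤ m * Real.exp (l * s) := by
    intro s hs0 hsS
    have := hmax (show s ∈ Icc 0 S from ⟨hs0, hsS⟩)
    simp only [mem_ofPred_eq] at this
    calc x s = (x s * Real.exp (-(l * s))) * Real.exp (l * s) := by
          rw [mul_assoc, ← Real.exp_add]; simp
      _ ≤ m * Real.exp (l * s) := mul_le_mul_of_nonneg_right this (Real.exp_pos _).le
  have hG : ∀ s ∈ Icc 0 t, Real.exp (P.Cf * s) * P.monoDrift x s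
      ≤ (D + E * m) * Real.exp ((P.Cf + l) * s) := by
    intro s hs0
    have hexp1 : 1 ≤ Real.exp (l * s) :=
      Real.one_le_exp (mul_nonneg (by positivity) hs0.1)
    have := hDE x (m * Real.exp (l * s)) s hs0.1 (by positivity) hpi hp hnn fun u hu0 hus =>
      (hle u hu0 (hus.trans (hs0.2.trans ht.2))).trans (mul_le_mul_of_nonneg_left
        (Real.exp_le_exp.2 (mul_le_mul_of_nonneg_left hus (by positivity))) hm0)
    have h2 : P.monoDrift x s ≤ (D + E * m) * Real.exp (l * s) := by nlinarith
    calc _ ≤ Real.exp (P.Cf * s) * ((D + E * m) * Real.exp (l * s)) :=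
          mul_le_mul_of_nonneg_left h2 (Real.exp_pos _).le
      _ = _ := by rw [add_mul P.Cf, Real.exp_add]; ring
  have hint : ∫ s in (0 : ℝ)..t, (D + E * m) * Real.exp ((P.Cf + l) * s)
      = (D + E * m) * ((Real.exp ((P.Cf + l) * t) - 1) / (P.Cf + l)) := by
    have hne : P.Cf + l ≠ 0 := by positivity
    rw [intervalIntegral.integral_const_mul]
    congr 1
    have hd : ∀ s ∈ uIcc 0 t, HasDerivAt (fun s => Real.exp ((P.Cf + l) * s) / (P.Cf + l))
        (Real.exp ((P.Cf + l) * s)) s := by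
      intro s _
      have := (((hasDerivAt_id s).const_mul (P.Cf + l)).exp).div_const (P.Cf + l)
      convert! this using 1
      simp only [id_eq, mul_one]
      field_simp
    rw [intervalIntegral.integral_eq_sub_of_hasDerivAt hd
      (Continuous.intervalIntegrable (by fun_prop) _ _)]
    simp
    ring
  have hGi : IntervalIntegrable (fun s => Real.exp (P.Cf * s) * P.monoDrift x s) volume 0 t := by
    refine ContinuousOn.intervalIntegrable ?_
    rw [uIcc_of_le ht.1]
    exact (Continuous.continuousOn (by fun_prop)).mul
      ((monoDrift_continuousOn hs hpi hc hnn).mono fun s hs => hs.1)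
  have h1 := (hsub t ht.1).trans (add_le_add_right (intervalIntegral.integral_mono_on ht.1 hGi
    (Continuous.intervalIntegrable (by fun_prop) _ _) hG) _)
  rw [hint] at h1
  have hX : 1 ≤ Real.exp ((P.Cf + l) * t) :=
    Real.one_le_exp (mul_nonneg (by positivity) ht.1)
  set X := Real.exp ((P.Cf + l) * t)
  have hxt : Real.exp (P.Cf * t) * x t = m * X := by
    have : x t = m * Real.exp (l * t) := by
      rw [hm, mul_assoc, ← Real.exp_add]; simp
    rw [this]
    simp only [X]
    rw [add_mul, Real.exp_add]; ring
  rw [hxt] at h1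
  have h2 : (D + E * m) * ((X - 1) / (P.Cf + l)) ≤ (D + m / 2) * X := by
    rw [mul_div_assoc', div_le_iff₀ (by positivity)]
    have e1 : D + E * m ≤ (D + m / 2) * (P.Cf + l) := by
      rw [hl]
      nlinarith [mul_nonneg hD hC, mul_nonneg hm0 hC, mul_nonneg hD hE]
    have e2 : 0 ≤ D + E * m := by positivity
    nlinarith
  have h3 : m * X ≤ (η.fst + D + m / 2) * X := by nlinarith
  have h4 : m ≤ η.fst + D + m / 2 := le_of_mul_le_mul_right h3 (by linarith)
  exact (hle S hS le_rfl).trans (mul_le_mul_of_nonneg_right (by linarith) (Real.exp_pos _).le)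

theorem IsPair.exp_mul_eq (hs : P.StateHypotheses) {η : P.H} {c x : ℝ → ℝ} (h : P.IsPair η c x)
    {t : ℝ} (ht : 0 ≤ t) : Real.exp (P.Cf * t) * x t
      = η.fst + ∫ s in (0 : ℝ)..t, Real.exp (P.Cf * s) * (P.monoDrift x s - c s) := by
  rw [exp_mul_primitive P.Cf (h.rate_integrable hs) (fun t ht => h.eq_primitive hs ht) ht]
  congr 1
  refine intervalIntegral.integral_congr fun s _ => ?_
  simp only [monoDrift]
  ring

end Problem

end DelayControl

/-! ### Monotone iteration: from a subsolution to a solution -/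

namespace DelayControl

namespace Problem

variable {P : Problem}

theorem IsDominated.le_of_le {η : P.H} {B l : ℝ} (hB : 0 ≤ B) (hl : 0 < l) {z : ℝ → ℝ}
    (h : P.IsDominated η B l z) {u s : ℝ} (hu : 0 ≤ u) (hus : u ≤ s) :
    z u ≤ B * Real.exp (l * s) :=
  (h.le u hu).trans (mul_le_mul_of_nonneg_left
    (Real.exp_le_exp.2 (mul_le_mul_of_nonneg_left hus hl.le)) hB)

theorem IsDominated.aestronglyMeasurable_monoDrift (hs : P.StateHypotheses) {η : P.H} {B l : ℝ}
    {z : ℝ → ℝ} (h : P.IsDominated η B l z) :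
    AEStronglyMeasurable (P.monoDrift z) (volume.restrict (Ici 0)) := by
  classical
  have hf : Measurable ((Ici (0 : ℝ) ×ˢ (univ : Set ℝ)).piecewise
      (fun p : ℝ × ℝ => P.f₀ p.1 p.2) 0) :=
    hs.f₀_continuousOn.measurable_piecewise continuousOn_const
      (measurableSet_Ici.prod MeasurableSet.univ)
  have hd : AEMeasurable (P.delay z) (volume.restrict (Ici 0)) :=
    ((hs.delay_continuousOn h.pathIntegrable).aestronglyMeasurable measurableSet_Ici).aemeasurable
  have h1 : AEMeasurable (fun t => P.f₀ (z t) (P.delay z t)) (volume.restrict (Ici 0)) := by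
    refine (hf.comp_aemeasurable (h.meas.aemeasurable.prodMk hd)).congr ?_
    refine (ae_restrict_iff' measurableSet_Ici).2 (Eventually.of_forall fun t ht => ?_)
    have : (z t, P.delay z t) ∈ Ici (0 : ℝ) ×ˢ (univ : Set ℝ) := ⟨h.nonneg t ht, mem_univ _⟩
    simp only [Function.comp, piecewise_eq_of_mem _ _ _ this]
  exact (((h.meas.aemeasurable.const_mul P.r).add h1).add
    (h.meas.aemeasurable.const_mul P.Cf)).aestronglyMeasurable

/-- Bounds on the monotone drift of dominated paths. -/
theorem exists_dominated_monoDrift_bound (hs : P.StateHypotheses) {η : P.H}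
    (hη : η ∈ P.HPlusPlus) {B l : ℝ} (hB : 0 ≤ B) (hl : 0 < l) :
    ∃ g : ℝ → ℝ, Continuous g ∧ ∀ z, P.IsDominated η B l z → ∀ s, 0 ≤ s →
      0 ≤ P.monoDrift z s ∧ P.monoDrift z s ≤ g s := by
  obtain ⟨D, E, hD, hE, h⟩ := exists_monoDrift_bound hs hη
  refine ⟨fun s => D + E * (B * Real.exp (l * s)), by fun_prop, fun z hz s hs0 =>
    ⟨monoDrift_nonneg hs hη hz.past hz.nonneg hs0, ?_⟩⟩
  exact h z _ s hs0 (by positivity) hz.pathIntegrable hz.past hz.nonneg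
    fun u hu hus => hz.le_of_le hB hl hu hus

theorem IsDominated.monoDrift_locallyIntegrableOn (hs : P.StateHypotheses) {η : P.H}
    (hη : η ∈ P.HPlusPlus) {B l : ℝ} (hB : 0 ≤ B) (hl : 0 < l) {z : ℝ → ℝ}
    (h : P.IsDominated η B l z) : LocallyIntegrableOn (P.monoDrift z) (Ici 0) := by
  obtain ⟨g, hg, hgb⟩ := exists_dominated_monoDrift_bound hs hη hB hl
  rw [locallyIntegrableOn_Ici_iff]
  intro S hS
  refine IntervalIntegrable.mono_fun' (g := g) (hg.intervalIntegrable _ _)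
    ((h.aestronglyMeasurable_monoDrift hs).mono_measure (Measure.restrict_mono ?_ le_rfl)) ?_
  · rw [uIoc_of_le hS]; exact fun s hs => hs.1.le
  · refine (ae_restrict_iff' measurableSet_uIoc).2 (Eventually.of_forall fun s hs => ?_)
    rw [uIoc_of_le hS] at hs
    obtain ⟨h1, h2⟩ := hgb z h s hs.1.le
    exact (Real.norm_of_nonneg h1).trans_le h2

theorem exp_mul_intervalIntegrable {g : ℝ → ℝ} (k : ℝ) (hg : LocallyIntegrableOn g (Ici 0)) {t : ℝ}
    (ht : 0 ≤ t) : IntervalIntegrable (fun s => Real.exp (k * s) * g s) volume 0 t :=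
  (locallyIntegrableOn_Ici_iff.1 hg t ht).continuousOn_mul
    (Continuous.continuousOn (by fun_prop))

/-- Continuity of the monotone drift along dominated sequences. -/
theorem tendsto_monoDrift (hs : P.StateHypotheses) {η : P.H} {B l : ℝ} (hB : 0 ≤ B) (hl : 0 < l)
    {u : ℕ → ℝ → ℝ} {z : ℝ → ℝ} (hu : ∀ k, P.IsDominated η B l (u k))
    (hz : P.IsDominated η B l z)
    (hlim : ∀ s, 0 ≤ s → Tendsto (fun k => u k s) atTop (𝓝 (z s))) {t : ℝ} (ht : 0 ≤ t) :
    Tendsto (fun k => P.monoDrift (u k) t) atTop (𝓝 (P.monoDrift z t)) := by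
  have hdel : Tendsto (fun k => P.delay (u k) t) atTop (𝓝 (P.delay z t)) := by
    -- A common dominating path: all the paths agree with `z` before time `0`, and on `[0, t]` they
    -- lie below `B exp (l t)`.
    have hpi : P.PathIntegrable (fun s => |z s| + B * Real.exp (l * t)) := fun S =>
      (hz.pathIntegrable S).abs.add (integrableOn_const (by simp))
    refine intervalIntegral.tendsto_integral_filter_of_dominated_convergence
      (fun ξ => P.a ξ * (|z (t + ξ)| + B * Real.exp (l * t))) ?_ ?_
      (hs.delay_intervalIntegrable hpi ht) ?_
    · refine Eventually.of_forall fun k => ?_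
      have := (hs.delay_intervalIntegrable (hu k).pathIntegrable ht).def'
      exact this.aestronglyMeasurable
    · refine Eventually.of_forall fun k => Eventually.of_forall fun ξ hξ => ?_
      rw [uIoc_of_le (by linarith [hs.T_pos])] at hξ
      have ha := hs.a_nonneg ξ (Ioc_subset_Icc_self hξ)
      rw [norm_mul, Real.norm_of_nonneg ha, Real.norm_eq_abs]
      refine mul_le_mul_of_nonneg_left ?_ ha
      have hpos : 0 ≤ B * Real.exp (l * t) := by positivity
      rcases lt_or_ge (t + ξ) 0 with h | h
      · rw [(hu k).past _ h, hz.past _ h]; linarith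
      · rw [abs_of_nonneg ((hu k).nonneg _ h)]
        have := (hu k).le_of_le hB hl h (show t + ξ ≤ t by linarith [hξ.2])
        linarith [abs_nonneg (z (t + ξ))]
    · refine Eventually.of_forall fun ξ _ => ?_
      refine Tendsto.const_mul _ ?_
      rcases lt_or_ge (t + ξ) 0 with h | h
      · simp only [(hu _).past _ h, hz.past _ h]; exact tendsto_const_nhds
      · exact hlim _ h
  have hpair : Tendsto (fun k => (u k t, P.delay (u k) t)) atTop
      (𝓝[Ici 0 ×ˢ univ] (z t, P.delay z t)) :=
    tendsto_nhdsWithin_iff.2 ⟨(hlim t ht).prodMk_nhds hdel,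
      Eventually.of_forall fun k => ⟨(hu k).nonneg t ht, mem_univ _⟩⟩
  have hf := (hs.f₀_continuousOn (z t, P.delay z t) ⟨hz.nonneg t ht, mem_univ _⟩).tendsto.comp hpair
  exact (((hlim t ht).const_mul P.r).add hf).add ((hlim t ht).const_mul P.Cf)

theorem tendsto_integral_monoDrift (hs : P.StateHypotheses) {η : P.H} (hη : η ∈ P.HPlusPlus)
    {B l : ℝ} (hB : 0 ≤ B) (hl : 0 < l)
    {u : ℕ → ℝ → ℝ} {z : ℝ → ℝ} (hu : ∀ k, P.IsDominated η B l (u k))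
    (hz : P.IsDominated η B l z)
    (hlim : ∀ s, 0 ≤ s → Tendsto (fun k => u k s) atTop (𝓝 (z s))) {t : ℝ} (ht : 0 ≤ t) :
    Tendsto (fun k => ∫ s in (0 : ℝ)..t, Real.exp (P.Cf * s) * P.monoDrift (u k) s) atTop
      (𝓝 (∫ s in (0 : ℝ)..t, Real.exp (P.Cf * s) * P.monoDrift z s)) := by
  obtain ⟨g, hg, hgb⟩ := exists_dominated_monoDrift_bound hs hη hB hl
  refine intervalIntegral.tendsto_integral_filter_of_dominated_convergence
    (fun s => Real.exp (P.Cf * s) * g s) ?_ ?_ (Continuous.intervalIntegrable (by fun_prop) _ _) ?_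
  · refine Eventually.of_forall fun k => ?_
    exact (exp_mul_intervalIntegrable P.Cf
      ((hu k).monoDrift_locallyIntegrableOn hs hη hB hl) ht).def'.aestronglyMeasurable
  · refine Eventually.of_forall fun k => Eventually.of_forall fun s hs0 => ?_
    rw [uIoc_of_le ht] at hs0
    obtain ⟨h1, h2⟩ := hgb (u k) (hu k) s hs0.1.le
    rw [norm_mul, Real.norm_of_nonneg (Real.exp_pos _).le, Real.norm_of_nonneg h1]
    exact mul_le_mul_of_nonneg_left h2 (Real.exp_pos _).le
  · refine Eventually.of_forall fun s hs0 => ?_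
    rw [uIoc_of_le ht] at hs0
    exact (tendsto_monoDrift hs hB hl hu hz hlim hs0.1.le).const_mul _

/-- Above every subsolution there is a solution of the state equation with the same control. -/
theorem exists_solution_ge (hs : P.StateHypotheses) {η : P.H} (hη : η ∈ P.HPlusPlus) {B l : ℝ}
    (hB : 0 ≤ B) (hl : 0 < l)
    (hgrow : ∀ x : ℝ → ℝ, (∀ s, s < 0 → x s = η.snd s) →
      ContinuousOn x (Ici 0) → (∀ t, 0 ≤ t → 0 ≤ x t) →
      (∀ t, 0 ≤ t → Real.exp (P.Cf * t) * x t
        ≤ η.fst + ∫ s in (0 : ℝ)..t, Real.exp (P.Cf * s) * P.monoDrift x s) →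
      ∀ t, 0 ≤ t → x t ≤ B * Real.exp (l * t))
    {c z : ℝ → ℝ} (hc : IsControl c) (hz : P.IsDominated η B l z)
    (hsub : ∀ t, 0 ≤ t → Real.exp (P.Cf * t) * z t
      ≤ η.fst + ∫ s in (0 : ℝ)..t, Real.exp (P.Cf * s) * (P.monoDrift z s - c s)) :
    ∃ x : ℝ → ℝ, P.IsDominated η B l x ∧ ContinuousOn x (Ici 0) ∧ (∀ t, 0 ≤ t → z t ≤ x t) ∧
      ∀ t, 0 ≤ t → x t = η.fst + ∫ s in (0 : ℝ)..t, (P.drift x s - c s) := by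
  -- The Picard map written with the integrating factor `exp (Cf t)`. In this form the right-hand
  -- side is monotone in the path, so `Φ` sends a subsolution to a larger subsolution. The growth
  -- bound keeps all iterates of `z` below `B exp (l t)`; they increase to a fixed point.
  set Φ : (ℝ → ℝ) → ℝ → ℝ := fun v => Problem.glue η fun t =>
    Real.exp (-P.Cf * t) *
      (η.fst + ∫ s in (0 : ℝ)..t, Real.exp (P.Cf * s) * (P.monoDrift v s - c s)) with hΦ
  have hexp : ∀ t y, Real.exp (P.Cf * t) * (Real.exp (-P.Cf * t) * y) = y := fun t y => by
    rw [← mul_assoc, ← Real.exp_add]; simp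
  have hrate : ∀ v, P.IsDominated η B l v →
      LocallyIntegrableOn (fun s => P.monoDrift v s - c s) (Ici 0) := fun v hv =>
    (hv.monoDrift_locallyIntegrableOn hs hη hB hl).sub hc.1
  have hrate' : ∀ v, P.IsDominated η B l v →
      LocallyIntegrableOn (fun s => Real.exp (P.Cf * s) * (P.monoDrift v s - c s)) (Ici 0) :=
    fun v hv => locallyIntegrableOn_Ici_iff.2 fun S hS =>
      exp_mul_intervalIntegrable _ (hrate v hv) hS
  have hΦeq : ∀ v t, 0 ≤ t → Real.exp (P.Cf * t) * Φ v t
      = η.fst + ∫ s in (0 : ℝ)..t, Real.exp (P.Cf * s) * (P.monoDrift v s - c s) := by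
    intro v t ht
    simp only [hΦ]
    rw [glue_of_nonneg _ _ ht, hexp]
  -- One step preserves the class of dominated subsolutions and increases the path.
  have hstep : ∀ v, P.IsDominated η B l v →
      (∀ t, 0 ≤ t → Real.exp (P.Cf * t) * v t
        ≤ η.fst + ∫ s in (0 : ℝ)..t, Real.exp (P.Cf * s) * (P.monoDrift v s - c s)) →
      P.IsDominated η B l (Φ v) ∧ (∀ t, 0 ≤ t → v t ≤ Φ v t) ∧
      (∀ t, 0 ≤ t → Real.exp (P.Cf * t) * Φ v t
        ≤ η.fst + ∫ s in (0 : ℝ)..t, Real.exp (P.Cf * s) * (P.monoDrift (Φ v) s - c s)) := by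
    intro v hv hvsub
    have hge : ∀ t, 0 ≤ t → v t ≤ Φ v t := fun t ht => by
      refine le_of_mul_le_mul_left ?_ (Real.exp_pos (P.Cf * t))
      rw [hΦeq v t ht]; exact hvsub t ht
    have hpast : ∀ s, s < 0 → Φ v s = η.snd s := fun s hs => glue_of_neg _ _ hs
    have hc0 : ContinuousOn (fun t => Real.exp (-P.Cf * t) *
        (η.fst + ∫ s in (0 : ℝ)..t, Real.exp (P.Cf * s) * (P.monoDrift v s - c s))) (Ici 0) :=
      (Continuous.continuousOn (by fun_prop)).mul (continuousOn_primitive_Ici (hrate' v hv) _)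
    have hcont : ContinuousOn (Φ v) (Ici 0) := hc0.congr fun t ht => glue_of_nonneg _ _ ht
    have hnn : ∀ s, 0 ≤ s → 0 ≤ Φ v s := fun s hs => (hv.nonneg s hs).trans (hge s hs)
    have hpi : P.PathIntegrable (Φ v) :=
      pathIntegrable_of_past hpast hcont.locallyIntegrableOn_Ici
    have hle : ∀ s, v s ≤ Φ v s := fun s => by
      rcases lt_or_ge s 0 with h | h
      · rw [hv.past s h, hpast s h]
      · exact hge s h
    have hmd := monoDrift_continuousOn hs hpi hcont hnn
    have hmono : ∀ t, 0 ≤ t →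
        (∫ s in (0 : ℝ)..t, Real.exp (P.Cf * s) * (P.monoDrift v s - c s))
        ≤ ∫ s in (0 : ℝ)..t, Real.exp (P.Cf * s) * (P.monoDrift (Φ v) s - c s) := fun t ht =>
      intervalIntegral.integral_mono_on ht (exp_mul_intervalIntegrable _ (hrate v hv) ht)
        (exp_mul_intervalIntegrable _ (hmd.locallyIntegrableOn_Ici.sub hc.1) ht) fun s hs0 => by
          have := monoDrift_mono hs hv.pathIntegrable hpi hv.nonneg hle hs0.1
          exact mul_le_mul_of_nonneg_left (by linarith) (Real.exp_pos _).le
    have hsub' : ∀ t, 0 ≤ t → Real.exp (P.Cf * t) * Φ v t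
        ≤ η.fst + ∫ s in (0 : ℝ)..t, Real.exp (P.Cf * s) * (P.monoDrift (Φ v) s - c s) :=
      fun t ht => by rw [hΦeq v t ht]; linarith [hmono t ht]
    refine ⟨⟨glue_measurable η hc0, hpast, hnn, hgrow _ hpast hcont hnn fun t ht => ?_⟩, hge, hsub'⟩
    refine (hsub' t ht).trans (add_le_add_right (intervalIntegral.integral_mono_on ht
      (exp_mul_intervalIntegrable _ (hmd.locallyIntegrableOn_Ici.sub hc.1) ht)
      (exp_mul_intervalIntegrable _ hmd.locallyIntegrableOn_Ici ht) fun s hs0 => ?_) _)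
    exact mul_le_mul_of_nonneg_left (sub_le_self _ (hc.2 s hs0.1)) (Real.exp_pos _).le
  set u : ℕ → ℝ → ℝ := fun k => Φ^[k] z with hu
  have hsucc : ∀ k, u (k + 1) = Φ (u k) := fun k => Function.iterate_succ_apply' Φ k z
  have hall : ∀ k, P.IsDominated η B l (u k) ∧ ∀ t, 0 ≤ t → Real.exp (P.Cf * t) * u k t
        ≤ η.fst + ∫ s in (0 : ℝ)..t, Real.exp (P.Cf * s) * (P.monoDrift (u k) s - c s) := by
    intro k
    induction k with
    | zero => exact ⟨hz, hsub⟩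
    | succ k ih =>
      rw [hsucc]
      exact ⟨(hstep _ ih.1 ih.2).1, (hstep _ ih.1 ih.2).2.2⟩
  have hmono : ∀ t, 0 ≤ t → Monotone (fun k => u k t) := fun t ht =>
    monotone_nat_of_le_succ fun k => by
      rw [hsucc]; exact (hstep _ (hall k).1 (hall k).2).2.1 t ht
  have hbdd : ∀ t, 0 ≤ t → BddAbove (range fun k => u k t) := fun t ht =>
    ⟨B * Real.exp (l * t), by rintro _ ⟨k, rfl⟩; exact (hall k).1.le t ht⟩
  set x : ℝ → ℝ := fun t => ⨆ k, u k t with hx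
  have hlim : ∀ t, 0 ≤ t → Tendsto (fun k => u k t) atTop (𝓝 (x t)) := fun t ht =>
    tendsto_atTop_ciSup (hmono t ht) (hbdd t ht)
  have hzx : ∀ t, 0 ≤ t → z t ≤ x t := fun t ht => le_ciSup (hbdd t ht) 0
  have hxd : P.IsDominated η B l x := by
    refine ⟨Measurable.iSup fun k => (hall k).1.meas, fun s hs0 => ?_,
      fun s hs0 => (hz.nonneg s hs0).trans (hzx s hs0), fun s hs0 => ?_⟩
    · simp only [hx, (hall _).1.past s hs0]
      exact ciSup_const
    · exact ciSup_le fun k => (hall k).1.le s hs0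
  have hfix : ∀ t, 0 ≤ t → Real.exp (P.Cf * t) * x t
      = η.fst + ∫ s in (0 : ℝ)..t, Real.exp (P.Cf * s) * (P.monoDrift x s - c s) := by
    intro t ht
    have h1 : Tendsto (fun k => Real.exp (P.Cf * t) * u (k + 1) t) atTop
        (𝓝 (Real.exp (P.Cf * t) * x t)) :=
      ((tendsto_add_atTop_iff_nat 1).2 (hlim t ht)).const_mul _
    have hsplit : ∀ v, P.IsDominated η B l v →
        (∫ s in (0 : ℝ)..t, Real.exp (P.Cf * s) * (P.monoDrift v s - c s))
        = (∫ s in (0 : ℝ)..t, Real.exp (P.Cf * s) * P.monoDrift v s)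
          - ∫ s in (0 : ℝ)..t, Real.exp (P.Cf * s) * c s := fun v hv => by
      rw [← intervalIntegral.integral_sub (exp_mul_intervalIntegrable _
        (hv.monoDrift_locallyIntegrableOn hs hη hB hl) ht) (exp_mul_intervalIntegrable _ hc.1 ht)]
      congr 1; ext s; ring
    have h2 : Tendsto (fun k => Real.exp (P.Cf * t) * u (k + 1) t) atTop
        (𝓝 (η.fst + ∫ s in (0 : ℝ)..t, Real.exp (P.Cf * s) * (P.monoDrift x s - c s))) := by
      rw [hsplit x hxd]
      have := ((tendsto_integral_monoDrift hs hη hB hl (fun k => (hall k).1) hxd hlim ht).sub_const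
        (∫ s in (0 : ℝ)..t, Real.exp (P.Cf * s) * c s)).const_add η.fst
      refine this.congr fun k => ?_
      rw [hsucc, hΦeq _ t ht, hsplit _ (hall k).1]
    exact tendsto_nhds_unique h1 h2
  have heqn : ∀ t, 0 ≤ t → x t = η.fst + ∫ s in (0 : ℝ)..t, (P.drift x s - c s) := by
    intro t ht
    -- The integrating factor is removed by multiplying with `exp (-Cf t)`.
    have := exp_mul_primitive (-P.Cf) (hrate' x hxd) hfix ht
    rw [← mul_assoc, ← Real.exp_add, neg_mul, neg_add_cancel, Real.exp_zero, one_mul] at this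
    rw [this]
    congr 1
    refine intervalIntegral.integral_congr fun s _ => ?_
    have e : Real.exp (-P.Cf * s) * Real.exp (P.Cf * s) = 1 := by
      rw [← Real.exp_add]; simp
    calc Real.exp (-P.Cf * s) * (Real.exp (P.Cf * s) * (P.monoDrift x s - c s)
          + -P.Cf * (Real.exp (P.Cf * s) * x s))
        = (Real.exp (-P.Cf * s) * Real.exp (P.Cf * s)) * (P.monoDrift x s - c s - P.Cf * x s) := by
          ring
      _ = P.drift x s - c s := by rw [e]; simp only [monoDrift]; ring
  refine ⟨x, hxd, ?_, hzx, heqn⟩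
  have hloc : LocallyIntegrableOn (fun s => P.drift x s - c s) (Ici 0) := by
    have := (hrate x hxd).sub (hxd.locallyIntegrableOn.smul P.Cf)
    refine (locallyIntegrableOn_congr (Eventually.of_forall fun s => ?_)).1 this
    simp [monoDrift]; ring
  exact (continuousOn_primitive_Ici hloc η.fst).congr heqn

end Problem

end DelayControl

/-! ### A maximizing sequence with almost everywhere convergent controls -/

namespace DelayControl

theorem aemeasurable_liminf_nat {α : Type*} {m : MeasurableSpace α} {μ : Measure α}
    {f : ℕ → α → ENNReal} (hf : ∀ k, AEMeasurable (f k) μ) :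
    AEMeasurable (fun a => liminf (fun k => f k a) atTop) μ := by
  refine ⟨fun a => liminf (fun k => (hf k).mk (f k) a) atTop,
    Measurable.liminf fun k => (hf k).measurable_mk, ?_⟩
  filter_upwards [ae_all_iff.2 fun k => (hf k).ae_eq_mk] with a ha
  simp only [ha]

namespace Problem

variable {P : Problem}

theorem IsControl.aestronglyMeasurable {c : ℝ → ℝ} (hc : IsControl c) :
    AEStronglyMeasurable c (volume.restrict (Ioi 0)) :=
  hc.1.aestronglyMeasurable.mono_measure (Measure.restrict_mono Ioi_subset_Ici_self le_rfl)

theorem IsControl.midpoint {c c' : ℝ → ℝ} (hc : IsControl c) (hc' : IsControl c') :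
    IsControl (fun t => 1 / 2 * c t + 1 / 2 * c' t) :=
  ⟨(hc.1.smul (1 / 2 : ℝ)).add (hc'.1.smul (1 / 2 : ℝ)), fun t ht => by
    have h1 := hc.2 t ht
    have h2 := hc'.2 t ht
    positivity⟩

section optimal

variable (hs : P.StateHypotheses) (hu : P.UtilityHypotheses)
include hs hu

/-- Almost optimal controls are close to each other, in the sense of strict concavity. -/
theorem integral_midpoint_gap_le {η : P.H} (hη : η ∈ P.HPlusPlus) {c c' x x' : ℝ → ℝ} {δ : ℝ}
    (h : P.IsPair η c x) (hf : P.FinitePayoff₂ x) (hδ : P.val η - δ < P.payoff₁ c + P.payoff₂ x)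
    (h' : P.IsPair η c' x') (hf' : P.FinitePayoff₂ x')
    (hδ' : P.val η - δ < P.payoff₁ c' + P.payoff₂ x') :
    IntegrableOn (fun t => Real.exp (-P.ρ * t) * (P.U₁ (1 / 2 * c t + 1 / 2 * c' t)
      - (1 / 2 * P.U₁ (c t) + 1 / 2 * P.U₁ (c' t)))) (Ioi 0) ∧
    ∫ t in Ioi (0 : ℝ), Real.exp (-P.ρ * t) * (P.U₁ (1 / 2 * c t + 1 / 2 * c' t)
      - (1 / 2 * P.U₁ (c t) + 1 / 2 * P.U₁ (c' t))) ≤ δ := by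
  -- The midpoint trajectory is admissible with a control `d` above the midpoint of the controls, so
  -- its payoff is at most the value. Concavity of `U₂` costs nothing, and the strict concavity gain
  -- in `U₁` must fit into the optimality defect `δ`.
  obtain ⟨d, hd, hle⟩ := h.convexCombination (ζ := η) hs h' (α := 1 / 2) (β := 1 / 2)
    (by norm_num) (by norm_num) (by norm_num) (by ring) rfl rfl
  have hm := h.control.midpoint h'.control
  have i1 := hu.integrable₁ h.control
  have i1' := hu.integrable₁ h'.control
  have im := hu.integrable₁ hm
  have hU₂ : ∀ t, 0 < t →
      1 / 2 * (Real.exp (-P.ρ * t) * P.U₂ (x t)) + 1 / 2 * (Real.exp (-P.ρ * t) * P.U₂ (x' t))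
      ≤ Real.exp (-P.ρ * t) * P.U₂ (1 / 2 * x t + 1 / 2 * x' t) := by
    intro t ht
    have := hu.U₂_concave.2 (x := x t) (h.traj.pos t ht.le) (y := x' t) (h'.traj.pos t ht.le)
      (by norm_num : (0 : ℝ) ≤ 1 / 2) (by norm_num : (0 : ℝ) ≤ 1 / 2) (by norm_num)
    simp only [smul_eq_mul] at this
    nlinarith [Real.exp_pos (-P.ρ * t)]
  have hint : IntegrableOn (fun t => 1 / 2 * (Real.exp (-P.ρ * t) * P.U₂ (x t))
      + 1 / 2 * (Real.exp (-P.ρ * t) * P.U₂ (x' t))) (Ioi 0) :=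
    (hf.const_mul _).add (hf'.const_mul _)
  have hfd : P.FinitePayoff₂ (fun t => 1 / 2 * x t + 1 / 2 * x' t) :=
    hu.integrable₂_of_ge hint
      ((hd.traj.cont.mono Ioi_subset_Ici_self).aestronglyMeasurable measurableSet_Ioi)
      (fun t ht => hd.traj.pos t ht.le) hU₂
  have h1 := payoff_le_val hs hu hη hd hfd
  have h2 : 1 / 2 * P.payoff₂ x + 1 / 2 * P.payoff₂ x'
      ≤ P.payoff₂ (fun t => 1 / 2 * x t + 1 / 2 * x' t) := by
    unfold payoff₂
    rw [← integral_const_mul, ← integral_const_mul,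
      ← integral_add (hf.const_mul _) (hf'.const_mul _)]
    exact setIntegral_mono_on hint hfd measurableSet_Ioi hU₂
  have h3 : P.payoff₁ (fun t => 1 / 2 * c t + 1 / 2 * c' t) ≤ P.payoff₁ d := by
    refine hu.payoff₁_mono hm hd.control ?_
    refine (ae_restrict_iff' measurableSet_Ioi).2 (Eventually.of_forall fun t ht => ?_)
    exact hu.strictMonoOn_U₁.monotoneOn (hm.2 t (le_of_lt ht)) (hd.control.2 t (le_of_lt ht))
      (hle t (le_of_lt ht))
  have e : (fun t => Real.exp (-P.ρ * t) * (P.U₁ (1 / 2 * c t + 1 / 2 * c' t)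
      - (1 / 2 * P.U₁ (c t) + 1 / 2 * P.U₁ (c' t))))
      = fun t => Real.exp (-P.ρ * t) * P.U₁ (1 / 2 * c t + 1 / 2 * c' t)
      - (1 / 2 * (Real.exp (-P.ρ * t) * P.U₁ (c t))
        + 1 / 2 * (Real.exp (-P.ρ * t) * P.U₁ (c' t))) := by
    ext; ring
  have i2 := (i1.const_mul (1 / 2)).add (i1'.const_mul (1 / 2))
  rw [e]
  refine ⟨im.sub i2, ?_⟩
  have e2 := integral_sub im i2
  have e3 := integral_add (i1.const_mul (1 / 2)) (i1'.const_mul (1 / 2))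
  simp only [Pi.add_apply] at e2 e3
  rw [e2, e3, integral_const_mul, integral_const_mul]
  unfold payoff₁ at h1 h3 hδ hδ'
  linarith

omit hu in
/-- The accumulated consumption is bounded uniformly over the admissible controls. -/
theorem exists_control_bound {η : P.H} (hη : η ∈ P.HPlusPlus) :
    ∃ (B l : ℝ) (C : ℝ → ℝ), 0 ≤ B ∧ 0 < l ∧ (∀ x : ℝ → ℝ, (∀ s, s < 0 → x s = η.snd s) →
      ContinuousOn x (Ici 0) → (∀ t, 0 ≤ t → 0 ≤ x t) →
      (∀ t, 0 ≤ t → Real.exp (P.Cf * t) * x t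
        ≤ η.fst + ∫ s in (0 : ℝ)..t, Real.exp (P.Cf * s) * P.monoDrift x s) →
      ∀ t, 0 ≤ t → x t ≤ B * Real.exp (l * t)) ∧
      ∀ c x, P.IsPair η c x → P.IsDominated η B l (glue η x) ∧
        ∀ S, 0 ≤ S → ∫ s in (0 : ℝ)..S, Real.exp (P.Cf * s) * c s ≤ C S := by
  obtain ⟨B, l, hB, hl, hgrow⟩ := exists_growth_bound hs hη
  obtain ⟨g, hg, hgb⟩ := exists_dominated_monoDrift_bound hs hη hB hl
  refine ⟨B, l, fun S => η.fst + ∫ s in (0 : ℝ)..S, Real.exp (P.Cf * s) * g s, hB, hl, hgrow,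
    fun c x h => ?_⟩
  have hgl := h.glue hs
  have hpast : ∀ s, s < 0 → glue η x s = η.snd s := fun s hs => glue_of_neg _ _ hs
  have hnn : ∀ t, 0 ≤ t → 0 ≤ glue η x t := fun t ht => (hgl.traj.pos t ht).le
  have hmd := monoDrift_continuousOn hs hgl.traj.pathIntegrable hgl.traj.cont hnn
  have hsplit : ∀ t, 0 ≤ t →
      (∫ s in (0 : ℝ)..t, Real.exp (P.Cf * s) * (P.monoDrift (glue η x) s - c s))
      = (∫ s in (0 : ℝ)..t, Real.exp (P.Cf * s) * P.monoDrift (glue η x) s)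
        - ∫ s in (0 : ℝ)..t, Real.exp (P.Cf * s) * c s := fun t ht => by
    rw [← intervalIntegral.integral_sub (exp_mul_intervalIntegrable _ hmd.locallyIntegrableOn_Ici
      ht) (exp_mul_intervalIntegrable _ h.control.1 ht)]
    congr 1; ext s; ring
  have hcnn : ∀ t, 0 ≤ t → 0 ≤ ∫ s in (0 : ℝ)..t, Real.exp (P.Cf * s) * c s := fun t ht =>
    intervalIntegral.integral_nonneg ht fun s hs0 =>
      mul_nonneg (Real.exp_pos _).le (h.control.2 s hs0.1)
  have hdom : P.IsDominated η B l (glue η x) := by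
    refine ⟨glue_measurable η h.traj.cont, hpast, hnn, hgrow _ hpast hgl.traj.cont hnn
      fun t ht => ?_⟩
    rw [hgl.exp_mul_eq hs ht, hsplit t ht]
    linarith [hcnn t ht]
  refine ⟨hdom, fun S hS => ?_⟩
  -- Weighted total consumption is the initial present plus the weighted drift minus the weighted
  -- final state; the last is nonnegative and the drift is bounded by `g`.
  have h1 := hgl.exp_mul_eq hs hS
  rw [hsplit S hS] at h1
  have h2 : 0 ≤ Real.exp (P.Cf * S) * glue η x S := mul_nonneg (Real.exp_pos _).le (hnn S hS)
  have h3 : (∫ s in (0 : ℝ)..S, Real.exp (P.Cf * s) * P.monoDrift (glue η x) s)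
      ≤ ∫ s in (0 : ℝ)..S, Real.exp (P.Cf * s) * g s :=
    intervalIntegral.integral_mono_on hS
      (exp_mul_intervalIntegrable _ hmd.locallyIntegrableOn_Ici hS)
      (Continuous.intervalIntegrable (by fun_prop) _ _) fun s hs0 =>
      mul_le_mul_of_nonneg_left (hgb _ hdom s hs0.1).2 (Real.exp_pos _).le
  linarith

/-- A maximizing sequence whose controls converge almost everywhere. -/
theorem exists_maximizing_sequence {η : P.H} (hη : η ∈ P.HPlusPlus) {C : ℝ → ℝ}
    (hC : ∀ c x, P.IsPair η c x → ∀ S, 0 ≤ S →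
      ∫ s in (0 : ℝ)..S, Real.exp (P.Cf * s) * c s ≤ C S) :
    ∃ (c x : ℕ → ℝ → ℝ) (δ : ℕ → ℝ) (d : ℝ → ℝ), Tendsto δ atTop (𝓝 0) ∧
      (∀ k, P.IsPair η (c k) (x k) ∧ P.FinitePayoff₂ (x k) ∧
        P.val η - δ k < P.payoff₁ (c k) + P.payoff₂ (x k)) ∧
      IsControl d ∧ ∀ᵐ t ∂(volume.restrict (Ioi (0 : ℝ))),
        Tendsto (fun k => c k t) atTop (𝓝 (d t)) := by
  have hg : ∀ k : ℕ, ∃ g, 0 < g ∧ ∀ a b : ℝ, 0 ≤ a → 0 ≤ b → a ≤ k → (1 / 2 : ℝ) ^ k ≤ |a - b| →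
      g ≤ P.U₁ (1 / 2 * a + 1 / 2 * b) - (1 / 2 * P.U₁ a + 1 / 2 * P.U₁ b) := fun k =>
    hu.exists_midpoint_gap (Nat.cast_nonneg k) (by positivity)
  choose g hg0 hg using hg
  -- The `k`-th gap involves the controls `k` and `k + 1`, so both `δ k` and `δ (k + 1)` must be at
  -- most `(1 / 2) ^ k * g k`. The cap by `1` makes `δ` tend to `0`. At `k = 0` the truncated
  -- subtraction merely repeats the bound by `g 0`.
  set δ : ℕ → ℝ := fun k => min ((1 / 2) ^ k * min (g k) 1) ((1 / 2) ^ (k - 1) * g (k - 1))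
  have hδ0 : ∀ k, 0 < δ k := fun k => by
    have := hg0 (k - 1)
    exact lt_min (mul_pos (by positivity) (lt_min (hg0 k) zero_lt_one)) (by positivity)
  have hδ1 : ∀ k, δ k ≤ (1 / 2) ^ k * g k := fun k =>
    (min_le_left _ _).trans (mul_le_mul_of_nonneg_left (min_le_left _ _) (by positivity))
  have hδ2 : ∀ k, δ (k + 1) ≤ (1 / 2) ^ k * g k := fun k => min_le_right _ _
  have hδ3 : ∀ k, δ k ≤ (1 / 2) ^ k := fun k =>
    (min_le_left _ _).trans (mul_le_of_le_one_right (by positivity) (min_le_right _ _))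
  have hδt : Tendsto δ atTop (𝓝 0) :=
    squeeze_zero (fun k => (hδ0 k).le) hδ3
      (tendsto_pow_atTop_nhds_zero_of_lt_one (by norm_num) (by norm_num))
  choose c x hp hf hlt using fun k => exists_val_sub_lt hs hu hη (hδ0 k)
  set G : ℕ → ℝ → ℝ := fun k t => Real.exp (-P.ρ * t) *
    (P.U₁ (1 / 2 * c k t + 1 / 2 * c (k + 1) t)
      - (1 / 2 * P.U₁ (c k t) + 1 / 2 * P.U₁ (c (k + 1) t))) with hG
  have hGi : ∀ k, IntegrableOn (G k) (Ioi 0) ∧ ∫ t in Ioi (0 : ℝ), G k t ≤ (1 / 2) ^ k * g k :=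
    fun k => integral_midpoint_gap_le hs hu hη (hp k) (hf k) (by linarith [hlt k, hδ1 k])
      (hp (k + 1)) (hf (k + 1)) (by linarith [hlt (k + 1), hδ2 k])
  have hGnn : ∀ k t, 0 < t → 0 ≤ G k t := fun k t ht =>
    mul_nonneg (Real.exp_pos _).le
      (hu.midpoint_nonneg ((hp k).control.2 t ht.le) ((hp (k + 1)).control.2 t ht.le))
  -- Borel–Cantelli in integral form: the functions `G k / g k` have summable integrals, so at
  -- almost every `t` they tend to `0` and are eventually below `exp (-ρ t)`. By the choice of `g
  -- k`, consecutive controls then differ by less than `(1 / 2) ^ k` whenever `c k t ≤ k`.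
  have hsum : ∀ᵐ t ∂(volume.restrict (Ioi (0 : ℝ))),
      ∑' k, ENNReal.ofReal (G k t / g k) < ⊤ := by
    have hm : ∀ k, AEMeasurable (fun t => ENNReal.ofReal (G k t / g k))
        (volume.restrict (Ioi 0)) := fun k =>
      ((hGi k).1.div_const (g k)).aestronglyMeasurable.aemeasurable.ennreal_ofReal
    refine ae_lt_top' (AEMeasurable.tsum hm) ?_
    rw [lintegral_tsum hm]
    have hle : ∀ k, ∫⁻ t in Ioi (0 : ℝ), ENNReal.ofReal (G k t / g k)
        ≤ ENNReal.ofReal ((1 / 2) ^ k) := by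
      intro k
      rw [← ofReal_integral_eq_lintegral_ofReal ((hGi k).1.div_const (g k))]
      · refine ENNReal.ofReal_le_ofReal ?_
        rw [integral_div, div_le_iff₀ (hg0 k)]
        exact (hGi k).2
      · refine (ae_restrict_iff' measurableSet_Ioi).2 (Eventually.of_forall fun t ht => ?_)
        exact div_nonneg (hGnn k t ht) (hg0 k).le
    refine ((ENNReal.tsum_le_tsum hle).trans_lt ?_).ne
    rw [← ENNReal.ofReal_tsum_of_nonneg (fun k => by positivity) summable_geometric_two]
    exact ENNReal.ofReal_lt_top
  have hinc : ∀ᵐ t ∂(volume.restrict (Ioi (0 : ℝ))), ∀ᶠ k in atTop,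
      c k t ≤ k → |c k t - c (k + 1) t| < (1 / 2) ^ k := by
    filter_upwards [hsum, ae_restrict_mem measurableSet_Ioi] with t ht ht0
    have h0 := ENNReal.tendsto_atTop_zero_of_tsum_ne_top ht.ne
    have hpos : (0 : ENNReal) < ENNReal.ofReal (Real.exp (-P.ρ * t)) :=
      ENNReal.ofReal_pos.2 (Real.exp_pos _)
    filter_upwards [h0.eventually_lt_const hpos] with k hk hck
    by_contra hcon
    rw [not_lt] at hcon
    have h1 := hg k (c k t) (c (k + 1) t) ((hp k).control.2 t (le_of_lt ht0))
      ((hp (k + 1)).control.2 t (le_of_lt ht0)) hck hcon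
    refine absurd hk (not_lt.2 (ENNReal.ofReal_le_ofReal ?_))
    rw [le_div_iff₀ (hg0 k)]
    exact mul_le_mul_of_nonneg_left h1 (Real.exp_pos _).le
  have hm : ∀ S k, AEMeasurable (fun t => ENNReal.ofReal (c k t)) (volume.restrict (Ioc 0 S)) :=
    fun S k => (((hp k).control.aestronglyMeasurable).mono_measure
      (Measure.restrict_mono Ioc_subset_Ioi_self le_rfl)).aemeasurable.ennreal_ofReal
  -- Fatou's lemma and the uniform consumption bound. A finite lower limit excludes escape to
  -- infinity at almost every `t`, and the same estimate later gives the local integrability of the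
  -- limit control.
  have hlint : ∀ S : ℝ, 0 ≤ S → ∫⁻ t in Ioc 0 S, liminf (fun k => ENNReal.ofReal (c k t)) atTop
      ≤ ENNReal.ofReal (C S) := by
    intro S hS
    refine (lintegral_liminf_le' (hm S)).trans
      (liminf_le_of_frequently_le' (Frequently.of_forall fun k => ?_))
    have hi := exp_mul_intervalIntegrable P.Cf (hp k).control.1 hS
    refine le_trans ?_ (ENNReal.ofReal_le_ofReal (hC _ _ (hp k) S hS))
    rw [intervalIntegral.integral_of_le hS, ofReal_integral_eq_lintegral_ofReal hi.1]
    · refine setLIntegral_mono_ae' measurableSet_Ioc (Eventually.of_forall fun t ht => ?_)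
      refine ENNReal.ofReal_le_ofReal ?_
      have := (hp k).control.2 t ht.1.le
      exact le_mul_of_one_le_left this (Real.one_le_exp (mul_nonneg hs.Cf_nonneg ht.1.le))
    · refine (ae_restrict_iff' measurableSet_Ioc).2 (Eventually.of_forall fun t ht => ?_)
      exact mul_nonneg (Real.exp_pos _).le ((hp k).control.2 t ht.1.le)
  have hFatou : ∀ S : ℝ, 0 ≤ S → ∀ᵐ t ∂(volume.restrict (Ioc 0 S)),
      liminf (fun k => ENNReal.ofReal (c k t)) atTop < ⊤ := fun S hS =>
    ae_lt_top' (aemeasurable_liminf_nat (hm S)) ((hlint S hS).trans_lt ENNReal.ofReal_lt_top).ne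
  have hfin : ∀ᵐ t ∂(volume.restrict (Ioi (0 : ℝ))),
      liminf (fun k => ENNReal.ofReal (c k t)) atTop < ⊤ := by
    rw [ae_restrict_iff' measurableSet_Ioi]
    have : ∀ᵐ t : ℝ, ∀ n : ℕ, t ∈ Ioc (0 : ℝ) n →
        liminf (fun k => ENNReal.ofReal (c k t)) atTop < ⊤ :=
      ae_all_iff.2 fun n => (ae_restrict_iff' measurableSet_Ioc).1 (hFatou n (Nat.cast_nonneg n))
    filter_upwards [this] with t ht ht0
    obtain ⟨n, hn⟩ := exists_nat_ge t
    exact ht n ⟨ht0, hn⟩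
  have hconv : ∀ᵐ t ∂(volume.restrict (Ioi (0 : ℝ))),
      ∃ a, Tendsto (fun k => c k t) atTop (𝓝 a) := by
    filter_upwards [hinc, hfin] with t h1 h2
    refine exists_tendsto_of_increments h1 ?_
    obtain ⟨R, hR, -⟩ := ENNReal.lt_iff_exists_nnreal_btwn.1 h2
    refine ⟨R, (frequently_lt_of_liminf_lt (by isBoundedDefault) hR).mono fun k hk => ?_⟩
    by_contra hcon
    rw [not_le] at hcon
    refine absurd hk (not_lt.2 ?_)
    rw [← ENNReal.ofReal_coe_nnreal]
    exact ENNReal.ofReal_le_ofReal hcon.le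
  obtain ⟨f, hfm, hflim⟩ := measurable_limit_of_tendsto_metrizable_ae
    (fun k => (hp k).control.aestronglyMeasurable.aemeasurable) hconv
  have hlim : ∀ᵐ t ∂(volume.restrict (Ioi (0 : ℝ))),
      Tendsto (fun k => c k t) atTop (𝓝 (max (f t) 0)) := by
    filter_upwards [hflim, ae_restrict_mem measurableSet_Ioi] with t ht ht0
    have : 0 ≤ f t := ge_of_tendsto' ht fun k => (hp k).control.2 t (le_of_lt ht0)
    rwa [max_eq_left this]
  -- The measurable limit is nonnegative only almost everywhere, while a control is required to be
  -- nonnegative at every time `t ≥ 0`; hence the truncation.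
  refine ⟨c, x, δ, fun t => max (f t) 0, hδt, fun k => ⟨hp k, hf k, hlt k⟩,
    ⟨locallyIntegrableOn_Ici_iff.2 fun S hS => ?_, fun t _ => le_max_right _ _⟩, hlim⟩
  rw [intervalIntegrable_iff_integrableOn_Ioc_of_le hS]
  refine ⟨(hfm.max measurable_const).aestronglyMeasurable, ?_⟩
  rw [hasFiniteIntegral_iff_ofReal (f := fun t => max (f t) 0)
    (Eventually.of_forall fun t => le_max_right _ _)]
  refine lt_of_eq_of_lt ?_ ((hlint S hS).trans_lt ENNReal.ofReal_lt_top)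
  refine lintegral_congr_ae ?_
  filter_upwards [ae_mono (Measure.restrict_mono (show Ioc (0 : ℝ) S ⊆ Ioi 0 from Ioc_subset_Ioi_self) le_rfl) hlim]
    with t ht
  exact ((ENNReal.continuous_ofReal.tendsto _).comp ht).liminf_eq.symm

end optimal

end Problem

end DelayControl

/-! ### Passage to the limit and existence of an optimal pair -/

namespace DelayControl

namespace Problem

variable {P : Problem}

/-- The upper envelopes of a sequence of dominated paths decrease to a dominated path. -/
theorem exists_upper_envelope {η : P.H} {B l : ℝ} {x : ℕ → ℝ → ℝ}
    (hx : ∀ k, P.IsDominated η B l (x k)) :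
    ∃ (z : ℕ → ℝ → ℝ) (w : ℝ → ℝ), (∀ m, P.IsDominated η B l (z m)) ∧ P.IsDominated η B l w ∧
      (∀ m n, m ≤ n → ∀ s, x n s ≤ z m s) ∧
      (∀ m s b, 0 ≤ s → (∀ n, m ≤ n → x n s ≤ b) → z m s ≤ b) ∧
      (∀ s, 0 ≤ s → Antitone fun m => z m s) ∧
      ∀ s, 0 ≤ s → Tendsto (fun m => z m s) atTop (𝓝 (w s)) := by
  have hbdd : ∀ m s, BddAbove (range fun n => x (m + n) s) := fun m s => by
    rcases lt_or_ge s 0 with h | h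
    · exact ⟨η.snd s, by rintro _ ⟨n, rfl⟩; exact ((hx _).past s h).le⟩
    · exact ⟨B * Real.exp (l * s), by rintro _ ⟨n, rfl⟩; exact (hx _).le s h⟩
  have hle : ∀ m n, m ≤ n → ∀ s, x n s ≤ ⨆ n, x (m + n) s := fun m n hmn s => by
    have := le_ciSup (hbdd m s) (n - m)
    simpa [Nat.add_sub_cancel' hmn] using this
  have hdom : ∀ m, P.IsDominated η B l (fun s => ⨆ n, x (m + n) s) := fun m => by
    refine ⟨Measurable.iSup fun n => (hx _).meas, fun s hs => ?_, fun s hs => ?_, fun s hs => ?_⟩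
    · simp only [(hx _).past s hs]; exact ciSup_const
    · exact ((hx m).nonneg s hs).trans (hle m m le_rfl s)
    · exact ciSup_le fun n => (hx _).le s hs
  have hanti : ∀ s, Antitone fun m => ⨆ n, x (m + n) s := fun s m m' hmm =>
    ciSup_le fun n => hle m (m' + n) (by omega) s
  have hbelow : ∀ s, 0 ≤ s → BddBelow (range fun m => ⨆ n, x (m + n) s) := fun s hs =>
    ⟨0, by rintro _ ⟨m, rfl⟩; exact (hdom m).nonneg s hs⟩
  -- No compactness of the trajectories is available or needed: the upper limit `w` of the paths is
  -- enough, since a larger state only helps the monotone drift and the monotone utility `U₂`.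
  refine ⟨fun m s => ⨆ n, x (m + n) s, fun s => ⨅ m, ⨆ n, x (m + n) s, hdom, ?_, hle,
    fun m s b hs hb => ciSup_le fun n => hb _ (by omega), fun s _ => hanti s,
    fun s hs => tendsto_atTop_ciInf (hanti s) (hbelow s hs)⟩
  refine ⟨Measurable.iInf fun m => (hdom m).meas, fun s hs => ?_, fun s hs => ?_, fun s hs => ?_⟩
  · simp only [(hx _).past s hs]; simp
  · exact le_ciInf fun m => (hdom m).nonneg s hs
  · exact (ciInf_le (hbelow s hs) 0).trans ((hdom 0).le s hs)

/-- The state equation passes to the limit as an inequality. -/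
theorem envelope_subsolution (hs : P.StateHypotheses) {η : P.H} (hη : η ∈ P.HPlusPlus)
    {B l : ℝ} (hB : 0 ≤ B) (hl : 0 < l) {c x z : ℕ → ℝ → ℝ} {d w : ℝ → ℝ}
    (hp : ∀ k, P.IsPair η (c k) (x k)) (hx : ∀ k, P.IsDominated η B l (x k))
    (hz : ∀ m, P.IsDominated η B l (z m)) (hw : P.IsDominated η B l w)
    (hxz : ∀ m n, m ≤ n → ∀ s, x n s ≤ z m s)
    (hzle : ∀ m s b, 0 ≤ s → (∀ n, m ≤ n → x n s ≤ b) → z m s ≤ b)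
    (hlim : ∀ s, 0 ≤ s → Tendsto (fun m => z m s) atTop (𝓝 (w s))) (hd : IsControl d)
    (hcd : ∀ᵐ t ∂(volume.restrict (Ioi (0 : ℝ))), Tendsto (fun k => c k t) atTop (𝓝 (d t)))
    {t : ℝ} (ht : 0 ≤ t) : Real.exp (P.Cf * t) * w t
      ≤ η.fst + ∫ s in (0 : ℝ)..t, Real.exp (P.Cf * s) * (P.monoDrift w s - d s) := by
  have hmd : ∀ v, P.IsDominated η B l v → LocallyIntegrableOn (P.monoDrift v) (Ici 0) :=
    fun v hv => hv.monoDrift_locallyIntegrableOn hs hη hB hl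
  have hsplit : ∀ v e, P.IsDominated η B l v → LocallyIntegrableOn e (Ici 0) →
      (∫ s in (0 : ℝ)..t, Real.exp (P.Cf * s) * (P.monoDrift v s - e s))
      = (∫ s in (0 : ℝ)..t, Real.exp (P.Cf * s) * P.monoDrift v s)
        - ∫ s in (0 : ℝ)..t, Real.exp (P.Cf * s) * e s := fun v e hv he => by
    rw [← intervalIntegral.integral_sub (exp_mul_intervalIntegrable _ (hmd v hv) ht)
      (exp_mul_intervalIntegrable _ he ht)]
    congr 1; ext s; ring
  rw [hsplit w d hw hd.1]
  have hnn : ∀ e, IsControl e → ∀ᵐ s ∂(volume.restrict (Ioc 0 t)),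
      0 ≤ Real.exp (P.Cf * s) * e s := fun e he =>
    (ae_restrict_iff' measurableSet_Ioc).2 (Eventually.of_forall fun s hs0 =>
      mul_nonneg (Real.exp_pos _).le (he.2 s hs0.1.le))
  have hlintegral : ∀ e, IsControl e → ENNReal.ofReal (∫ s in (0 : ℝ)..t, Real.exp (P.Cf * s) * e s)
      = ∫⁻ s in Ioc 0 t, ENNReal.ofReal (Real.exp (P.Cf * s) * e s) := fun e he => by
    rw [intervalIntegral.integral_of_le ht, ofReal_integral_eq_lintegral_ofReal
      (exp_mul_intervalIntegrable _ he.1 ht).1 (hnn e he)]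
  have hpos : ∀ e, IsControl e → 0 ≤ ∫ s in (0 : ℝ)..t, Real.exp (P.Cf * s) * e s := fun e he =>
    intervalIntegral.integral_nonneg ht fun s hs0 =>
      mul_nonneg (Real.exp_pos _).le (he.2 s hs0.1)
  -- Fatou's lemma for the controls
  have hFatou : ∀ b, b < ∫ s in (0 : ℝ)..t, Real.exp (P.Cf * s) * d s →
      ∀ᶠ k in atTop, b < ∫ s in (0 : ℝ)..t, Real.exp (P.Cf * s) * c k s := by
    intro b hb
    rcases lt_or_ge b 0 with hb0 | hb0
    · exact Eventually.of_forall fun k => hb0.trans_le (hpos _ (hp k).control)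
    have h1 : ENNReal.ofReal b < liminf (fun k => ENNReal.ofReal
        (∫ s in (0 : ℝ)..t, Real.exp (P.Cf * s) * c k s)) atTop := by
      refine ((ENNReal.ofReal_lt_ofReal_iff (hb0.trans_lt hb)).2 hb).trans_le ?_
      rw [hlintegral d hd]
      simp only [hlintegral _ (hp _).control]
      have hm : ∀ k, AEMeasurable (fun s => ENNReal.ofReal (Real.exp (P.Cf * s) * c k s))
          (volume.restrict (Ioc 0 t)) := fun k =>
        (exp_mul_intervalIntegrable P.Cf (hp k).control.1 ht).1.aestronglyMeasurable.aemeasurable.ennreal_ofReal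
      refine le_trans (le_of_eq ?_) (lintegral_liminf_le' hm)
      refine lintegral_congr_ae ?_
      filter_upwards [ae_mono (Measure.restrict_mono
        (show Ioc (0 : ℝ) t ⊆ Ioi 0 from Ioc_subset_Ioi_self) le_rfl) hcd] with s hs0
      exact ((ENNReal.continuous_ofReal.tendsto _).comp (hs0.const_mul _)).liminf_eq.symm
    filter_upwards [eventually_lt_of_lt_liminf h1] with k hk
    exact (ENNReal.ofReal_lt_ofReal_iff_of_nonneg hb0).1 hk
  suffices h : ∀ b, b < ∫ s in (0 : ℝ)..t, Real.exp (P.Cf * s) * d s →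
      b ≤ η.fst + (∫ s in (0 : ℝ)..t, Real.exp (P.Cf * s) * P.monoDrift w s)
        - Real.exp (P.Cf * t) * w t by
    have := le_of_forall_lt_imp_le_of_dense h
    linarith
  intro b hb
  have h1 := (tendsto_integral_monoDrift hs hη hB hl hz hw hlim ht).const_add η.fst
  have h2 := (hlim t ht).const_mul (Real.exp (P.Cf * t))
  refine ge_of_tendsto (h1.sub h2) ?_
  obtain ⟨N, hN⟩ := eventually_atTop.1 (hFatou b hb)
  filter_upwards [eventually_ge_atTop N] with m hm
  -- For every `n ≥ m`, the drift along `x n` is at most the drift along `z m` and the weighted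
  -- consumption exceeds `b`. The bound is therefore uniform in `n` and passes to the supremum `z m
  -- t`; afterwards `m → ∞`.
  have h3 : z m t ≤ Real.exp (-(P.Cf * t)) *
      (η.fst + (∫ s in (0 : ℝ)..t, Real.exp (P.Cf * s) * P.monoDrift (z m) s) - b) := by
    refine hzle m t _ ht fun n hn => ?_
    refine le_of_mul_le_mul_left ?_ (Real.exp_pos (P.Cf * t))
    rw [← mul_assoc, ← Real.exp_add, add_neg_cancel, Real.exp_zero, one_mul,
      (hp n).exp_mul_eq hs ht, hsplit _ _ (hx n) (hp n).control.1]
    have h4 : (∫ s in (0 : ℝ)..t, Real.exp (P.Cf * s) * P.monoDrift (x n) s)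
        ≤ ∫ s in (0 : ℝ)..t, Real.exp (P.Cf * s) * P.monoDrift (z m) s :=
      intervalIntegral.integral_mono_on ht (exp_mul_intervalIntegrable _ (hmd _ (hx n)) ht)
        (exp_mul_intervalIntegrable _ (hmd _ (hz m)) ht) fun s hs0 =>
        mul_le_mul_of_nonneg_left (monoDrift_mono hs (hx n).pathIntegrable (hz m).pathIntegrable
          (hx n).nonneg (hxz m n hn) hs0.1) (Real.exp_pos _).le
    linarith [hN n (hm.trans hn)]
  have h5 := mul_le_mul_of_nonneg_left h3 (Real.exp_pos (P.Cf * t)).le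
  rw [← mul_assoc, ← Real.exp_add, add_neg_cancel, Real.exp_zero, one_mul] at h5
  linarith

/-- The affine change of variables carries `(t₀, t₀ + 1)` to `(0, L)`. It serves to contradict the
non-integrability of `U₂` at `0⁺` when a path leaves `0` at most linearly. -/
theorem integrableAtFilter_of_scaled {U : ℝ → ℝ} {L : ℝ} (hL : 0 < L) {t₀ : ℝ}
    (h : IntegrableOn (fun t => U (L * (t - t₀))) (Ioo t₀ (t₀ + 1))) :
    IntegrableAtFilter U (𝓝[>] (0 : ℝ)) volume := by
  have h1 : IntervalIntegrable (fun t => U (L * (t - t₀))) volume t₀ (t₀ + 1) :=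
    (intervalIntegrable_iff_integrableOn_Ioo_of_le (by linarith)).2 h
  have h2 := h1.comp_add_right t₀
  simp only [add_sub_cancel_right, sub_self, add_sub_cancel_left] at h2
  have h3 := h2.comp_mul_left (c := L⁻¹)
  simp only [mul_inv_cancel_left₀ hL.ne', zero_div, one_div, inv_inv] at h3
  rw [intervalIntegrable_iff_integrableOn_Ioo_of_le hL.le] at h3
  exact ⟨Ioo 0 L, Ioo_mem_nhdsGT hL, h3⟩

/-- Passage to the limit in the utility of the state, and strict positivity of the limit state. -/
theorem pos_and_payoff₂_ge (hu : P.UtilityHypotheses)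
    (hU₂ : ¬ IntegrableAtFilter P.U₂ (𝓝[>] (0 : ℝ)) volume) {z : ℕ → ℝ → ℝ} {w x : ℝ → ℝ} {b : ℝ}
    (hzpos : ∀ m t, 0 < t → 0 < z m t)
    (hanti : ∀ s, 0 ≤ s → Antitone fun m => z m s)
    (hlim : ∀ s, 0 ≤ s → Tendsto (fun m => z m s) atTop (𝓝 (w s)))
    (hfin : ∀ m, P.FinitePayoff₂ (z m)) (hb : ∀ m, b ≤ P.payoff₂ (z m))
    (hxc : ContinuousOn x (Ici 0)) (hwx : ∀ t, 0 ≤ t → w t ≤ x t) (hx0 : 0 < x 0)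
    (hxnn : ∀ t, 0 ≤ t → 0 ≤ x t)
    (hgrow : ∀ t₀, 0 ≤ t₀ → x t₀ = 0 → ∃ L, 0 < L ∧ ∀ t ∈ Ioo t₀ (t₀ + 1), x t ≤ L * (t - t₀)) :
    (∀ t, 0 ≤ t → 0 < x t) ∧ P.FinitePayoff₂ x ∧ b ≤ P.payoff₂ x := by
  obtain ⟨K, hK⟩ := hu.U₂_bdd
  -- Subtracting from the upper bound `K` makes the integrands nonnegative, and they increase with
  -- `m` because `z m` decreases: monotone convergence needs no prior lower bound on `U₂` along the
  -- limit.
  set F : ℕ → ℝ → ENNReal := fun m t =>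
    ENNReal.ofReal (Real.exp (-P.ρ * t) * (K - P.U₂ (z m t))) with hF
  set I := ∫ t in Ioi (0 : ℝ), Real.exp (-P.ρ * t) * K
  have hint : ∀ v, P.FinitePayoff₂ v →
      IntegrableOn (fun t => Real.exp (-P.ρ * t) * (K - P.U₂ (v t))) (Ioi 0) := fun v hv => by
    have := (hu.integrable_discount K).sub hv
    refine this.congr (Eventually.of_forall fun t => ?_)
    simp only [Pi.sub_apply]; ring
  have hintegral : ∀ v, P.FinitePayoff₂ v →
      ∫ t in Ioi (0 : ℝ), Real.exp (-P.ρ * t) * (K - P.U₂ (v t)) = I - P.payoff₂ v := fun v hv => by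
    unfold payoff₂
    rw [← integral_sub (hu.integrable_discount K) hv]
    congr 1; ext t; ring
  have hFint : ∀ m, ∫⁻ t in Ioi (0 : ℝ), F m t ≤ ENNReal.ofReal (I - b) := fun m => by
    rw [← ofReal_integral_eq_lintegral_ofReal (hint _ (hfin m)), hintegral _ (hfin m)]
    · exact ENNReal.ofReal_le_ofReal (by linarith [hb m])
    · refine (ae_restrict_iff' measurableSet_Ioi).2 (Eventually.of_forall fun t ht => ?_)
      exact mul_nonneg (Real.exp_pos _).le (sub_nonneg.2 (hK _ (hzpos m t ht)))
  have hGint : ∫⁻ t in Ioi (0 : ℝ), ⨆ m, F m t ≤ ENNReal.ofReal (I - b) := by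
    rw [lintegral_iSup']
    · exact iSup_le hFint
    · exact fun m => (hint _ (hfin m)).aestronglyMeasurable.aemeasurable.ennreal_ofReal
    · refine (ae_restrict_iff' measurableSet_Ioi).2 (Eventually.of_forall fun t ht => ?_)
      intro m n hmn
      refine ENNReal.ofReal_le_ofReal (mul_le_mul_of_nonneg_left ?_ (Real.exp_pos _).le)
      have := hu.U₂_mono (hzpos n t ht) (hzpos m t ht) (hanti t (le_of_lt ht) hmn)
      linarith
  -- The limit `w t` may be `0`, where `U₂` is not controlled. The comparison is therefore made at
  -- levels `y > w t`, which `z m t` eventually undershoots.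
  have hkey : ∀ t y, 0 < t → 0 < y → w t < y →
      ENNReal.ofReal (Real.exp (-P.ρ * t) * (K - P.U₂ y)) ≤ ⨆ m, F m t := by
    intro t y ht hy hwy
    obtain ⟨m, hm⟩ := ((hlim t ht.le).eventually_lt_const hwy).exists
    refine le_trans ?_ (le_iSup (fun m => F m t) m)
    refine ENNReal.ofReal_le_ofReal (mul_le_mul_of_nonneg_left ?_ (Real.exp_pos _).le)
    have := hu.U₂_mono (hzpos m t ht) hy hm.le
    linarith
  have hpos : ∀ t, 0 ≤ t → 0 < x t := by
    intro t₀ ht₀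
    by_contra hcon
    have hxt₀ : x t₀ = 0 := le_antisymm (not_lt.1 hcon) (hxnn t₀ ht₀)
    have ht₀' : 0 < t₀ := by
      rcases ht₀.eq_or_lt with h | h
      · rw [← h] at hxt₀; linarith
      · exact h
    obtain ⟨L, hL, hgr⟩ := hgrow t₀ ht₀ hxt₀
    -- After a zero at `t₀` one has `w t ≤ x t ≤ L (t - t₀)`; the factor `2` gives the strict
    -- inequality needed in `hkey`. The finite payoff then makes `U₂ (2 L (t - t₀))` integrable near
    -- `t₀`.
    refine hU₂ (integrableAtFilter_of_scaled (L := 2 * L) (t₀ := t₀) (by positivity) ?_)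
    have hypos : ∀ t ∈ Ioo t₀ (t₀ + 1), 0 < 2 * L * (t - t₀) := fun t ht =>
      mul_pos (by positivity) (by linarith [ht.1])
    have hmeas : AEStronglyMeasurable (fun t => P.U₂ (2 * L * (t - t₀)))
        (volume.restrict (Ioo t₀ (t₀ + 1))) :=
      hu.aestronglyMeasurable_U₂ measurableSet_Ioo
        (Continuous.aestronglyMeasurable (by fun_prop)) hypos
    have hi : IntegrableOn (fun t => Real.exp (-P.ρ * (t₀ + 1)) * (K - P.U₂ (2 * L * (t - t₀))))
        (Ioo t₀ (t₀ + 1)) := by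
      refine ⟨(aestronglyMeasurable_const.sub hmeas).const_mul _, ?_⟩
      rw [hasFiniteIntegral_iff_ofReal ((ae_restrict_iff' measurableSet_Ioo).2
        (Eventually.of_forall fun t ht => mul_nonneg (Real.exp_pos _).le
          (sub_nonneg.2 (hK _ (hypos t ht)))))]
      refine lt_of_le_of_lt ?_ (hGint.trans_lt ENNReal.ofReal_lt_top)
      refine le_trans ?_ (lintegral_mono_set
        (show Ioo t₀ (t₀ + 1) ⊆ Ioi 0 from fun t ht => ht₀'.trans ht.1))
      refine setLIntegral_mono_ae' measurableSet_Ioo (Eventually.of_forall fun t ht => ?_)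
      have htpos : 0 < t := ht₀'.trans ht.1
      refine le_trans (ENNReal.ofReal_le_ofReal ?_) (hkey t (2 * L * (t - t₀)) htpos (hypos t ht) ?_)
      · refine mul_le_mul_of_nonneg_right (Real.exp_le_exp.2 ?_)
          (sub_nonneg.2 (hK _ (hypos t ht)))
        nlinarith [hu.ρ_pos, ht.2]
      · have := hgr t ht
        have h2 := hypos t ht
        have h3 := hwx t htpos.le
        linarith
    have hne : Real.exp (-P.ρ * (t₀ + 1)) ≠ 0 := (Real.exp_pos _).ne'
    have h2 := hi.const_mul (Real.exp (-P.ρ * (t₀ + 1)))⁻¹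
    simp only [inv_mul_cancel_left₀ hne] at h2
    have hKi : IntegrableOn (fun _ : ℝ => K) (Ioo t₀ (t₀ + 1)) := integrableOn_const (by simp)
    refine (hKi.sub h2).congr (Eventually.of_forall fun t => ?_)
    simp
  have hxm : AEStronglyMeasurable (fun t => P.U₂ (x t)) (volume.restrict (Ioi 0)) :=
    hu.aestronglyMeasurable_U₂ measurableSet_Ioi
      ((hxc.mono Ioi_subset_Ici_self).aestronglyMeasurable measurableSet_Ioi)
      fun t ht => hpos t (le_of_lt ht)
  have hle : ∀ t, 0 < t →
      ENNReal.ofReal (Real.exp (-P.ρ * t) * (K - P.U₂ (x t))) ≤ ⨆ m, F m t := by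
    intro t ht
    have hxt := hpos t ht.le
    have hc : ContinuousAt (fun y => ENNReal.ofReal (Real.exp (-P.ρ * t) * (K - P.U₂ y))) (x t) :=
      (ENNReal.continuous_ofReal.continuousAt).comp
        (continuousAt_const.mul (continuousAt_const.sub
          (hu.U₂_cont.continuousAt (Ioi_mem_nhds hxt))))
    refine le_of_tendsto (hc.tendsto.mono_left (nhdsWithin_le_nhds (s := Ioi (x t)))) ?_
    filter_upwards [self_mem_nhdsWithin] with y hy
    exact hkey t y ht (hxt.trans hy) ((hwx t ht.le).trans_lt hy)
  have hnn : ∀ᵐ t ∂(volume.restrict (Ioi (0 : ℝ))),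
      0 ≤ Real.exp (-P.ρ * t) * (K - P.U₂ (x t)) :=
    (ae_restrict_iff' measurableSet_Ioi).2 (Eventually.of_forall fun t ht =>
      mul_nonneg (Real.exp_pos _).le (sub_nonneg.2 (hK _ (hpos t (le_of_lt ht)))))
  have hlint : ∫⁻ t in Ioi (0 : ℝ), ENNReal.ofReal (Real.exp (-P.ρ * t) * (K - P.U₂ (x t)))
      ≤ ENNReal.ofReal (I - b) :=
    (setLIntegral_mono_ae' measurableSet_Ioi (Eventually.of_forall fun t ht => hle t ht)).trans
      hGint
  have hi : IntegrableOn (fun t => Real.exp (-P.ρ * t) * (K - P.U₂ (x t))) (Ioi 0) := by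
    refine ⟨(Continuous.aestronglyMeasurable (by fun_prop)).mul
      (aestronglyMeasurable_const.sub hxm), ?_⟩
    rw [hasFiniteIntegral_iff_ofReal hnn]
    exact hlint.trans_lt ENNReal.ofReal_lt_top
  have hfx : P.FinitePayoff₂ x := by
    refine ((hu.integrable_discount K).sub hi).congr (Eventually.of_forall fun t => ?_)
    simp only [Pi.sub_apply]; ring
  refine ⟨hpos, hfx, ?_⟩
  rw [← ofReal_integral_eq_lintegral_ofReal hi hnn, hintegral x hfx] at hlint
  have hIb : 0 ≤ I - b := by
    have h1 := hb 0
    have h2 : 0 ≤ I - P.payoff₂ (z 0) := by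
      rw [← hintegral _ (hfin 0)]
      exact setIntegral_nonneg measurableSet_Ioi fun t ht =>
        mul_nonneg (Real.exp_pos _).le (sub_nonneg.2 (hK _ (hzpos 0 t ht)))
    linarith
  have := (ENNReal.ofReal_le_ofReal_iff hIb).1 hlint
  linarith

/-- Existence of an optimal control. -/
theorem exists_optimal_pair (hs : P.StateHypotheses) (hu : P.UtilityHypotheses)
    (hU₂ : ¬ IntegrableAtFilter P.U₂ (𝓝[>] (0 : ℝ)) volume) {η : P.H} (hη : η ∈ P.HPlusPlus) :
    ∃ c x, P.IsPair η c x ∧ P.FinitePayoff₂ x ∧ P.val η ≤ P.payoff₁ c + P.payoff₂ x := by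
  obtain ⟨B, l, C, hB, hl, hgrow, hdomC⟩ := exists_control_bound hs hη
  obtain ⟨c, x, δ, d, hδ, hseq, hd, hcd⟩ :=
    exists_maximizing_sequence hs hu hη fun c x h => (hdomC c x h).2
  have hp : ∀ k, P.IsPair η (c k) (glue η (x k)) := fun k => (hseq k).1.glue hs
  have hx : ∀ k, P.IsDominated η B l (glue η (x k)) := fun k => (hdomC _ _ (hseq k).1).1
  have hge : ∀ k t, 0 ≤ t → glue η (x k) t = x k t := fun k t ht => glue_of_nonneg _ _ ht
  obtain ⟨z, w, hz, hw, hxz, hzle, hanti, hlim⟩ := exists_upper_envelope hx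
  obtain ⟨y, hy, hyc, hwy, hyeq⟩ := exists_solution_ge hs hη hB hl hgrow hd hw fun t ht =>
    envelope_subsolution hs hη hB hl hp hx hz hw hxz hzle hlim hd hcd ht
  have hzpos : ∀ m t, 0 < t → 0 < z m t := fun m t ht =>
    ((hp m).traj.pos t ht.le).trans_le (hxz m m le_rfl t)
  have h₁ : Tendsto (fun k => P.payoff₁ (c k)) atTop (𝓝 (P.payoff₁ d)) := by
    obtain ⟨K, hK⟩ := hu.U₁_bdd
    refine tendsto_integral_of_dominated_convergence (fun t => Real.exp (-P.ρ * t) * K)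
      (fun k => (hu.integrable₁ (hp k).control).aestronglyMeasurable)
      (hu.integrable_discount K) (fun k => ?_) ?_
    · refine (ae_restrict_iff' measurableSet_Ioi).2 (Eventually.of_forall fun t ht => ?_)
      rw [norm_mul, Real.norm_of_nonneg (Real.exp_pos _).le]
      exact mul_le_mul_of_nonneg_left (hK _ ((hp k).control.2 t (le_of_lt ht))) (Real.exp_pos _).le
    · filter_upwards [hcd, ae_restrict_mem measurableSet_Ioi] with t ht ht0
      have h1 : Tendsto (fun k => c k t) atTop (𝓝[Ici 0] (d t)) :=
        tendsto_nhdsWithin_iff.2 ⟨ht, Eventually.of_forall fun k =>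
          (hp k).control.2 t (le_of_lt ht0)⟩
      exact ((hu.U₁_cont _ (hd.2 t (le_of_lt ht0))).tendsto.comp h1).const_mul _
  have hz₂ : ∀ m n, m ≤ n → P.FinitePayoff₂ (z m) ∧ P.payoff₂ (x n) ≤ P.payoff₂ (z m) :=
    fun m n hmn => hu.payoff₂_mono (hseq n).2.1 (hz m).meas.aestronglyMeasurable
      (fun t ht => (hseq n).1.traj.pos t ht.le)
      fun t ht => by rw [← hge n t ht.le]; exact hxz m n hmn t
  -- For `n ≥ m` the envelope `z m` lies above `x n`, so its state utility is at least `val η - δ n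
  -- - payoff₁ (c n)`; then `n → ∞`.
  have hb : ∀ m, P.val η - P.payoff₁ d ≤ P.payoff₂ (z m) := by
    intro m
    have h2 : Tendsto (fun k => P.val η - δ k - P.payoff₁ (c k)) atTop
        (𝓝 (P.val η - 0 - P.payoff₁ d)) := (hδ.const_sub _).sub h₁
    rw [sub_zero] at h2
    refine le_of_tendsto h2 ?_
    filter_upwards [eventually_ge_atTop m] with n hn
    linarith [(hz₂ m n hn).2, (hseq n).2.2]
  have hy0 : y 0 = η.fst := by rw [hyeq 0 le_rfl]; simp
  have hpi := hy.pathIntegrable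
  have hrate : LocallyIntegrableOn (fun s => P.drift y s - d s) (Ici 0) :=
    (hs.drift_continuousOn hpi hyc hy.nonneg).locallyIntegrableOn_Ici.sub hd.1
  -- Consumption is nonnegative, so the growth rate is bounded above by the drift, which is
  -- continuous and hence locally bounded. No lower bound on the rate is involved.
  have hygrow : ∀ t₀, 0 ≤ t₀ → y t₀ = 0 →
      ∃ L, 0 < L ∧ ∀ t ∈ Ioo t₀ (t₀ + 1), y t ≤ L * (t - t₀) := by
    intro t₀ ht₀ hyt₀
    have hdc := hs.drift_continuousOn hpi hyc hy.nonneg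
    obtain ⟨L, hL⟩ := (isCompact_Icc (a := t₀) (b := t₀ + 1)).bddAbove_image
      (hdc.mono fun t ht => ht₀.trans ht.1)
    refine ⟨max L 1, by positivity, fun t ht => ?_⟩
    have ht0 : 0 ≤ t := ht₀.trans ht.1.le
    have h1 : y t = ∫ s in t₀..t, (P.drift y s - d s) := by
      have e1 := hyeq t ht0
      have e2 := hyeq t₀ ht₀
      have e3 := intervalIntegral.integral_interval_sub_left
        (locallyIntegrableOn_Ici_iff.1 hrate t ht0) (locallyIntegrableOn_Ici_iff.1 hrate t₀ ht₀)
      linarith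
    rw [h1]
    have h2 : (∫ s in t₀..t, (P.drift y s - d s)) ≤ ∫ _s in t₀..t, max L 1 := by
      refine intervalIntegral.integral_mono_on ht.1.le
        (LocallyIntegrableOn.intervalIntegrable_Ici hrate ht₀ ht0) intervalIntegrable_const
        fun s hs0 => ?_
      have h3 := hL (mem_image_of_mem _ (show s ∈ Icc t₀ (t₀ + 1) from
        ⟨hs0.1, hs0.2.trans ht.2.le⟩))
      have h4 := hd.2 s (ht₀.trans hs0.1)
      have h5 := le_max_left L 1
      linarith
    rw [intervalIntegral.integral_const, smul_eq_mul] at h2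
    linarith
  obtain ⟨hypos, hyfin, hyb⟩ := pos_and_payoff₂_ge hu hU₂ hzpos hanti hlim
    (fun m => (hz₂ m m le_rfl).1) hb hyc hwy (by rw [hy0]; exact hη.1) hy.nonneg hygrow
  have hinit : P.HasInitialDatum η y :=
    hasInitialDatum_of_ae hy0 (Eventually.of_forall fun s hs => hy.past s hs.2)
  have hpair : P.IsPair η d y := by
    have := isPair_of_rate_le hs hinit hypos hrate hyeq fun t ht => sub_le_self _ (hd.2 t ht)
    refine this.congr_control (Eventually.of_forall fun t => ?_) hd.2
    simp
  exact ⟨d, y, hpair, hyfin, by linarith⟩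

end Problem

end DelayControl

/-! ### Shifts, concatenation and dynamic programming -/

namespace DelayControl

theorem integrableOn_Ioi_shift_iff {g : ℝ → ℝ} (t : ℝ) :
    IntegrableOn (fun s => g (t + s)) (Ioi 0) ↔ IntegrableOn g (Ioi t) := by
  have h := (measurePreserving_add_left volume t).integrableOn_comp_preimage
    (measurableEmbedding_addLeft t) (s := Ioi t) (f := g)
  have e : (fun x => t + x) ⁻¹' Ioi t = Ioi 0 := by ext; simp
  rw [e] at h
  exact h

theorem setIntegral_Ioi_shift (g : ℝ → ℝ) (t : ℝ) :
    ∫ s in Ioi (0 : ℝ), g (t + s) = ∫ s in Ioi t, g s := by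
  have h := (measurePreserving_add_left volume t).setIntegral_preimage_emb
    (measurableEmbedding_addLeft t) g (Ioi t)
  have e : (fun x => t + x) ⁻¹' Ioi t = Ioi 0 := by ext; simp
  rwa [e] at h

theorem discounted_shift_integrable {u : ℝ → ℝ} {ρ t : ℝ}
    (h : IntegrableOn (fun s => Real.exp (-ρ * s) * u s) (Ioi t)) :
    IntegrableOn (fun s => Real.exp (-ρ * s) * u (t + s)) (Ioi 0) := by
  have h1 := ((integrableOn_Ioi_shift_iff t).2 h).const_mul (Real.exp (ρ * t))
  refine h1.congr (Eventually.of_forall fun s => ?_)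
  simp only
  rw [← mul_assoc, ← Real.exp_add]
  ring_nf

theorem discounted_shift_integral (u : ℝ → ℝ) (ρ t : ℝ) :
    ∫ s in Ioi t, Real.exp (-ρ * s) * u s
      = Real.exp (-ρ * t) * ∫ s in Ioi (0 : ℝ), Real.exp (-ρ * s) * u (t + s) := by
  rw [← setIntegral_Ioi_shift, ← integral_const_mul]
  congr 1
  ext s
  rw [← mul_assoc, ← Real.exp_add]
  ring_nf

/-- The concatenation at time `t` of two functions. -/
noncomputable def concat (t : ℝ) (u v : ℝ → ℝ) : ℝ → ℝ := fun s => if s < t then u s else v (s - t)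

theorem concat_of_lt {t s : ℝ} (u v : ℝ → ℝ) (h : s < t) : concat t u v s = u s := by
  simp [concat, h]

theorem concat_of_ge {t s : ℝ} (u v : ℝ → ℝ) (h : t ≤ s) : concat t u v s = v (s - t) := by
  simp [concat, not_lt.2 h]

theorem concat_add {t s : ℝ} (u v : ℝ → ℝ) (h : 0 ≤ s) : concat t u v (t + s) = v s := by
  rw [concat_of_ge _ _ (by linarith)]; simp

theorem discounted_concat {u v w : ℝ → ℝ} {ρ t : ℝ} (ht : 0 ≤ t)
    (hu : IntegrableOn (fun s => Real.exp (-ρ * s) * u s) (Ioi 0))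
    (hv : IntegrableOn (fun s => Real.exp (-ρ * s) * v s) (Ioi 0))
    (hw₁ : ∀ s, s < t → w s = u s) (hw₂ : ∀ s, 0 < s → w (t + s) = v s) :
    IntegrableOn (fun s => Real.exp (-ρ * s) * w s) (Ioi 0) ∧
    ∫ s in Ioi (0 : ℝ), Real.exp (-ρ * s) * w s
      = (∫ s in Ioo 0 t, Real.exp (-ρ * s) * u s)
        + Real.exp (-ρ * t) * ∫ s in Ioi (0 : ℝ), Real.exp (-ρ * s) * v s := by
  have e1 : ∀ s ∈ Ioo 0 t, Real.exp (-ρ * s) * u s = Real.exp (-ρ * s) * w s :=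
    fun s hs => by rw [hw₁ s hs.2]
  have i1 : IntegrableOn (fun s => Real.exp (-ρ * s) * w s) (Ioo 0 t) :=
    IntegrableOn.congr_fun (hu.mono_set Ioo_subset_Ioi_self) e1 measurableSet_Ioo
  have i2 : IntegrableOn (fun s => Real.exp (-ρ * s) * w s) (Ioi t) := by
    refine (integrableOn_Ioi_shift_iff t).1 ?_
    refine IntegrableOn.congr_fun (hv.const_mul (Real.exp (-ρ * t))) (fun s hs => ?_)
      measurableSet_Ioi
    rw [hw₂ s hs, ← mul_assoc, ← Real.exp_add]
    ring_nf
  have i1' : IntegrableOn (fun s => Real.exp (-ρ * s) * w s) (Ioc 0 t) :=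
    (integrableOn_Ioc_iff_integrableOn_Ioo).2 i1
  have hU : Ioc 0 t ∪ Ioi t = Ioi 0 := Ioc_union_Ioi_eq_Ioi ht
  refine ⟨hU ▸ i1'.union i2, ?_⟩
  rw [show (∫ s in Ioi (0 : ℝ), Real.exp (-ρ * s) * w s)
      = ∫ s in Ioc 0 t ∪ Ioi t, Real.exp (-ρ * s) * w s by rw [hU], setIntegral_union (Ioc_disjoint_Ioi le_rfl) measurableSet_Ioi i1' i2,
    integral_Ioc_eq_integral_Ioo, discounted_shift_integral,
    setIntegral_congr_fun measurableSet_Ioo fun s hs => (e1 s hs).symm]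
  congr 2
  exact setIntegral_congr_fun measurableSet_Ioi fun s hs => by
    rw [hw₂ s hs]

namespace Problem

variable {P : Problem}

theorem IsPair.exists_segment (hs : P.StateHypotheses) {η : P.H} {c x : ℝ → ℝ}
    (h : P.IsPair η c x) {t : ℝ} (ht : 0 ≤ t) : ∃ ζ : P.H, P.IsSegment x t ζ := by
  have hT := hs.T_pos
  have hpi := h.traj.pathIntegrable t
  have hsq : IntegrableOn (fun s => x s ^ 2) (Icc (-P.T) t) := by
    have h1 : IntegrableOn (fun s => x s ^ 2) (Ico (-P.T) 0) := by
      have : IntegrableOn (fun s => η.snd s ^ 2) (Icc (-P.T) 0) := (Lp.memLp η.snd).integrable_sq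
      refine (this.mono_set Ico_subset_Icc_self).congr ?_
      filter_upwards [h.traj.initial.2] with s h1
      rw [h1]
    have h2 : IntegrableOn (fun s => x s ^ 2) (Icc 0 t) :=
      ((h.traj.cont.mono fun s hs0 => hs0.1).pow 2).integrableOn_Icc
    refine (h1.union h2).mono_set fun s hs0 => ?_
    rcases lt_or_ge s 0 with h' | h'
    · exact Or.inl ⟨hs0.1, h'⟩
    · exact Or.inr ⟨h', hs0.2⟩
  have hshift : ∀ g : ℝ → ℝ, IntegrableOn g (Icc (-P.T) t) →
      IntegrableOn (fun ξ => g (t + ξ)) (Icc (-P.T) 0) := fun g hg => by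
    have h1 : IntervalIntegrable g volume (t + -P.T) (t + 0) := by
      rw [intervalIntegrable_iff_integrableOn_Icc_of_le (by linarith)]
      exact hg.mono_set fun u hu => ⟨by linarith [hu.1], by linarith [hu.2]⟩
    have h2 := h1.comp_add_left t
    simp only [add_sub_cancel_left] at h2
    rwa [intervalIntegrable_iff_integrableOn_Icc_of_le (by linarith)] at h2
  have hm : MemLp (fun ξ => x (t + ξ)) 2 (volume.restrict (Icc (-P.T) 0)) :=
    (memLp_two_iff_integrable_sq (hshift _ hpi).aestronglyMeasurable).2 (hshift _ hsq)
  exact ⟨WithLp.toLp 2 (x t, hm.toLp _), rfl, hm.coeFn_toLp⟩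

theorem IsSegment.ae {x : ℝ → ℝ} {t : ℝ} {ζ : P.H} (h : P.IsSegment x t ζ) :
    ∀ᵐ s, s ∈ Icc (-P.T) 0 → ζ.snd s = x (t + s) :=
  (ae_restrict_iff' measurableSet_Icc).1 h.2

theorem IsSegment.mem_HPlusPlus {η ζ : P.H} (hη : η ∈ P.HPlusPlus) {c x : ℝ → ℝ}
    (h : P.IsPair η c x) {t : ℝ} (ht : 0 ≤ t) (hζ : P.IsSegment x t ζ) : ζ ∈ P.HPlusPlus := by
  refine ⟨by rw [hζ.1]; exact h.traj.pos t ht, (ae_restrict_iff' measurableSet_Icc).2 ?_⟩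
  have := (quasiMeasurePreserving_add_left volume t).ae (h.traj.ae_nonneg hη)
  filter_upwards [hζ.ae, this] with s h1 h2 hs
  rw [h1 hs]
  exact h2 (by linarith [hs.1])

theorem drift_shift (x : ℝ → ℝ) (t s : ℝ) : P.drift (fun s => x (t + s)) s = P.drift x (t + s) := by
  simp only [drift, add_assoc]

theorem IsSegment.hasInitialDatum {x : ℝ → ℝ} {t : ℝ} {ζ : P.H} (h : P.IsSegment x t ζ) :
    P.HasInitialDatum ζ (fun s => x (t + s)) := by
  refine hasInitialDatum_of_ae (by simp [h.1]) ?_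
  filter_upwards [h.ae] with s h1 h2
  exact (h1 (Ico_subset_Icc_self h2)).symm

/-- The tail of a trajectory is a trajectory. -/
theorem IsPair.tail (hs : P.StateHypotheses) {η ζ : P.H} {c x : ℝ → ℝ} (h : P.IsPair η c x)
    {t : ℝ} (ht : 0 ≤ t) (hζ : P.IsSegment x t ζ) :
    P.IsPair ζ (fun s => c (t + s)) (fun s => x (t + s)) := by
  have hr := h.rate_integrable hs
  have hw : LocallyIntegrableOn (fun s => P.drift x (t + s) - c (t + s)) (Ici 0) := by
    refine locallyIntegrableOn_Ici_iff.2 fun S hS => ?_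
    have := (LocallyIntegrableOn.intervalIntegrable_Ici hr ht (by linarith : 0 ≤ t + S)).comp_add_left t
    simpa using this
  have key := isPair_of_rate_le (η := ζ) (w := fun s => P.drift x (t + s) - c (t + s))
    hs hζ.hasInitialDatum (fun s h0 => h.traj.pos _ (by linarith)) hw ?_ ?_
  · refine key.congr_control ?_ fun s h0 => h.control.2 _ (by linarith)
    exact Eventually.of_forall fun s => by rw [drift_shift]; ring
  · intro s h0
    rw [h.eq_primitive hs (by linarith : 0 ≤ t + s), hζ.1, h.eq_primitive hs ht, add_assoc]
    congr 1
    have e := intervalIntegral.integral_comp_add_left (a := 0) (b := s)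
      (fun s => P.drift x s - c s) t
    rw [e, add_zero]
    exact (intervalIntegral.integral_add_adjacent_intervals (locallyIntegrableOn_Ici_iff.1 hr t ht)
      (LocallyIntegrableOn.intervalIntegrable_Ici hr ht (by linarith))).symm
  · intro s h0
    rw [drift_shift]
    exact sub_le_self _ (h.control.2 _ (by linarith))

/-- Trajectories may be concatenated. -/
theorem IsPair.concat (hs : P.StateHypotheses) {η ζ : P.H} {c x d y : ℝ → ℝ} (h : P.IsPair η c x)
    {t : ℝ} (ht : 0 ≤ t) (hζ : P.IsSegment x t ζ) (h' : P.IsPair ζ d y) :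
    P.IsPair η (concat t c d) (concat t x y) := by
  set X := DelayControl.concat t x y with hX
  have hr := h.rate_integrable hs
  have hr' := h'.rate_integrable hs
  set w := DelayControl.concat t (fun s => P.drift x s - c s) (fun s => P.drift y s - d s) with hw
  have hy0 : y 0 = x t := by rw [h'.traj.initial.1, hζ.1]
  have hX_le : ∀ s, s ≤ t → X s = x s := fun s hst => by
    rcases hst.eq_or_lt with h0 | h0
    · rw [hX, h0, concat_of_ge _ _ le_rfl, sub_self, hy0]
    · exact concat_of_lt _ _ h0
  have hd1 : ∀ s, 0 ≤ s → s < t → P.drift X s = P.drift x s := fun s h0 hst => by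
    rw [drift_def, drift_def, hX_le s hst.le]
    congr 2
    unfold delay
    refine intervalIntegral.integral_congr fun ξ hξ => ?_
    rw [uIcc_of_le (by linarith [hs.T_pos])] at hξ
    rw [hX_le _ (by linarith [hξ.2])]
  -- Shifted by `t`, the concatenated path agrees with `y` almost everywhere on `[-T, ∞)`, because
  -- the past of `y` is the segment of `x` at time `t`; the delay integral cannot see the
  -- difference.
  have hd2 : ∀ s, 0 ≤ s → P.drift X (t + s) = P.drift y s := fun s h0 => by
    rw [← drift_shift, drift_def, drift_def]
    have e : ∀ᵐ u, -P.T ≤ u → X (t + u) = y u := by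
      filter_upwards [hζ.ae, h'.traj.initial.ae] with u h1 h2 hu
      rcases lt_or_ge u 0 with h3 | h3
      · rw [hX_le _ (by linarith), h2 ⟨hu, h3⟩, h1 ⟨hu, h3.le⟩]
      · exact concat_add _ _ h3
    rw [hs.delay_congr e h0, hX, concat_add _ _ h0]
  have hwi1 : ∀ s, 0 ≤ s → s ≤ t → IntervalIntegrable w volume 0 s := fun s h0 hst => by
    refine (locallyIntegrableOn_Ici_iff.1 hr s h0).congr_ae ?_
    rw [uIoc_of_le h0, Filter.EventuallyEq, ae_restrict_iff' measurableSet_Ioc]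
    have : ∀ᵐ u : ℝ, u ≠ t := by simp [ae_iff, measure_singleton]
    filter_upwards [this] with u hu hu0
    rw [hw, concat_of_lt _ _ (lt_of_le_of_ne (hu0.2.trans hst) hu)]
  have hint1 : ∀ s, 0 ≤ s → s ≤ t →
      ∫ u in (0 : ℝ)..s, w u = ∫ u in (0 : ℝ)..s, (P.drift x u - c u) := fun s h0 hst => by
    refine intervalIntegral.integral_congr_ae ?_
    have : ∀ᵐ u : ℝ, u ≠ t := by simp [ae_iff, measure_singleton]
    filter_upwards [this] with u hu hu0
    rw [uIoc_of_le h0] at hu0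
    exact concat_of_lt _ _ (lt_of_le_of_ne (hu0.2.trans hst) hu)
  have hwi2 : ∀ s, 0 ≤ s → IntervalIntegrable w volume t (t + s) := fun s h0 => by
    have h1 : IntervalIntegrable (fun u => P.drift y (u - t) - d (u - t)) volume (0 + t) (s + t) :=
      (locallyIntegrableOn_Ici_iff.1 hr' s h0).comp_sub_right t
    rw [zero_add, add_comm] at h1
    refine h1.congr_ae ?_
    rw [uIoc_of_le (by linarith), Filter.EventuallyEq, ae_restrict_iff' measurableSet_Ioc]
    exact Eventually.of_forall fun u hu => by rw [hw, concat_of_ge _ _ hu.1.le]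
  have hint2 : ∀ s, 0 ≤ s →
      ∫ u in t..(t + s), w u = ∫ u in (0 : ℝ)..s, (P.drift y u - d u) := fun s h0 => by
    have e := intervalIntegral.integral_comp_add_left (a := 0) (b := s) w t
    rw [add_zero] at e
    rw [← e]
    refine intervalIntegral.integral_congr fun u hu => ?_
    rw [uIcc_of_le h0] at hu
    exact concat_add _ _ hu.1
  have hwloc : LocallyIntegrableOn w (Ici 0) := by
    refine locallyIntegrableOn_Ici_iff.2 fun S hS => ?_
    rcases le_total S t with h0 | h0
    · exact hwi1 S hS h0
    · have := (hwi1 t ht le_rfl).trans (hwi2 (S - t) (by linarith))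
      simpa using this
  have key := isPair_of_rate_le (η := η) (w := w) (x := X) hs ?_ ?_ hwloc ?_ ?_
  · refine key.congr_control ?_ ?_
    · refine (ae_restrict_iff' measurableSet_Ici).2 (Eventually.of_forall fun s h0 => ?_)
      rcases lt_or_ge s t with h1 | h1
      · rw [hd1 s h0 h1, hw, concat_of_lt _ _ h1, concat_of_lt _ _ h1]; ring
      · obtain ⟨u, rfl⟩ : ∃ u, s = t + u := ⟨s - t, by ring⟩
        have hu : 0 ≤ u := by linarith
        rw [hd2 u hu, hw, concat_add _ _ hu, concat_add _ _ hu]; ring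
    · intro s h0
      rcases lt_or_ge s t with h1 | h1
      · rw [concat_of_lt _ _ h1]; exact h.control.2 s h0
      · rw [concat_of_ge _ _ h1]; exact h'.control.2 _ (by linarith)
  · refine hasInitialDatum_of_ae (by rw [hX_le 0 ht, h.traj.initial.1]) ?_
    filter_upwards [h.traj.initial.ae] with s h1 h2
    rw [hX_le s (h2.2.le.trans ht), h1 h2]
  · intro s h0
    rcases lt_or_ge s t with h1 | h1
    · rw [hX_le s h1.le]; exact h.traj.pos s h0
    · rw [hX, concat_of_ge _ _ h1]; exact h'.traj.pos _ (by linarith)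
  · intro s h0
    rcases le_total s t with h1 | h1
    · rw [hX_le s h1, hint1 s h0 h1, ← h.eq_primitive hs h0]
    · obtain ⟨u, rfl⟩ : ∃ u, s = t + u := ⟨s - t, by ring⟩
      have hu : 0 ≤ u := by linarith
      rw [← intervalIntegral.integral_add_adjacent_intervals (hwi1 t ht le_rfl) (hwi2 u hu),
        hint1 t ht le_rfl, hint2 u hu, ← add_assoc, ← h.eq_primitive hs ht, ← hζ.1,
        ← h'.eq_primitive hs hu, hX, concat_add _ _ hu]
  · intro s h0
    rcases lt_or_ge s t with h1 | h1
    · rw [hd1 s h0 h1, hw, concat_of_lt _ _ h1]; exact sub_le_self _ (h.control.2 s h0)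
    · obtain ⟨u, rfl⟩ : ∃ u, s = t + u := ⟨s - t, by ring⟩
      have hu : 0 ≤ u := by linarith
      rw [hd2 u hu, hw, concat_add _ _ hu]; exact sub_le_self _ (h'.control.2 u hu)

/-- Dynamic programming: the tail of an optimal pair is optimal. -/
theorem tail_optimal (hs : P.StateHypotheses) (hu : P.UtilityHypotheses) {η ζ : P.H}
    (hη : η ∈ P.HPlusPlus) {c x : ℝ → ℝ} (h : P.IsPair η c x) (hf : P.FinitePayoff₂ x)
    (hopt : P.val η ≤ P.payoff₁ c + P.payoff₂ x) {t : ℝ} (ht : 0 ≤ t) (hζ : P.IsSegment x t ζ) :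
    P.FinitePayoff₂ (fun s => x (t + s)) ∧
      P.val ζ ≤ P.payoff₁ (fun s => c (t + s)) + P.payoff₂ (fun s => x (t + s)) := by
  have hζm := hζ.mem_HPlusPlus hη h ht
  have hft : P.FinitePayoff₂ (fun s => x (t + s)) :=
    discounted_shift_integrable (u := fun s => P.U₂ (x s)) (hf.mono_set (Ioi_subset_Ioi ht))
  refine ⟨hft, le_of_forall_pos_le_add fun ε hε => ?_⟩
  -- An `ε`-optimal continuation from `ζ` replaces the tail. The payoffs on `(0, t)` cancel, and the
  -- common factor `exp (-ρ t)` is divided out.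
  obtain ⟨d, y, h', hf', hlt⟩ := exists_val_sub_lt hs hu hζm hε
  have hcat := h.concat hs ht hζ h'
  have htail := h.tail hs ht hζ
  have a1 := discounted_concat (ρ := P.ρ) (t := t) (w := fun s => P.U₁ (concat t c d s)) ht
    (hu.integrable₁ h.control) (hu.integrable₁ h'.control)
    (fun s h0 => by rw [concat_of_lt _ _ h0]) (fun s h0 => by rw [concat_add _ _ h0.le])
  have a2 := discounted_concat (ρ := P.ρ) (t := t) (w := fun s => P.U₂ (concat t x y s)) ht hf hf'
    (fun s h0 => by rw [concat_of_lt _ _ h0]) (fun s h0 => by rw [concat_add _ _ h0.le])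
  have b1 := discounted_concat (ρ := P.ρ) (t := t) (w := fun s => P.U₁ (c s)) ht
    (hu.integrable₁ h.control) (hu.integrable₁ htail.control) (fun s h0 => rfl) (fun s h0 => rfl)
  have b2 := discounted_concat (ρ := P.ρ) (t := t) (w := fun s => P.U₂ (x s)) ht hf hft
    (fun s h0 => rfl) (fun s h0 => rfl)
  have h1 := payoff_le_val hs hu hη hcat a2.1
  have a1' := a1.2
  have a2' := a2.2
  have b1' := b1.2
  have b2' := b2.2
  unfold payoff₁ payoff₂ at *
  have h2 : Real.exp (-P.ρ * t) * (P.val ζ - ε) ≤ Real.exp (-P.ρ * t) *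
      ((∫ s in Ioi (0 : ℝ), Real.exp (-P.ρ * s) * P.U₁ (c (t + s)))
        + ∫ s in Ioi (0 : ℝ), Real.exp (-P.ρ * s) * P.U₂ (x (t + s))) := by
    have := mul_le_mul_of_nonneg_left hlt.le (Real.exp_pos (-P.ρ * t)).le
    rw [mul_add] at this ⊢
    linarith
  have := le_of_mul_le_mul_left h2 (Real.exp_pos _)
  linarith

end Problem

end DelayControl

/-! ### Upward tent perturbations: averages of the marginal utility lie below the supergradients -/

namespace DelayControl

/-- The tent that decreases linearly from `1` at time `0` to `0` at time `δ`. -/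
noncomputable def tent (δ s : ℝ) : ℝ := if s < 0 then 0 else max (1 - s / δ) 0

theorem tent_nonneg (δ s : ℝ) : 0 ≤ tent δ s := by
  unfold tent; split_ifs
  · exact le_rfl
  · exact le_max_right _ _

theorem tent_of_neg {δ s : ℝ} (h : s < 0) : tent δ s = 0 := by simp [tent, h]

theorem tent_zero (δ : ℝ) : tent δ 0 = 1 := by simp [tent]

theorem tent_of_ge {δ s : ℝ} (hδ : 0 < δ) (h : δ ≤ s) : tent δ s = 0 := by
  have h1 : 1 ≤ s / δ := (one_le_div hδ).2 h
  have h0 : ¬ s < 0 := by linarith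
  simp [tent, h0, h1]

theorem tent_of_mem {δ s : ℝ} (hδ : 0 < δ) (h0 : 0 ≤ s) (h : s ≤ δ) : tent δ s = 1 - s / δ := by
  have h1 : s / δ ≤ 1 := (div_le_one hδ).2 h
  simp [tent, not_lt.2 h0, h1]

theorem tent_le_one {δ : ℝ} (hδ : 0 < δ) (s : ℝ) : tent δ s ≤ 1 := by
  unfold tent; split_ifs with h
  · exact zero_le_one
  · exact max_le (by have := div_nonneg (not_lt.1 h) hδ.le; linarith) zero_le_one

theorem tent_le_indicator {δ : ℝ} (hδ : 0 < δ) (s : ℝ) :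
    tent δ s ≤ (Icc 0 δ).indicator (fun _ => (1 : ℝ)) s := by
  by_cases h : s ∈ Icc 0 δ
  · rw [indicator_of_mem h]; exact tent_le_one hδ s
  · rw [indicator_of_notMem h]
    rw [mem_Icc, not_and_or, not_le, not_le] at h
    rcases h with h | h
    · rw [tent_of_neg h]
    · rw [tent_of_ge hδ h.le]

/-- The slope of the tent. -/
noncomputable def tentSlope (δ s : ℝ) : ℝ := if s < δ then -(1 / δ) else 0

theorem tentSlope_intervalIntegrable (δ a b : ℝ) : IntervalIntegrable (tentSlope δ) volume a b := by
  refine IntervalIntegrable.mono_fun' (g := fun _ => |1 / δ|) intervalIntegrable_const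
    ((Measurable.ite measurableSet_Iio measurable_const measurable_const).aestronglyMeasurable) ?_
  refine Eventually.of_forall fun s => ?_
  simp only [tentSlope]
  split_ifs <;> simp

theorem tent_eq_integral {δ : ℝ} (hδ : 0 < δ) {s : ℝ} (hs : 0 ≤ s) :
    tent δ s = 1 + ∫ u in (0 : ℝ)..s, tentSlope δ u := by
  have h1 : ∀ s, 0 ≤ s → s ≤ δ → ∫ u in (0 : ℝ)..s, tentSlope δ u = -(s / δ) := fun s h0 hs => by
    have : ∫ u in (0 : ℝ)..s, tentSlope δ u = ∫ _u in (0 : ℝ)..s, -(1 / δ) := by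
      refine intervalIntegral.integral_congr_ae ?_
      have : ∀ᵐ u : ℝ, u ≠ δ := by simp [ae_iff, measure_singleton]
      filter_upwards [this] with u hu hu0
      rw [uIoc_of_le h0] at hu0
      simp [tentSlope, lt_of_le_of_ne (hu0.2.trans hs) hu]
    rw [this, intervalIntegral.integral_const, smul_eq_mul]
    ring
  rcases le_total s δ with h | h
  · rw [tent_of_mem hδ hs h, h1 s hs h]; ring
  · have h2 : ∫ u in δ..s, tentSlope δ u = 0 := by
      rw [intervalIntegral.integral_congr_ae (g := fun _ => (0 : ℝ))]
      · simp
      · refine Eventually.of_forall fun u hu => ?_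
        rw [uIoc_of_le h] at hu
        simp [tentSlope, not_lt.2 hu.1.le]
    rw [tent_of_ge hδ h, ← intervalIntegral.integral_add_adjacent_intervals
      (tentSlope_intervalIntegrable δ 0 δ) (tentSlope_intervalIntegrable δ δ s), h2, h1 δ hδ.le le_rfl,
      div_self hδ.ne']
    ring

theorem measurable_tent (δ : ℝ) : Measurable (tent δ) :=
  Measurable.ite measurableSet_Iio measurable_const (by fun_prop)

namespace Problem

variable {P : Problem}

theorem tent_pathIntegrable {δ : ℝ} (hδ : 0 < δ) : P.PathIntegrable (tent δ) := fun S => by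
  refine Integrable.mono' (integrableOn_const (C := (1 : ℝ)) (by simp))
    (measurable_tent δ).aestronglyMeasurable (Eventually.of_forall fun s => ?_)
  rw [Real.norm_of_nonneg (tent_nonneg _ _)]
  exact tent_le_one hδ s

theorem delay_tent_nonneg (hs : P.StateHypotheses) (δ : ℝ) {t : ℝ} (ht : 0 ≤ t) :
    0 ≤ P.delay (tent δ) t :=
  hs.delay_nonneg (Eventually.of_forall fun s _ => tent_nonneg δ s) ht

theorem delay_tent_le (hs : P.StateHypotheses) {A : ℝ} (hA0 : 0 ≤ A)
    (hA : ∀ ξ ∈ Icc (-P.T) 0, P.a ξ ≤ A) {δ : ℝ} (hδ : 0 < δ) {t : ℝ} (ht : 0 ≤ t) :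
    P.delay (tent δ) t ≤ A * δ := by
  have hT := hs.T_pos
  set I : ℝ → ℝ := (Icc 0 δ).indicator (fun _ => (1 : ℝ))
  have hI : Integrable I :=
    (integrable_indicator_iff measurableSet_Icc).2 (integrableOn_const (by simp))
  have hI0 : ∀ s, 0 ≤ I s := fun s => indicator_nonneg (fun _ _ => zero_le_one) s
  have hsh : Integrable (fun ξ => I (t + ξ)) := hI.comp_add_left t
  have h1 : P.delay (tent δ) t ≤ ∫ ξ in (-P.T)..0, A * I (t + ξ) := by
    refine intervalIntegral.integral_mono_on (by linarith)
      (hs.delay_intervalIntegrable (tent_pathIntegrable hδ) ht)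
      (hsh.intervalIntegrable.const_mul A) fun ξ hξ => ?_
    exact mul_le_mul (hA ξ hξ) (tent_le_indicator hδ _) (tent_nonneg _ _) hA0
  refine h1.trans ?_
  rw [intervalIntegral.integral_const_mul]
  refine mul_le_mul_of_nonneg_left ?_ hA0
  have h2 : ∫ s, I s = δ := by
    rw [integral_indicator measurableSet_Icc]
    simp [hδ.le]
  rw [intervalIntegral.integral_of_le (by linarith)]
  calc _ ≤ ∫ ξ, I (t + ξ) := setIntegral_le_integral hsh (Eventually.of_forall fun _ => hI0 _)
    _ = δ := by rw [integral_add_left_eq_self I t, h2]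

theorem delay_tent_of_ge (hs : P.StateHypotheses) {δ : ℝ} (hδ : 0 < δ) {t : ℝ} (ht : δ + P.T ≤ t) :
    P.delay (tent δ) t = 0 := by
  unfold delay
  rw [intervalIntegral.integral_congr (g := fun _ => (0 : ℝ))]
  · simp
  · intro ξ hξ
    rw [uIcc_of_le (by linarith [hs.T_pos])] at hξ
    simp only
    rw [tent_of_ge hδ (by linarith [hξ.1]), mul_zero]

/-- The perturbation of a trajectory in the direction of a tent. -/
theorem IsPair.perturb (hs : P.StateHypotheses) {ζ : P.H} {c x : ℝ → ℝ} (h : P.IsPair ζ c x)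
    {δ : ℝ} (hδ : 0 < δ) (k : ℝ) (hpos : ∀ t, 0 ≤ t → 0 < x t + k * tent δ t)
    (hc : ∀ t, 0 ≤ t → 0 ≤ c t + (P.drift (fun s => x s + k * tent δ s) t - P.drift x t)
      - k * tentSlope δ t) :
    P.IsPair (WithLp.toLp 2 (ζ.fst + k, ζ.snd)) (fun t => c t
      + (P.drift (fun s => x s + k * tent δ s) t - P.drift x t) - k * tentSlope δ t)
      (fun s => x s + k * tent δ s) := by
  have hr := h.rate_integrable hs
  have hsl : LocallyIntegrableOn (fun t => k * tentSlope δ t) (Ici 0) :=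
    locallyIntegrableOn_Ici_iff.2 fun S _ => (tentSlope_intervalIntegrable δ 0 S).const_mul k
  have key := isPair_of_rate_le (η := (WithLp.toLp 2 (ζ.fst + k, ζ.snd) : P.H))
    (w := fun t => P.drift x t - c t + k * tentSlope δ t)
    (x := fun s => x s + k * tent δ s) hs ?_ hpos (hr.add hsl) ?_ ?_
  · refine key.congr_control (Eventually.of_forall fun t => by ring) hc
  · refine hasInitialDatum_of_ae ?_ ?_
    · simp [h.traj.initial.1, tent_zero]
    · filter_upwards [h.traj.initial.ae] with s h1 h2
      rw [h1 h2, tent_of_neg h2.2]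
      simp
  · intro t ht
    rw [intervalIntegral.integral_add (locallyIntegrableOn_Ici_iff.1 hr t ht)
      (locallyIntegrableOn_Ici_iff.1 hsl t ht), intervalIntegral.integral_const_mul,
      h.eq_primitive hs ht, tent_eq_integral hδ ht]
    simp only [WithLp.toLp_fst]
    ring
  · intro t ht
    have := hc t ht
    linarith

theorem delay_perturb (hs : P.StateHypotheses) {x : ℝ → ℝ} (hx : P.PathIntegrable x) {δ : ℝ}
    (hδ : 0 < δ) (k : ℝ) {t : ℝ} (ht : 0 ≤ t) :
    P.delay (fun s => x s + k * tent δ s) t = P.delay x t + k * P.delay (tent δ) t := by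
  have := hs.delay_comb hx (tent_pathIntegrable hδ) 1 k ht
  simpa using this

/-- The marginal utility, with value `⊤` at `0`. -/
noncomputable def marginal (P : Problem) (c : ℝ) : ENNReal :=
  if c = 0 then ⊤ else ENNReal.ofReal (deriv P.U₁ c)

/-- `q` is a supergradient of the value function in the direction `(1, 0)`. -/
def IsSupergradient (P : Problem) (ζ : P.H) (q : ℝ) : Prop :=
  ∀ s, 0 < s → P.val (WithLp.toLp 2 (s, ζ.snd)) ≤ P.val ζ + q * (s - ζ.fst)

section lower

variable (hs : P.StateHypotheses) (hu : P.UtilityHypotheses)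
include hs hu

/-- The present is raised by `k` and the path `x + k tent` is followed, so the state utility does
not decrease. The descent of the tent releases consumption at rate `k / δ` on `[0, δ)`, of which at
most `Cf k` is lost through the drift. The supergradient caps the total gain by `k q`, while
concavity bounds the gain in `U₁` below by the increment times `U₁'` at the raised consumption. The
limit `k → 0` is taken afterwards. -/
theorem lintegral_marginal_add_le {ζ : P.H} (hζ : ζ ∈ P.HPlusPlus) {c x : ℝ → ℝ}
    (h : P.IsPair ζ c x) (hf : P.FinitePayoff₂ x) (hopt : P.val ζ ≤ P.payoff₁ c + P.payoff₂ x)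
    {q : ℝ} (hq : P.IsSupergradient ζ q) {δ : ℝ} (hδ : 0 < δ) (hk : 0 < 1 / δ - P.Cf) {k : ℝ}
    (hk0 : 0 < k) :
    ∫⁻ s in Ioo 0 δ, ENNReal.ofReal (Real.exp (-P.ρ * δ) * ((1 / δ - P.Cf) *
      deriv P.U₁ (c s + k * (1 / δ - P.Cf)))) ≤ ENNReal.ofReal q := by
  have hC := hs.Cf_nonneg
  have hdr : ∀ t, 0 ≤ t →
      -(P.Cf * (k * tent δ t)) ≤ P.drift (fun s => x s + k * tent δ s) t - P.drift x t := by
    intro t ht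
    rw [drift_def, drift_def, delay_perturb hs h.traj.pathIntegrable hδ k ht]
    have h0 := mul_nonneg hk0.le (tent_nonneg δ t)
    have h1 := hs.f₀_add_mono (h.traj.pos t ht).le (x' := x t + k * tent δ t) (by linarith)
      (show P.delay x t ≤ P.delay x t + k * P.delay (tent δ) t by
        have := mul_nonneg hk0.le (delay_tent_nonneg hs δ ht); linarith)
    have h2 := mul_nonneg hs.r_pos.le h0
    nlinarith
  have hgain : ∀ t, 0 ≤ t → t < δ → c t + k * (1 / δ - P.Cf) ≤ c t
      + (P.drift (fun s => x s + k * tent δ s) t - P.drift x t) - k * tentSlope δ t := by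
    intro t ht htδ
    have h1 := hdr t ht
    have h2 := tent_le_one hδ t
    have h3 : tentSlope δ t = -(1 / δ) := by simp [tentSlope, htδ]
    rw [h3]
    nlinarith [mul_le_mul_of_nonneg_left h2 (mul_nonneg hC hk0.le)]
  have hgain' : ∀ t, 0 ≤ t → c t ≤ c t
      + (P.drift (fun s => x s + k * tent δ s) t - P.drift x t) - k * tentSlope δ t := by
    intro t ht
    rcases lt_or_ge t δ with h1 | h1
    · have := hgain t ht h1
      have := mul_pos hk0 hk
      linarith
    · have h2 := hdr t ht
      rw [tent_of_ge hδ h1] at h2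
      have h3 : tentSlope δ t = 0 := by simp [tentSlope, not_lt.2 h1]
      rw [h3]
      linarith
  have hp := h.perturb hs hδ k (fun t ht => by
    have := h.traj.pos t ht
    have := mul_nonneg hk0.le (tent_nonneg δ t)
    linarith) (fun t ht => (h.control.2 t ht).trans (hgain' t ht))
  set ck : ℝ → ℝ := fun t => c t
      + (P.drift (fun s => x s + k * tent δ s) t - P.drift x t) - k * tentSlope δ t
  have h2 := hu.payoff₂_mono (x := fun s => x s + k * tent δ s) (y := x) hf
    ((hp.traj.cont.mono Ioi_subset_Ici_self).aestronglyMeasurable measurableSet_Ioi)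
    (fun t ht => h.traj.pos t ht.le)
    (fun t _ => by have := mul_nonneg hk0.le (tent_nonneg δ t); linarith)
  have hζk : 0 < ζ.fst + k := by have : 0 < ζ.fst := hζ.1; linarith
  have h3 := payoff_le_val hs hu (fiber_mem hζ hζk) hp h2.1
  have h4 := hq _ hζk
  rw [add_sub_cancel_left] at h4
  have i0 := hu.integrable₁ h.control
  have ik := hu.integrable₁ hp.control
  have hD : ∫ s in Ioi (0 : ℝ), (Real.exp (-P.ρ * s) * P.U₁ (ck s)
      - Real.exp (-P.ρ * s) * P.U₁ (c s)) ≤ k * q := by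
    rw [integral_sub ik i0]
    unfold payoff₁ at h3 hopt
    linarith [h2.2]
  have hDnn : ∀ s, 0 < s → P.U₁ (c s) ≤ P.U₁ (ck s) := fun s h0 =>
    hu.strictMonoOn_U₁.monotoneOn (h.control.2 s h0.le) (hp.control.2 s h0.le) (hgain' s h0.le)
  have hlint : ∫⁻ s in Ioo 0 δ, ENNReal.ofReal k * ENNReal.ofReal (Real.exp (-P.ρ * δ) *
      ((1 / δ - P.Cf) * deriv P.U₁ (c s + k * (1 / δ - P.Cf)))) ≤ ENNReal.ofReal (k * q) := by
    refine le_trans ?_ (ENNReal.ofReal_le_ofReal hD)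
    have hDi : IntegrableOn (fun s => Real.exp (-P.ρ * s) * P.U₁ (ck s)
        - Real.exp (-P.ρ * s) * P.U₁ (c s)) (Ioi 0) := ik.sub i0
    rw [ofReal_integral_eq_lintegral_ofReal hDi
      ((ae_restrict_iff' measurableSet_Ioi).2 (Eventually.of_forall fun s h0 => by
        have := mul_le_mul_of_nonneg_left (hDnn s h0) (Real.exp_pos (-P.ρ * s)).le
        simpa using this))]
    refine le_trans ?_ (lintegral_mono_set (show Ioo 0 δ ⊆ Ioi 0 from Ioo_subset_Ioi_self))
    refine setLIntegral_mono_ae' measurableSet_Ioo (Eventually.of_forall fun s hs0 => ?_)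
    rw [← ENNReal.ofReal_mul hk0.le]
    refine ENNReal.ofReal_le_ofReal ?_
    have hcs := h.control.2 s hs0.1.le
    have hkk : 0 < k * (1 / δ - P.Cf) := mul_pos hk0 hk
    have e1 := hu.mul_deriv_le hcs hkk
    have e2 : P.U₁ (c s + k * (1 / δ - P.Cf)) ≤ P.U₁ (ck s) :=
      hu.strictMonoOn_U₁.monotoneOn (show 0 ≤ c s + k * (1 / δ - P.Cf) by linarith)
        (hp.control.2 s hs0.1.le) (hgain s hs0.1.le hs0.2)
    have e3 : Real.exp (-P.ρ * δ) ≤ Real.exp (-P.ρ * s) :=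
      Real.exp_le_exp.2 (by nlinarith [hu.ρ_pos, hs0.2])
    have e4 : 0 ≤ k * (1 / δ - P.Cf) * deriv P.U₁ (c s + k * (1 / δ - P.Cf)) :=
      mul_nonneg hkk.le (hu.U₁_deriv_pos _ (by linarith)).le
    calc k * (Real.exp (-P.ρ * δ) * ((1 / δ - P.Cf) * deriv P.U₁ (c s + k * (1 / δ - P.Cf))))
        = Real.exp (-P.ρ * δ) * (k * (1 / δ - P.Cf) * deriv P.U₁ (c s + k * (1 / δ - P.Cf))) := by
          ring
      _ ≤ Real.exp (-P.ρ * s) * (k * (1 / δ - P.Cf) * deriv P.U₁ (c s + k * (1 / δ - P.Cf))) :=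
          mul_le_mul_of_nonneg_right e3 e4
      _ ≤ Real.exp (-P.ρ * s) * (P.U₁ (ck s) - P.U₁ (c s)) :=
          mul_le_mul_of_nonneg_left (by linarith) (Real.exp_pos _).le
      _ = _ := by ring
  rw [lintegral_const_mul' _ _ ENNReal.ofReal_ne_top, ENNReal.ofReal_mul hk0.le] at hlint
  exact (ENNReal.mul_le_mul_iff_right (ENNReal.ofReal_pos.2 hk0).ne' ENNReal.ofReal_ne_top).1 hlint

/-- Supergradients dominate the averages of the marginal utility along an optimal control. -/
theorem lintegral_marginal_le {ζ : P.H} (hζ : ζ ∈ P.HPlusPlus) {c x : ℝ → ℝ}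
    (h : P.IsPair ζ c x) (hf : P.FinitePayoff₂ x) (hopt : P.val ζ ≤ P.payoff₁ c + P.payoff₂ x)
    {q : ℝ} (hq : P.IsSupergradient ζ q) {δ : ℝ} (hδ : 0 < δ) (hk : 0 < 1 / δ - P.Cf) :
    ENNReal.ofReal (Real.exp (-P.ρ * δ) * (1 / δ - P.Cf)) * ∫⁻ s in Ioo 0 δ, P.marginal (c s)
      ≤ ENNReal.ofReal q := by
  set K := 1 / δ - P.Cf
  set e := Real.exp (-P.ρ * δ)
  have he : 0 < e := Real.exp_pos _
  rw [← lintegral_const_mul' _ _ ENNReal.ofReal_ne_top]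
  set G : ℕ → ℝ → ENNReal := fun n s =>
    ENNReal.ofReal (e * (K * deriv P.U₁ (c s + (1 / ((n : ℝ) + 1)) * K)))
  have hcm : AEMeasurable c (volume.restrict (Ioo 0 δ)) :=
    (h.control.aestronglyMeasurable.mono_measure
      (Measure.restrict_mono Ioo_subset_Ioi_self le_rfl)).aemeasurable
  have hGm : ∀ n, AEMeasurable (G n) (volume.restrict (Ioo 0 δ)) := fun n =>
    ((((measurable_deriv P.U₁).comp_aemeasurable (hcm.add_const _)).const_mul K).const_mul
      e).ennreal_ofReal
  have hGle : ∀ n, ∫⁻ s in Ioo 0 δ, G n s ≤ ENNReal.ofReal q := fun n =>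
    lintegral_marginal_add_le hs hu hζ h hf hopt hq hδ hk (by positivity)
  -- Fatou's lemma with `k = 1 / (n + 1)`. Where `c s = 0` the integrands tend to `⊤`, so the value
  -- of `marginal` at `0` is the correct limit, and the inequality excludes that `c` vanishes on a
  -- set of positive measure in `(0, δ)`.
  refine le_trans (b := ∫⁻ s in Ioo 0 δ, liminf (fun n => G n s) atTop) ?_
    ((lintegral_liminf_le' hGm).trans
      (liminf_le_of_frequently_le' (Frequently.of_forall hGle)))
  refine setLIntegral_mono_ae' measurableSet_Ioo (Eventually.of_forall fun s hs0 => ?_)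
  have hcs := h.control.2 s hs0.1.le
  have hto : Tendsto (fun n : ℕ => c s + (1 / ((n : ℝ) + 1)) * K) atTop (𝓝 (c s)) := by
    have := (tendsto_one_div_add_atTop_nhds_zero_nat.mul_const K).const_add (c s)
    simpa using this
  rcases hcs.eq_or_lt with h0 | h0
  · have h1 : Tendsto (fun n : ℕ => c s + (1 / ((n : ℝ) + 1)) * K) atTop (𝓝[>] 0) := by
      refine tendsto_nhdsWithin_iff.2 ⟨by rw [← h0] at hto ⊢; exact hto,
        Eventually.of_forall fun n => ?_⟩
      have : 0 < (1 / ((n : ℝ) + 1)) * K := by positivity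
      rw [mem_Ioi]
      linarith
    have h2 : Tendsto (fun n => G n s) atTop (𝓝 ⊤) :=
      ENNReal.tendsto_ofReal_nhds_top.2
        ((((hu.U₁_deriv_zero.comp h1).const_mul_atTop hk)).const_mul_atTop he)
    rw [h2.liminf_eq]
    exact le_top
  · have hc : ContinuousAt (deriv P.U₁) (c s) :=
      hu.continuousOn_deriv_U₁.continuousAt (Ioi_mem_nhds h0)
    have h2 : Tendsto (fun n => G n s) atTop
        (𝓝 (ENNReal.ofReal (e * (K * deriv P.U₁ (c s))))) :=
      (ENNReal.continuous_ofReal.tendsto _).comp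
        (((hc.tendsto.comp hto).const_mul K).const_mul e)
    rw [h2.liminf_eq, marginal, if_neg h0.ne', ← ENNReal.ofReal_mul (by positivity), mul_assoc]

end lower

end Problem

end DelayControl

/-! ### Downward tent perturbations: the reverse inequality up to order `δ` -/

namespace DelayControl

namespace Problem

variable {P : Problem}

/-- Bound on the decrease of the consumption rate under a unit downward tent perturbation. -/
noncomputable def tentCost (P : Problem) (A δ s : ℝ) : ℝ :=
  (Iio δ).indicator (fun _ => 1 / δ + P.r + P.Cf) s + P.Cf * (A * δ)

theorem measurable_tentCost (A δ : ℝ) : Measurable (P.tentCost A δ) :=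
  (measurable_const.indicator measurableSet_Iio).add_const _

section upper

variable (hs : P.StateHypotheses)
include hs

theorem tentCost_nonneg {A δ : ℝ} (hA : 0 ≤ A) (hδ : 0 < δ) (s : ℝ) : 0 ≤ P.tentCost A δ s := by
  have := hs.Cf_nonneg
  have := hs.r_pos
  refine add_nonneg (indicator_nonneg (fun _ _ => by positivity) _) (by positivity)

theorem tentCost_le {A δ : ℝ} (hδ : 0 < δ) (s : ℝ) :
    P.tentCost A δ s ≤ 1 / δ + P.r + P.Cf + P.Cf * (A * δ) := by
  have := hs.Cf_nonneg
  have := hs.r_pos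
  exact add_le_add_left (indicator_le' (fun _ _ => le_rfl) (fun _ _ => by positivity) s) _

theorem drift_sub_tent_ge {x : ℝ → ℝ} (hx : P.PathIntegrable x) {δ θ : ℝ} (hδ : 0 < δ)
    (hθ : 0 ≤ θ) {t : ℝ} (ht : 0 ≤ t) (hxt : 0 ≤ x t) (hpos : 0 ≤ x t + -θ * tent δ t) :
    P.drift x t - θ * ((P.r + P.Cf) * tent δ t + P.Cf * P.delay (tent δ) t)
      ≤ P.drift (fun s => x s + -θ * tent δ s) t := by
  rw [drift_def, drift_def, delay_perturb hs hx hδ (-θ) ht]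
  have h1 := (abs_le.1 (hs.f₀_lipschitz (x t + -θ * tent δ t) (x t)
    (P.delay x t + -θ * P.delay (tent δ) t) (P.delay x t) hpos hxt)).1
  have h2 := mul_nonneg hθ (tent_nonneg δ t)
  have h3 := mul_nonneg hθ (delay_tent_nonneg hs δ ht)
  rw [add_sub_cancel_left, add_sub_cancel_left, neg_mul, neg_mul, abs_neg, abs_neg,
    abs_of_nonneg h2, abs_of_nonneg h3] at h1
  rw [neg_mul, neg_mul] at *
  linarith

variable (hu : P.UtilityHypotheses)
include hu

/-- The present is lowered by `θ` and the path `x - θ tent` is followed. Consumption drops by at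
most `θ tentCost` up to time `δ + T`, after which the delay no longer sees the tent and the control
is unchanged. The state utility drops by at most `L θ` on `[0, δ]`. The smallness of `θ` keeps the
state above `μ` on `[0, δ]` and the consumption above `m / 2` on `[0, δ + T]`; the supergradient
inequality is finally divided by `θ`. -/
theorem supergradient_le_integral_tentCost {ζ : P.H} (hζ : ζ ∈ P.HPlusPlus) {c x : ℝ → ℝ}
    (h : P.IsPair ζ c x) (hf : P.FinitePayoff₂ x) (hopt : P.val ζ ≤ P.payoff₁ c + P.payoff₂ x)
    {q : ℝ} (hq : P.IsSupergradient ζ q) {A δ m μ L θ : ℝ} (hA0 : 0 ≤ A)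
    (hA : ∀ ξ ∈ Icc (-P.T) 0, P.a ξ ≤ A) (hδ : 0 < δ) (hm : 0 < m)
    (hmc : ∀ s ∈ Icc 0 (δ + P.T), m ≤ c s) (hμ : 0 < μ) (hμx : ∀ s ∈ Icc 0 δ, 2 * μ ≤ x s)
    (hL0 : 0 ≤ L) (hL : ∀ y y', μ ≤ y' → y' ≤ y → P.U₂ y - P.U₂ y' ≤ L * (y - y'))
    (hθ : 0 < θ) (hθμ : θ ≤ μ)
    (hθm : θ * (1 / δ + P.r + P.Cf + P.Cf * (A * δ)) ≤ m / 2) :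
    q ≤ (∫ s in Ioc 0 (δ + P.T), P.tentCost A δ s * deriv P.U₁ (c s - θ * P.tentCost A δ s))
      + L * δ := by
  have hC := hs.Cf_nonneg
  have hT := hs.T_pos
  have hr := hs.r_pos
  set e := P.tentCost A δ
  have he0 : ∀ s, 0 ≤ e s := tentCost_nonneg hs hA0 hδ
  have hem : ∀ s, θ * e s ≤ m / 2 := fun s =>
    (mul_le_mul_of_nonneg_left (tentCost_le hs hδ s) hθ.le).trans hθm
  have hxpos : ∀ t, 0 ≤ t → 0 < x t + -θ * tent δ t := fun t ht => by
    rcases le_or_gt δ t with h1 | h1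
    · rw [tent_of_ge hδ h1]
      simpa using h.traj.pos t ht
    · have h2 := hμx t ⟨ht, h1.le⟩
      have h3 := mul_le_mul_of_nonneg_left (tent_le_one hδ t) hθ.le
      linarith
  set ck : ℝ → ℝ := fun t => c t
      + (P.drift (fun s => x s + -θ * tent δ s) t - P.drift x t) - -θ * tentSlope δ t with hck
  have hloss : ∀ t, 0 ≤ t → c t - θ * e t ≤ ck t := fun t ht => by
    have h1 := drift_sub_tent_ge hs h.traj.pathIntegrable hδ hθ.le ht (h.traj.pos t ht).le
      (hxpos t ht).le
    have h2 := mul_le_mul_of_nonneg_left (delay_tent_le hs hA0 hA hδ ht) (mul_nonneg hθ.le hC)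
    simp only [hck, e, tentCost]
    rcases lt_or_ge t δ with h3 | h3
    · have h4 := mul_le_mul_of_nonneg_left (tent_le_one hδ t)
        (mul_nonneg hθ.le (add_nonneg hr.le hC))
      rw [indicator_of_mem (show t ∈ Iio δ from h3)]
      simp only [tentSlope, if_pos h3]
      linarith
    · rw [indicator_of_notMem (show t ∉ Iio δ from not_lt.2 h3)]
      rw [tent_of_ge hδ h3] at h1
      simp only [tentSlope, if_neg (not_lt.2 h3)]
      linarith
  have heq : ∀ t, δ + P.T ≤ t → ck t = c t := fun t ht => by
    have h3 : δ ≤ t := by linarith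
    simp only [hck]
    rw [drift_def, drift_def, delay_perturb hs h.traj.pathIntegrable hδ (-θ) (by linarith),
      delay_tent_of_ge hs hδ ht, tent_of_ge hδ h3]
    simp [tentSlope, not_lt.2 h3]
  have hck0 : ∀ t, 0 ≤ t → 0 ≤ ck t := fun t ht => by
    rcases le_total t (δ + P.T) with h1 | h1
    · have := hloss t ht
      have := hmc t ⟨ht, h1⟩
      have := hem t
      linarith
    · rw [heq t h1]; exact h.control.2 t ht
  have hp := h.perturb hs hδ (-θ) hxpos hck0
  have hxm : AEStronglyMeasurable (fun s => x s + -θ * tent δ s) (volume.restrict (Ioi 0)) :=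
    ((h.traj.cont.mono Ioi_subset_Ici_self).aestronglyMeasurable measurableSet_Ioi).add
      ((measurable_tent δ).const_mul _).aestronglyMeasurable
  set b₂ : ℝ → ℝ := (Ioc 0 δ).indicator fun _ => L * θ
  have hb₂ : IntegrableOn b₂ (Ioi 0) :=
    ((integrable_indicator_iff measurableSet_Ioc).2 (integrableOn_const (by simp))).integrableOn
  have hU₂ : ∀ t, 0 < t → Real.exp (-P.ρ * t) * P.U₂ (x t) - b₂ t
      ≤ Real.exp (-P.ρ * t) * P.U₂ (x t + -θ * tent δ t) := fun t ht => by
    rcases le_or_gt t δ with h1 | h1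
    · simp only [b₂]
      rw [indicator_of_mem (show t ∈ Ioc 0 δ from ⟨ht, h1⟩)]
      have h2 := hμx t ⟨ht.le, h1⟩
      have h3 := mul_le_mul_of_nonneg_left (tent_le_one hδ t) hθ.le
      have h4 := mul_nonneg hθ.le (tent_nonneg δ t)
      have h5 := hL (x t) (x t + -θ * tent δ t) (by linarith) (by linarith)
      have h6 : P.U₂ (x t) - P.U₂ (x t + -θ * tent δ t) ≤ L * θ :=
        h5.trans (mul_le_mul_of_nonneg_left (by linarith) hL0)
      have h7 : Real.exp (-P.ρ * t) ≤ 1 := Real.exp_le_one_iff.2 (by nlinarith [hu.ρ_pos])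
      have h8 := mul_le_mul_of_nonneg_left h6 (Real.exp_pos (-P.ρ * t)).le
      have h9 := mul_le_mul_of_nonneg_right h7 (mul_nonneg hL0 hθ.le)
      linarith
    · simp only [b₂]
      rw [indicator_of_notMem (show t ∉ Ioc 0 δ from fun h => absurd h.2 (not_le.2 h1)),
        tent_of_ge hδ h1.le]
      simp
  have hfk : P.FinitePayoff₂ (fun s => x s + -θ * tent δ s) :=
    hu.integrable₂_of_ge (hf.sub hb₂) hxm (fun t ht => hxpos t ht.le) hU₂
  have hint₂ : P.payoff₂ x - L * θ * δ ≤ P.payoff₂ (fun s => x s + -θ * tent δ s) := by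
    have e1 : ∫ t in Ioi (0 : ℝ), b₂ t = L * θ * δ := by
      rw [setIntegral_indicator measurableSet_Ioc, inter_eq_right.2 Ioc_subset_Ioi_self]
      simp [hδ.le, mul_comm]
    have e2 : ∫ t in Ioi (0 : ℝ), (Real.exp (-P.ρ * t) * P.U₂ (x t) - b₂ t)
      = P.payoff₂ x - L * θ * δ := by rw [integral_sub hf hb₂, e1]; rfl
    rw [← e2]
    exact setIntegral_mono_on (hf.sub hb₂) hfk measurableSet_Ioi fun t ht => hU₂ t ht
  set b₁ : ℝ → ℝ := (Ioc 0 (δ + P.T)).indicator fun s => θ * (e s * deriv P.U₁ (c s - θ * e s))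
  have hcm : AEMeasurable c (volume.restrict (Ioc 0 (δ + P.T))) :=
    (h.control.aestronglyMeasurable.mono_measure
      (Measure.restrict_mono Ioc_subset_Ioi_self le_rfl)).aemeasurable
  have hem' : AEMeasurable e (volume.restrict (Ioc 0 (δ + P.T))) :=
    (measurable_tentCost A δ).aemeasurable
  have hlow : ∀ s ∈ Ioc 0 (δ + P.T), m / 2 ≤ c s - θ * e s := fun s hs' => by
    have := hmc s ⟨hs'.1.le, hs'.2⟩
    have := hem s
    linarith
  have hb₁ : IntegrableOn b₁ (Ioi 0) := by
    refine ((integrable_indicator_iff measurableSet_Ioc).2 ?_).integrableOn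
    refine Integrable.mono' (integrableOn_const (C := m / 2 * deriv P.U₁ (m / 2)) (by simp))
      ((hem'.mul ((measurable_deriv P.U₁).comp_aemeasurable
        (hcm.sub (hem'.const_mul θ)))).const_mul θ).aestronglyMeasurable
      ((ae_restrict_iff' measurableSet_Ioc).2 (Eventually.of_forall fun s hs' => ?_))
    have h1 := hlow s hs'
    have h2 := hu.U₁_deriv_pos (c s - θ * e s) (by linarith)
    have h3 : deriv P.U₁ (c s - θ * e s) ≤ deriv P.U₁ (m / 2) :=
      hu.strictAntiOn_deriv_U₁.antitoneOn (show 0 < m / 2 by linarith)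
        (show 0 < c s - θ * e s by linarith) h1
    rw [← mul_assoc, Real.norm_of_nonneg (mul_nonneg (mul_nonneg hθ.le (he0 s)) h2.le)]
    exact mul_le_mul (hem s) h3 h2.le (by linarith)
  have hU₁ : ∀ t, 0 < t → Real.exp (-P.ρ * t) * P.U₁ (c t) - b₁ t
      ≤ Real.exp (-P.ρ * t) * P.U₁ (ck t) := fun t ht => by
    rcases le_or_gt t (δ + P.T) with h1 | h1
    · have hmem : t ∈ Ioc 0 (δ + P.T) := ⟨ht, h1⟩
      simp only [b₁]
      rw [indicator_of_mem hmem]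
      have h2 := hlow t hmem
      have h3 : 0 ≤ θ * e t := mul_nonneg hθ.le (he0 t)
      have h4 : P.U₁ (c t - θ * e t) ≤ P.U₁ (ck t) :=
        hu.strictMonoOn_U₁.monotoneOn (show 0 ≤ c t - θ * e t by linarith)
          (hck0 t ht.le) (hloss t ht.le)
      have hd := hu.U₁_deriv_pos (c t - θ * e t) (by linarith)
      have h5 : P.U₁ (c t) - P.U₁ (c t - θ * e t) ≤ θ * e t * deriv P.U₁ (c t - θ * e t) := by
        rcases h3.eq_or_lt with h3 | h3
        · rw [← h3]; simp
        · have := hu.sub_le_mul_deriv (c := c t - θ * e t) (by linarith) (c' := c t)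
            (h.control.2 t ht.le) (by linarith)
          rw [sub_sub_cancel] at this
          exact this.le
      have h7 : Real.exp (-P.ρ * t) ≤ 1 := Real.exp_le_one_iff.2 (by nlinarith [hu.ρ_pos])
      have h8 := mul_le_mul_of_nonneg_left (show P.U₁ (c t) - θ * e t *
        deriv P.U₁ (c t - θ * e t) ≤ P.U₁ (ck t) by linarith) (Real.exp_pos (-P.ρ * t)).le
      have h9 := mul_le_mul_of_nonneg_right h7 (mul_nonneg h3 hd.le)
      linarith
    · simp only [b₁]
      rw [indicator_of_notMem (show t ∉ Ioc 0 (δ + P.T) from fun h => absurd h.2 (not_le.2 h1)),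
        heq t h1.le]
      simp
  have i0 := hu.integrable₁ h.control
  have hint₁ : P.payoff₁ c - θ * (∫ s in Ioc 0 (δ + P.T), e s * deriv P.U₁ (c s - θ * e s))
      ≤ P.payoff₁ ck := by
    have e1 : ∫ t in Ioi (0 : ℝ), b₁ t
        = θ * ∫ s in Ioc 0 (δ + P.T), e s * deriv P.U₁ (c s - θ * e s) := by
      rw [setIntegral_indicator measurableSet_Ioc, inter_eq_right.2 Ioc_subset_Ioi_self,
        integral_const_mul]
    have e2 : ∫ t in Ioi (0 : ℝ), (Real.exp (-P.ρ * t) * P.U₁ (c t) - b₁ t)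
      = P.payoff₁ c - θ * ∫ s in Ioc 0 (δ + P.T), e s * deriv P.U₁ (c s - θ * e s) := by
        rw [integral_sub i0 hb₁, e1]; rfl
    rw [← e2]
    exact setIntegral_mono_on (i0.sub hb₁) (hu.integrable₁ hp.control) measurableSet_Ioi
      fun t ht => hU₁ t ht
  have hζθ : 0 < ζ.fst + -θ := by
    have h1 := hμx 0 ⟨le_rfl, hδ.le⟩
    rw [h.traj.initial.1] at h1
    linarith
  have h3 := payoff_le_val hs hu (fiber_mem hζ hζθ) hp hfk
  have h4 := hq _ hζθ
  rw [add_sub_cancel_left] at h4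
  refine le_of_mul_le_mul_left ?_ hθ
  linarith

/-- Averages of the marginal utility along an optimal control dominate the supergradients, up to a
first order error. -/
theorem supergradient_le {ζ : P.H} (hζ : ζ ∈ P.HPlusPlus) {c x : ℝ → ℝ}
    (h : P.IsPair ζ c x) (hf : P.FinitePayoff₂ x) (hopt : P.val ζ ≤ P.payoff₁ c + P.payoff₂ x)
    {q : ℝ} (hq : P.IsSupergradient ζ q) {A δ m μ L : ℝ} (hA0 : 0 ≤ A)
    (hA : ∀ ξ ∈ Icc (-P.T) 0, P.a ξ ≤ A) (hδ : 0 < δ) (hm : 0 < m)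
    (hmc : ∀ s ∈ Icc 0 (δ + P.T), m ≤ c s) (hμ : 0 < μ) (hμx : ∀ s ∈ Icc 0 δ, 2 * μ ≤ x s)
    (hL0 : 0 ≤ L) (hL : ∀ y y', μ ≤ y' → y' ≤ y → P.U₂ y - P.U₂ y' ≤ L * (y - y')) :
    q ≤ (1 / δ + P.r + P.Cf) * (∫ s in Ioc 0 δ, deriv P.U₁ (c s))
      + P.Cf * (A * δ) * ((δ + P.T) * deriv P.U₁ m) + L * δ := by
  have hC := hs.Cf_nonneg
  have hT := hs.T_pos
  have hr := hs.r_pos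
  set e := P.tentCost A δ
  set M := 1 / δ + P.r + P.Cf + P.Cf * (A * δ)
  have hM : 0 < M := by positivity
  have he0 : ∀ s, 0 ≤ e s := tentCost_nonneg hs hA0 hδ
  have heM : ∀ s, e s ≤ M := tentCost_le hs hδ
  -- The largest perturbation size allowed by the two smallness conditions. The sizes `θ n` tend to
  -- `0`, and since the perturbed consumption stays above `m / 2`, the marginal utilities are
  -- dominated by a constant.
  set θ₀ := min μ (m / 2 / M)
  have hθ₀ : 0 < θ₀ := lt_min hμ (by positivity)
  set θ : ℕ → ℝ := fun n => θ₀ * (1 / ((n : ℝ) + 1))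
  have hθpos : ∀ n, 0 < θ n := fun n => by positivity
  have hθle : ∀ n, θ n ≤ θ₀ := fun n => by
    refine mul_le_of_le_one_right hθ₀.le ?_
    rw [div_le_one (by positivity)]
    have : (0 : ℝ) ≤ n := n.cast_nonneg
    linarith
  have hθM : ∀ n, θ n * M ≤ m / 2 := fun n =>
    (le_div_iff₀ hM).1 ((hθle n).trans (min_le_right _ _))
  have hθto : Tendsto θ atTop (𝓝 0) := by
    simpa only [mul_zero] using tendsto_one_div_add_atTop_nhds_zero_nat.const_mul θ₀
  have hcm : AEMeasurable c (volume.restrict (Ioc 0 (δ + P.T))) :=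
    (h.control.aestronglyMeasurable.mono_measure
      (Measure.restrict_mono Ioc_subset_Ioi_self le_rfl)).aemeasurable
  have hem' : AEMeasurable e (volume.restrict (Ioc 0 (δ + P.T))) :=
    (measurable_tentCost A δ).aemeasurable
  have hlow : ∀ n, ∀ s ∈ Ioc 0 (δ + P.T), m / 2 ≤ c s - θ n * e s := fun n s hs' => by
    have := hmc s ⟨hs'.1.le, hs'.2⟩
    have := (mul_le_mul_of_nonneg_left (heM s) (hθpos n).le).trans (hθM n)
    linarith
  have hlim : Tendsto (fun n => ∫ s in Ioc 0 (δ + P.T), e s * deriv P.U₁ (c s - θ n * e s))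
      atTop (𝓝 (∫ s in Ioc 0 (δ + P.T), e s * deriv P.U₁ (c s))) := by
    refine tendsto_integral_of_dominated_convergence (fun _ => M * deriv P.U₁ (m / 2))
      (fun n => (hem'.mul ((measurable_deriv P.U₁).comp_aemeasurable
        (hcm.sub (hem'.const_mul _)))).aestronglyMeasurable) (integrableOn_const (by simp)) ?_ ?_
    · refine fun n => (ae_restrict_iff' measurableSet_Ioc).2 (Eventually.of_forall fun s hs' => ?_)
      have h1 := hlow n s hs'
      have h2 := hu.U₁_deriv_pos (c s - θ n * e s) (by linarith)
      have h3 : deriv P.U₁ (c s - θ n * e s) ≤ deriv P.U₁ (m / 2) :=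
        hu.strictAntiOn_deriv_U₁.antitoneOn (show 0 < m / 2 by linarith)
          (show 0 < c s - θ n * e s by linarith) h1
      rw [Real.norm_of_nonneg (mul_nonneg (he0 s) h2.le)]
      exact mul_le_mul (heM s) h3 h2.le hM.le
    · refine (ae_restrict_iff' measurableSet_Ioc).2 (Eventually.of_forall fun s hs' => ?_)
      have h1 := hmc s ⟨hs'.1.le, hs'.2⟩
      have hca : ContinuousAt (deriv P.U₁) (c s) :=
        hu.continuousOn_deriv_U₁.continuousAt (Ioi_mem_nhds (by linarith))
      refine Tendsto.const_mul _ (hca.tendsto.comp ?_)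
      simpa using (hθto.mul_const (e s)).const_sub (c s)
  have h1 : q ≤ (∫ s in Ioc 0 (δ + P.T), e s * deriv P.U₁ (c s)) + L * δ :=
    ge_of_tendsto' (hlim.add_const _) fun n =>
      supergradient_le_integral_tentCost hs hu hζ h hf hopt hq hA0 hA hδ hm hmc hμ hμx hL0 hL
        (hθpos n) ((hθle n).trans (min_le_left _ _)) (hθM n)
  have hgle : ∀ s ∈ Ioc 0 (δ + P.T), deriv P.U₁ (c s) ≤ deriv P.U₁ m := fun s hs' => by
    have h1 := hmc s ⟨hs'.1.le, hs'.2⟩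
    exact hu.strictAntiOn_deriv_U₁.antitoneOn hm (show 0 < c s by linarith) h1
  have hgi : IntegrableOn (fun s => deriv P.U₁ (c s)) (Ioc 0 (δ + P.T)) := by
    refine Integrable.mono' (integrableOn_const (C := deriv P.U₁ m) (by simp))
      ((measurable_deriv P.U₁).comp_aemeasurable hcm).aestronglyMeasurable
      ((ae_restrict_iff' measurableSet_Ioc).2 (Eventually.of_forall fun s hs' => ?_))
    have h2 := hu.U₁_deriv_pos (c s) (hm.trans_le (hmc s ⟨hs'.1.le, hs'.2⟩))
    rw [Real.norm_of_nonneg h2.le]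
    exact hgle s hs'
  have h2 : ∫ s in Ioc 0 (δ + P.T), e s * deriv P.U₁ (c s)
      = (1 / δ + P.r + P.Cf) * (∫ s in Ioc 0 δ, deriv P.U₁ (c s))
        + P.Cf * (A * δ) * ∫ s in Ioc 0 (δ + P.T), deriv P.U₁ (c s) := by
    have e1 : ∀ s, e s * deriv P.U₁ (c s) = (Iio δ).indicator
        (fun s => (1 / δ + P.r + P.Cf) * deriv P.U₁ (c s)) s
        + P.Cf * (A * δ) * deriv P.U₁ (c s) := fun s => by
      simp only [e, tentCost, indicator]
      split_ifs <;> ring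
    have e2 : Ioc 0 (δ + P.T) ∩ Iio δ = Ioo 0 δ := by
      ext s
      simp only [mem_inter_iff, mem_Ioc, mem_Iio, mem_Ioo]
      constructor
      · exact fun h => ⟨h.1.1, h.2⟩
      · exact fun h => ⟨⟨h.1, by linarith [h.2]⟩, h.2⟩
    simp only [e1]
    rw [integral_add ((hgi.const_mul _).indicator measurableSet_Iio) (hgi.const_mul _),
      setIntegral_indicator measurableSet_Iio, e2, integral_const_mul, integral_const_mul,
      integral_Ioc_eq_integral_Ioo (y := δ)]
  have h3 : ∫ s in Ioc 0 (δ + P.T), deriv P.U₁ (c s) ≤ (δ + P.T) * deriv P.U₁ m := by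
    calc _ ≤ ∫ _s in Ioc 0 (δ + P.T), deriv P.U₁ m :=
          setIntegral_mono_on hgi (integrableOn_const (by simp)) measurableSet_Ioc hgle
      _ = _ := by simp [(by linarith : (0 : ℝ) ≤ δ + P.T)]
  have h4 := mul_le_mul_of_nonneg_left h3 (show 0 ≤ P.Cf * (A * δ) by positivity)
  linarith

end upper

end Problem

end DelayControl

/-! ### Lebesgue differentiation; supergradients of the value function -/

namespace DelayControl

/-- A function whose averages over short intervals to the right are bounded is bounded. -/
theorem ae_le_of_forall_lintegral_le {f : ℝ → ENNReal} {S K δ₀ : ℝ}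
    (hf : AEMeasurable f (volume.restrict (Ioi 0))) (hδ₀ : 0 < δ₀) (hK : 0 ≤ K)
    (h : ∀ t δ, 0 ≤ t → t ≤ S → 0 < δ → δ ≤ δ₀ →
      ∫⁻ s in Ioc t (t + δ), f s ≤ ENNReal.ofReal (K * δ)) :
    ∀ᵐ s, s ∈ Ioo 0 S → f s ≤ ENNReal.ofReal K := by
  have hm : ∀ {a b : ℝ}, 0 ≤ a → AEMeasurable f (volume.restrict (Ioc a b)) := fun ha =>
    hf.mono_measure (Measure.restrict_mono (fun s hs => ha.trans_lt hs.1) le_rfl)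
  -- On an interval of length `δ₀` the function has finite integral, so almost everywhere it is the
  -- right derivative of its primitive, whose difference quotients are at most `K`. Such intervals
  -- cover `(0, S)`.
  have hloc : ∀ t, 0 ≤ t → t ≤ S →
      ∀ᵐ s, s ∈ Ioo t (t + δ₀) → s < S → f s ≤ ENNReal.ofReal K := by
    intro t ht htS
    have hfin : ∫⁻ s in Ioc t (t + δ₀), f s ≠ ⊤ :=
      ((h t δ₀ ht htS hδ₀ le_rfl).trans_lt ENNReal.ofReal_lt_top).ne
    have hlt := (ae_restrict_iff' measurableSet_Ioc).1 (ae_lt_top' (hm ht) hfin)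
    have hint : IntervalIntegrable (fun s => (f s).toReal) volume t (t + δ₀) :=
      (intervalIntegrable_iff_integrableOn_Ioc_of_le (by linarith)).2
        (integrable_toReal_of_lintegral_ne_top (hm ht) hfin)
    filter_upwards [hlt, hint.ae_hasDerivAt_integral] with s hs1 hs2 hs hsS
    have hsI : s ∈ Ioc t (t + δ₀) := ⟨hs.1, hs.2.le⟩
    have hu : uIcc t (t + δ₀) = Icc t (t + δ₀) := uIcc_of_le (by linarith)
    have hd := hs2 (hu ▸ ⟨hs.1.le, hs.2.le⟩) t (hu ▸ ⟨le_rfl, by linarith⟩)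
    have hle : (f s).toReal ≤ K := by
      refine le_of_tendsto hd.tendsto_slope_zero_right ?_
      have hev : ∀ᶠ k in 𝓝[>] (0 : ℝ), k < t + δ₀ - s :=
        mem_nhdsWithin_of_mem_nhds (Iio_mem_nhds (by linarith [hs.2]))
      filter_upwards [self_mem_nhdsWithin, hev] with k hk0 hk
      have hk0' : 0 < k := hk0
      have h0s : 0 ≤ s := ht.trans hs.1.le
      have hb := h s k h0s hsS.le hk0' (by linarith [hs.1])
      have hfin' : ∫⁻ u in Ioc s (s + k), f u ≠ ⊤ := (hb.trans_lt ENNReal.ofReal_lt_top).ne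
      have e : (∫ u in t..(s + k), (f u).toReal) - ∫ u in t..s, (f u).toReal
          = (∫⁻ u in Ioc s (s + k), f u).toReal := by
        rw [intervalIntegral.integral_interval_sub_left, intervalIntegral.integral_of_le (by linarith),
          integral_toReal (hm h0s) (ae_lt_top' (hm h0s) hfin')]
        · exact hint.mono_set (by rw [hu, uIcc_of_le (by linarith [hs.1])]
                                  exact Icc_subset_Icc_right (by linarith))
        · exact hint.mono_set (by rw [hu, uIcc_of_le hs.1.le]
                                  exact Icc_subset_Icc_right (by linarith [hs.2]))
      rw [e, smul_eq_mul, inv_mul_le_iff₀ hk0', mul_comm]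
      exact ENNReal.toReal_le_of_le_ofReal (by positivity) hb
    rw [← ENNReal.ofReal_toReal (hs1 hsI).ne]
    exact ENNReal.ofReal_le_ofReal hle
  rw [ae_iff]
  refine measure_null_of_locally_null _ fun s hs => ?_
  simp only [mem_ofPred_eq, Classical.not_imp] at hs
  obtain ⟨⟨h0, hS⟩, -⟩ := hs
  set t := max 0 (s - δ₀ / 2)
  have ht1 : t < s := max_lt h0 (by linarith)
  have ht2 : s < t + δ₀ := by have := le_max_right 0 (s - δ₀ / 2); linarith
  have h1 := hloc t (le_max_left _ _) (ht1.le.trans hS.le)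
  rw [ae_iff] at h1
  refine ⟨Ioo t (t + δ₀) ∩ {s | ¬(s ∈ Ioo 0 S → f s ≤ ENNReal.ofReal K)},
    inter_mem (mem_nhdsWithin_of_mem_nhds (Ioo_mem_nhds ht1 ht2)) self_mem_nhdsWithin,
    measure_mono_null ?_ h1⟩
  rintro u ⟨hu1, hu2⟩ hcon
  exact hu2 fun hu3 => hcon hu1 hu3.2

/-- One-sided derivatives of concave functions are supergradients. -/
theorem _root_.ConcaveOn.exists_supergradients {v : ℝ → ℝ} (hv : ConcaveOn ℝ (Ioi 0) v) {s₀ : ℝ}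
    (h0 : 0 < s₀) : ∃ q q', (∀ s, 0 < s → v s ≤ v s₀ + q * (s - s₀)) ∧
      (∀ s, 0 < s → v s ≤ v s₀ + q' * (s - s₀)) ∧
      HasDerivWithinAt v q (Ioi s₀) s₀ ∧ HasDerivWithinAt v q' (Iio s₀) s₀ := by
  have hw : ConvexOn ℝ (Ioi 0) (-v) := hv.neg
  have hi : s₀ ∈ interior (Ioi (0 : ℝ)) := by rwa [interior_Ioi]
  set qr := derivWithin (-v) (Ioi s₀) s₀
  set ql := derivWithin (-v) (Iio s₀) s₀
  have hlr : ql ≤ qr := hw.leftDeriv_le_rightDeriv_of_mem_interior hi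
  have hright : ∀ s, s₀ < s → v s ≤ v s₀ - qr * (s - s₀) := fun s hs => by
    have := hw.rightDeriv_le_slope_of_mem_interior hi (h0.trans hs : s ∈ Ioi (0 : ℝ)) hs
    rw [slope_def_field, le_div_iff₀ (by linarith)] at this
    simp only [Pi.neg_apply] at this
    linarith
  have hleft : ∀ s, 0 < s → s < s₀ → v s ≤ v s₀ - ql * (s - s₀) := fun s h0s hs => by
    have := hw.slope_le_leftDeriv_of_mem_interior (h0s : s ∈ Ioi (0 : ℝ)) hi hs
    rw [slope_def_field, div_le_iff₀ (by linarith)] at this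
    simp only [Pi.neg_apply] at this
    linarith
  refine ⟨-qr, -ql, fun s hs => ?_, fun s hs => ?_, ?_, ?_⟩
  · rcases lt_trichotomy s s₀ with h | h | h
    · have := hleft s hs h
      nlinarith
    · simp [h]
    · have := hright s h
      linarith
  · rcases lt_trichotomy s s₀ with h | h | h
    · have := hleft s hs h
      linarith
    · simp [h]
    · have := hright s h
      nlinarith
  · simpa using (hw.hasDerivWithinAt_rightDeriv_of_mem_interior hi).neg
  · simpa using (hw.hasDerivWithinAt_leftDeriv_of_mem_interior hi).neg

namespace Problem

variable {P : Problem}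

section regularity

variable (hs : P.StateHypotheses) (hu : P.UtilityHypotheses)
include hs hu

theorem exists_isSupergradient {ζ : P.H} (hζ : ζ ∈ P.HPlusPlus) : ∃ q, P.IsSupergradient ζ q := by
  obtain ⟨q, -, h, -⟩ := (concaveOn_val hs hu hζ).exists_supergradients hζ.1
  exact ⟨q, h⟩

/-- Both one-sided derivatives of a concave function are supergradients; if there is only one
supergradient, they coincide and the function is differentiable. -/
theorem hasPresentDerivAt_of_unique {ζ : P.H} (hζ : ζ ∈ P.HPlusPlus) {p : ℝ}
    (h : ∀ q, P.IsSupergradient ζ q → q = p) : P.HasPresentDerivAt ζ p := by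
  obtain ⟨q, q', h1, h2, h3, h4⟩ := (concaveOn_val hs hu hζ).exists_supergradients hζ.1
  rw [h q h1] at h3
  rw [h q' h2] at h4
  have h5 := h4.union h3
  rw [Iio_union_Ioi] at h5
  exact hasDerivWithinAt_univ.1
    (hasDerivWithinAt_sdiff_singleton.1 (by rwa [← compl_eq_univ_sdiff]))

/-- Testing the supergradient at half the present gives `q ζ₀ / 2 ≤ V(ζ) - V(ζ₀ / 2, ζ₁)`. The first
value has a uniform upper bound, and the second is bounded below by the exponential pair started at
`ζ₀ / 2 ≥ μ`. The past does not enter. -/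
theorem exists_supergradient_bound {μ : ℝ} (hμ : 0 < μ) :
    ∃ Q : ℝ, 0 < Q ∧ ∀ ζ ∈ P.HPlusPlus, 2 * μ ≤ ζ.fst → ∀ q, P.IsSupergradient ζ q → q ≤ Q := by
  obtain ⟨B, hB⟩ := val_bounds hs hu
  set N := 2 * B - P.payoff₂ (fun t => μ * Real.exp (-P.Cf * t))
  refine ⟨max (N / μ) 1, lt_max_of_lt_right one_pos, fun ζ hζ hle q hq => ?_⟩
  have hhalf : μ ≤ ζ.fst / 2 := by linarith
  have h1 := (hB ζ hζ).1
  have h2 := (hB _ (fiber_mem hζ (show 0 < ζ.fst / 2 by linarith))).2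
  have h3 := (hu.payoff₂_mono (hu.exp_finitePayoff₂ hs hμ)
    (x := fun t => ζ.fst / 2 * Real.exp (-P.Cf * t))
    (Continuous.aestronglyMeasurable (by fun_prop)) (fun t _ => by positivity)
    (fun t _ => mul_le_mul_of_nonneg_right hhalf (Real.exp_pos _).le)).2
  have h4 := hq (ζ.fst / 2) (by linarith)
  simp only [WithLp.toLp_fst] at h2
  have h5 : q * (ζ.fst / 2) ≤ N := by
    simp only [N]
    linarith
  rcases le_or_gt q 0 with h6 | h6
  · exact h6.trans (by positivity)
  · refine le_max_of_le_left ((le_div_iff₀ hμ).2 ?_)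
    exact (mul_le_mul_of_nonneg_left hhalf h6.le).trans h5

end regularity

end Problem

end DelayControl

/-! ### The derivative of the value function along an optimal trajectory -/

namespace DelayControl

namespace Problem

variable {P : Problem}

theorem measurable_marginal : Measurable P.marginal :=
  Measurable.ite (measurableSet_singleton 0) measurable_const
    (measurable_deriv P.U₁).ennreal_ofReal

/-- A positive continuous path is bounded away from `0` on compact intervals. -/
theorem IsPositiveTrajectory.exists_le {η : P.H} {c x : ℝ → ℝ}
    (h : P.IsPositiveTrajectory η c x) {S : ℝ} (hS : 0 ≤ S) :
    ∃ μ : ℝ, 0 < μ ∧ ∀ s ∈ Icc 0 S, 2 * μ ≤ x s := by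
  obtain ⟨s₀, hs₀, hmin⟩ := (isCompact_Icc (a := (0 : ℝ)) (b := S)).exists_isMinOn
    (nonempty_Icc.2 hS) (h.cont.mono Icc_subset_Ici_self)
  exact ⟨x s₀ / 2, half_pos (h.pos s₀ hs₀.1), fun s hs => by
    rw [mul_div_cancel₀ _ two_ne_zero]; exact hmin hs⟩

theorem discount_factor_ge {C ρ δ : ℝ} (hρ : 0 < ρ) (hδ : 0 < δ) (hk : 0 < 1 / δ - C)
    (hC : 0 ≤ C) : 1 / δ - (C + ρ) ≤ Real.exp (-ρ * δ) * (1 / δ - C) := by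
  have h1 := Real.add_one_le_exp (-ρ * δ)
  have h2 := mul_le_mul_of_nonneg_right h1 hk.le
  have h3 : (-ρ * δ + 1) * (1 / δ - C) = 1 / δ - (C + ρ) + ρ * δ * C := by
    field_simp
    ring
  have h4 : 0 ≤ ρ * δ * C := by positivity
  linarith

section regularity

variable (hs : P.StateHypotheses) (hu : P.UtilityHypotheses)
include hs hu

/-- The marginal utility of an optimal control is locally bounded. -/
theorem exists_marginal_bound {η : P.H} (hη : η ∈ P.HPlusPlus) {c x : ℝ → ℝ} (h : P.IsPair η c x)
    (hf : P.FinitePayoff₂ x) (hopt : P.val η ≤ P.payoff₁ c + P.payoff₂ x) {S : ℝ} (hS : 0 ≤ S) :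
    ∃ Q : ℝ, 0 < Q ∧ ∀ᵐ s, s ∈ Ioo 0 S → P.marginal (c s) ≤ ENNReal.ofReal Q := by
  obtain ⟨μ, hμ, hμx⟩ := h.traj.exists_le hS
  obtain ⟨Q, hQ, hQb⟩ := exists_supergradient_bound hs hu hμ
  have hC := hs.Cf_nonneg
  have hρ := hu.ρ_pos
  -- For `δ ≤ δ₀` the factor `exp (-ρ δ) (1 / δ - Cf)` is at least `1 / (2 δ)`, so a supergradient
  -- bound `Q` at each time becomes the bound `2 Q` for the averages of the marginal utility.
  refine ⟨2 * Q, by positivity, ae_le_of_forall_lintegral_le (δ₀ := 1 / (2 * (P.Cf + P.ρ)))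
    (measurable_marginal.comp_aemeasurable h.control.aestronglyMeasurable.aemeasurable)
    (by positivity) (by positivity) fun t δ ht htS hδ hδ₀ => ?_⟩
  have hk1 : 2 * (P.Cf + P.ρ) ≤ 1 / δ := (le_one_div hδ (by positivity)).1 hδ₀
  have hk : 0 < 1 / δ - P.Cf := by linarith
  have hfac := discount_factor_ge hρ hδ hk hC
  obtain ⟨ζ, hζ⟩ := h.exists_segment hs ht
  have hζm := hζ.mem_HPlusPlus hη h ht
  obtain ⟨hf', hopt'⟩ := tail_optimal hs hu hη h hf hopt ht hζ
  obtain ⟨q, hq⟩ := exists_isSupergradient hs hu hζm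
  have hqQ := hQb ζ hζm (by rw [hζ.1]; exact hμx t ⟨ht, htS⟩) q hq
  have h1 := (lintegral_marginal_le hs hu hζm (h.tail hs ht hζ) hf' hopt' hq hδ hk).trans
    (ENNReal.ofReal_le_ofReal hqQ)
  have e : ∫⁻ s in Ioo 0 δ, P.marginal (c (t + s)) = ∫⁻ s in Ioc t (t + δ), P.marginal (c s) := by
    rw [setLIntegral_congr Ioo_ae_eq_Ioc]
    have := (measurePreserving_add_left volume t).setLIntegral_comp_preimage_emb
      (measurableEmbedding_addLeft t) (fun s => P.marginal (c s)) (Ioc t (t + δ))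
    rw [← this]
    simp
  rw [e] at h1
  have h2 : ENNReal.ofReal (1 / (2 * δ)) ≤
      ENNReal.ofReal (Real.exp (-P.ρ * δ) * (1 / δ - P.Cf)) := by
    refine ENNReal.ofReal_le_ofReal (le_trans ?_ hfac)
    have : 1 / (2 * δ) = 1 / δ / 2 := by field_simp
    rw [this]
    linarith
  have h3 := (mul_le_mul_left h2 (∫⁻ s in Ioc t (t + δ), P.marginal (c s))).trans h1
  have hpos : 0 < 1 / (2 * δ) := by positivity
  refine (ENNReal.mul_le_mul_iff_right (ENNReal.ofReal_pos.2 hpos).ne' ENNReal.ofReal_ne_top).1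
    (h3.trans_eq ?_)
  rw [← ENNReal.ofReal_mul hpos.le]
  congr 1
  field_simp

/-- There is an optimal control which is locally bounded away from `0`. -/
theorem exists_optimal_pair_bounded_below (hU₂ : ¬ IntegrableAtFilter P.U₂ (𝓝[>] (0 : ℝ)) volume)
    {η : P.H} (hη : η ∈ P.HPlusPlus) :
    ∃ c x, P.IsPair η c x ∧ P.FinitePayoff₂ x ∧ P.val η ≤ P.payoff₁ c + P.payoff₂ x ∧
      ∀ S, ∃ m : ℝ, 0 < m ∧ ∀ s ∈ Icc 0 S, m ≤ c s := by
  obtain ⟨c, x, h, hf, hopt⟩ := exists_optimal_pair hs hu hU₂ hη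
  have hm : ∀ n : ℕ, ∃ m : ℝ, 0 < m ∧ ∀ᵐ s, s ∈ Ioo 0 (n : ℝ) → m ≤ c s := fun n => by
    obtain ⟨Q, hQ, hb⟩ := exists_marginal_bound hs hu hη h hf hopt n.cast_nonneg
    obtain ⟨m, hm0, hm⟩ := hu.exists_deriv_eq hQ
    refine ⟨m, hm0, ?_⟩
    filter_upwards [hb] with s hs' hsn
    have h1 := hs' hsn
    have h2 : c s ≠ 0 := fun h0 => by simp [marginal, h0] at h1
    have h3 : 0 < c s := lt_of_le_of_ne (h.control.2 s hsn.1.le) h2.symm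
    rw [marginal, if_neg h2, ENNReal.ofReal_le_ofReal_iff hQ.le, ← hm] at h1
    exact (hu.strictAntiOn_deriv_U₁.le_iff_ge h3 hm0).1 h1
  choose m hm0 hm using hm
  classical
  -- The lower bounds hold almost everywhere. On `[0, ∞)` the exceptional set is null, and resetting
  -- the control to `1` there makes them hold at every point without changing trajectory or payoff.
  set N : Set ℝ := {s | ∃ n : ℕ, s < n ∧ c s < m n}
  set c' : ℝ → ℝ := fun s => if s ∈ N then 1 else c s
  have hc' : ∀ t, 0 ≤ t → 0 ≤ c' t := fun t ht => by
    simp only [c']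
    split_ifs
    · exact zero_le_one
    · exact h.control.2 t ht
  have hae : ∀ᵐ t ∂volume.restrict (Ici 0), c t = c' t := by
    rw [ae_restrict_iff' measurableSet_Ici]
    have h0 : ∀ᵐ t : ℝ, t ≠ 0 := by simp [ae_iff, measure_singleton]
    filter_upwards [ae_all_iff.2 hm, h0] with t ht ht0 hmem
    have : t ∉ N := fun ⟨n, hn, hlt⟩ =>
      absurd (ht n ⟨lt_of_le_of_ne hmem (Ne.symm ht0), hn⟩) (not_le.2 hlt)
    simp [c', this]
  have hpay : P.payoff₁ c' = P.payoff₁ c := by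
    refine integral_congr_ae ?_
    filter_upwards [ae_restrict_of_ae_restrict_of_subset Ioi_subset_Ici_self hae] with t ht
    rw [ht]
  refine ⟨c', x, h.congr_control hae hc', hf, by rwa [hpay], fun S => ?_⟩
  obtain ⟨n, hn⟩ := exists_nat_gt S
  refine ⟨min (m n) 1, lt_min (hm0 n) one_pos, fun s hs' => ?_⟩
  simp only [c']
  split_ifs with hN
  · exact min_le_right _ _
  · refine (min_le_left _ _).trans (not_lt.1 fun hlt => hN ⟨n, hs'.2.trans_lt hn, hlt⟩)

omit hs in
/-- The utility `U₂` is Lipschitz continuous away from `0`. -/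
theorem exists_lipschitz_U₂ {μ : ℝ} (hμ : 0 < μ) :
    ∃ L : ℝ, 0 ≤ L ∧ ∀ y y', μ ≤ y' → y' ≤ y → P.U₂ y - P.U₂ y' ≤ L * (y - y') := by
  have h1 : 0 ≤ P.U₂ μ - P.U₂ (μ / 2) :=
    sub_nonneg.2 (hu.U₂_mono (show 0 < μ / 2 by linarith) hμ (by linarith))
  refine ⟨(P.U₂ μ - P.U₂ (μ / 2)) / (μ / 2), by positivity, fun y y' hy' hyy => ?_⟩
  rcases hyy.eq_or_lt with rfl | hyy
  · simp
  -- Slopes of a concave function decrease, so beyond `μ` they are at most the slope over `[μ / 2,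
  -- μ]`.
  · have h2 : (P.U₂ y - P.U₂ y') / (y - y') ≤ (P.U₂ μ - P.U₂ (μ / 2)) / (μ - μ / 2) := by
      have e1 := hu.U₂_concave.slope_anti_adjacent (x := μ / 2) (y := y') (z := y)
        (show 0 < μ / 2 by linarith) (show 0 < y by linarith) (by linarith) hyy
      rcases hy'.eq_or_lt with h | h
      · rw [← h] at e1 ⊢; exact e1
      · have e2 := hu.U₂_concave.slope_anti_adjacent (x := μ / 2) (y := μ) (z := y')
          (show 0 < μ / 2 by linarith) (show 0 < y' by linarith) (by linarith) h
        have e3 := hu.U₂_concave.slope_anti_adjacent (x := μ) (y := y') (z := y)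
          hμ (show 0 < y by linarith) h hyy
        exact e3.trans e2
    rw [show μ - μ / 2 = μ / 2 by ring, div_le_iff₀ (by linarith)] at h2
    exact h2

/-- Along an optimal control which is locally bounded away from `0`, supergradients are uniformly
approximated by averages of the marginal utility. -/
theorem abs_supergradient_sub_le {η : P.H} (hη : η ∈ P.HPlusPlus) {c x : ℝ → ℝ}
    (h : P.IsPair η c x) (hf : P.FinitePayoff₂ x) (hopt : P.val η ≤ P.payoff₁ c + P.payoff₂ x)
    (hm : ∀ S, ∃ m : ℝ, 0 < m ∧ ∀ s ∈ Icc 0 S, m ≤ c s) {S : ℝ} (hS : 0 ≤ S) :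
    ∃ K δ₀ : ℝ, 0 < K ∧ 0 < δ₀ ∧ ∀ t ∈ Icc 0 S, ∀ ζ, P.IsSegment x t ζ → ∀ q,
      P.IsSupergradient ζ q → ∀ δ, 0 < δ → δ ≤ δ₀ →
        |q - 1 / δ * ∫ s in t..(t + δ), deriv P.U₁ (c s)| ≤ K * δ ∧ 0 < q := by
  have hC := hs.Cf_nonneg
  have hρ := hu.ρ_pos
  have hT := hs.T_pos
  have hr := hs.r_pos
  obtain ⟨A, hA0, hA⟩ := hs.exists_a_bound
  obtain ⟨m, hm0, hmc⟩ := hm (S + (1 + P.T))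
  obtain ⟨μ, hμ, hμx⟩ := h.traj.exists_le (show 0 ≤ S + 1 by linarith)
  obtain ⟨L, hL0, hL⟩ := exists_lipschitz_U₂ hu hμ
  set Q := deriv P.U₁ m
  have hQ : 0 < Q := hu.U₁_deriv_pos m hm0
  -- The term `Cf + ρ` is the error of the upward perturbation, including the discount. The terms `r
  -- + Cf`, `Cf A (1 + T)` and `L` come from the downward one: drift, delay and state utility. Each
  -- becomes of order `δ` because the integral `G` of the marginal utility is at most `Q δ`; `δ ≤ 1`
  -- is used in `δ + T ≤ 1 + T`.
  refine ⟨(P.Cf + P.ρ + (P.r + P.Cf) + P.Cf * A * (1 + P.T)) * Q + L,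
    min 1 (1 / (2 * (P.Cf + P.ρ))), by positivity, lt_min one_pos (by positivity),
    fun t ht ζ hζ q hq δ hδ hδ₀ => ?_⟩
  have hδ1 : δ ≤ 1 := hδ₀.trans (min_le_left _ _)
  have hk1 : 2 * (P.Cf + P.ρ) ≤ 1 / δ :=
    (le_one_div hδ (by positivity)).1 (hδ₀.trans (min_le_right _ _))
  have hk : 0 < 1 / δ - P.Cf := by linarith
  have hfac := discount_factor_ge hρ hδ hk hC
  have hζm := hζ.mem_HPlusPlus hη h ht.1
  obtain ⟨hf', hopt'⟩ := tail_optimal hs hu hη h hf hopt ht.1 hζ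
  have htail := h.tail hs ht.1 hζ
  have hmt : ∀ s ∈ Icc 0 (δ + P.T), m ≤ c (t + s) := fun s hs' =>
    hmc _ ⟨by linarith [ht.1, hs'.1], by linarith [ht.2, hs'.2]⟩
  have hg0 : ∀ s ∈ Ioc 0 δ, 0 < deriv P.U₁ (c (t + s)) := fun s hs' =>
    hu.U₁_deriv_pos _ (hm0.trans_le (hmt s ⟨hs'.1.le, by linarith [hs'.2]⟩))
  have hgQ : ∀ s ∈ Ioc 0 δ, deriv P.U₁ (c (t + s)) ≤ Q := fun s hs' => by
    have := hmt s ⟨hs'.1.le, by linarith [hs'.2]⟩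
    exact hu.strictAntiOn_deriv_U₁.antitoneOn hm0 (show 0 < c (t + s) by linarith) this
  have hgi : IntegrableOn (fun s => deriv P.U₁ (c (t + s))) (Ioc 0 δ) := by
    refine Integrable.mono' (integrableOn_const (C := Q) (by simp))
      ((measurable_deriv P.U₁).comp_aemeasurable
        (htail.control.aestronglyMeasurable.mono_measure
          (Measure.restrict_mono Ioc_subset_Ioi_self le_rfl)).aemeasurable).aestronglyMeasurable
      ((ae_restrict_iff' measurableSet_Ioc).2 (Eventually.of_forall fun s hs' => ?_))
    rw [Real.norm_of_nonneg (hg0 s hs').le]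
    exact hgQ s hs'
  set G := ∫ s in Ioc 0 δ, deriv P.U₁ (c (t + s)) with hGdef
  have hG : ∫ s in t..(t + δ), deriv P.U₁ (c s) = G := by
    rw [hGdef, ← intervalIntegral.integral_of_le hδ.le,
      intervalIntegral.integral_comp_add_left (fun s => deriv P.U₁ (c s)) t, add_zero]
  have hGpos : 0 < G := by
    rw [hGdef, ← intervalIntegral.integral_of_le hδ.le]
    exact intervalIntegral.intervalIntegral_pos_of_pos_on
      ((intervalIntegrable_iff_integrableOn_Ioc_of_le hδ.le).2 hgi)
      (fun s hs' => hg0 s ⟨hs'.1, hs'.2.le⟩) hδ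
  have hGle : G ≤ Q * δ := by
    calc G ≤ ∫ _s in Ioc 0 δ, Q :=
          setIntegral_mono_on hgi (integrableOn_const (by simp)) measurableSet_Ioc hgQ
      _ = Q * δ := by simp [hδ.le, mul_comm]
  have hup := supergradient_le hs hu hζm htail hf' hopt' hq hA0 hA hδ hm0 hmt hμ
    (fun s hs' => hμx _ ⟨by linarith [ht.1, hs'.1], by linarith [ht.2, hs'.2]⟩) hL0 hL
  have hlow := lintegral_marginal_le hs hu hζm htail hf' hopt' hq hδ hk
  have e : ∫⁻ s in Ioo 0 δ, P.marginal (c (t + s)) = ENNReal.ofReal G := by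
    rw [setLIntegral_congr Ioo_ae_eq_Ioc, hGdef, ofReal_integral_eq_lintegral_ofReal hgi
      ((ae_restrict_iff' measurableSet_Ioc).2 (Eventually.of_forall fun s hs' => (hg0 s hs').le))]
    refine setLIntegral_congr_fun measurableSet_Ioc fun s hs' => ?_
    have := hmt s ⟨hs'.1.le, by linarith [hs'.2]⟩
    simp only [marginal]
    rw [if_neg (by linarith)]
  have hfpos : 0 < Real.exp (-P.ρ * δ) * (1 / δ - P.Cf) := mul_pos (Real.exp_pos _) hk
  have hlow' : Real.exp (-P.ρ * δ) * (1 / δ - P.Cf) * G ≤ q := by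
    rw [e, ← ENNReal.ofReal_mul hfpos.le, ENNReal.ofReal_le_ofReal_iff'] at hlow
    exact hlow.resolve_right (not_le.2 (mul_pos hfpos hGpos))
  have h1 := mul_le_mul_of_nonneg_right hfac hGpos.le
  have h2 := mul_le_mul_of_nonneg_left hGle (show 0 ≤ P.Cf + P.ρ by linarith)
  have h3 := mul_le_mul_of_nonneg_left hGle (show 0 ≤ P.r + P.Cf by linarith)
  have h4 : P.Cf * (A * δ) * ((δ + P.T) * Q) ≤ P.Cf * (A * δ) * ((1 + P.T) * Q) := by gcongr
  have hLδ : 0 ≤ L * δ := by positivity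
  have hx1 : 0 ≤ P.Cf * (A * δ) * ((1 + P.T) * Q) := by positivity
  have hx2 : 0 ≤ (P.Cf + P.ρ) * (Q * δ) := by positivity
  have hx3 : 0 ≤ (P.r + P.Cf) * (Q * δ) := by positivity
  rw [hG]
  refine ⟨abs_le.2 ⟨?_, ?_⟩, lt_of_lt_of_le (mul_pos hfpos hGpos) hlow'⟩
  · linarith
  · linarith

/-- The value function has a positive derivative, continuous in time, in the direction of the
present along an optimal trajectory; it is the marginal utility of the optimal control. -/
theorem exists_presentDeriv {η : P.H} (hη : η ∈ P.HPlusPlus) {c x : ℝ → ℝ}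
    (h : P.IsPair η c x) (hf : P.FinitePayoff₂ x) (hopt : P.val η ≤ P.payoff₁ c + P.payoff₂ x)
    (hm : ∀ S, ∃ m : ℝ, 0 < m ∧ ∀ s ∈ Icc 0 S, m ≤ c s) {X : ℝ → P.H}
    (hX : ∀ t, 0 ≤ t → P.IsSegment x t (X t)) :
    ∃ p : ℝ → ℝ, ContinuousOn p (Ici 0) ∧ (∀ t, 0 ≤ t → 0 < p t) ∧
      (∀ t, 0 ≤ t → P.HasPresentDerivAt (X t) (p t)) ∧
      ∀ᵐ t, 0 < t → deriv P.U₁ (c t) = p t := by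
  have hcpos : ∀ t, 0 ≤ t → 0 < c t := fun t ht => by
    obtain ⟨m, hm0, hmc⟩ := hm t
    exact hm0.trans_le (hmc t ⟨ht, le_rfl⟩)
  have hgi : LocallyIntegrableOn (fun s => deriv P.U₁ (c s)) (Ici 0) :=
    locallyIntegrableOn_Ici_iff.2 fun S hS => by
      obtain ⟨m, hm0, hmc⟩ := hm S
      rw [intervalIntegrable_iff_integrableOn_Ioc_of_le hS]
      refine Integrable.mono' (integrableOn_const (C := deriv P.U₁ m) (by simp))
        ((measurable_deriv P.U₁).comp_aemeasurable
          (h.control.aestronglyMeasurable.mono_measure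
            (Measure.restrict_mono Ioc_subset_Ioi_self le_rfl)).aemeasurable).aestronglyMeasurable
        ((ae_restrict_iff' measurableSet_Ioc).2 (Eventually.of_forall fun s hs' => ?_))
      rw [Real.norm_of_nonneg (hu.U₁_deriv_pos _ (hcpos s hs'.1.le)).le]
      exact hu.strictAntiOn_deriv_U₁.antitoneOn hm0 (hcpos s hs'.1.le) (hmc s ⟨hs'.1.le, hs'.2⟩)
  set Φ : ℝ → ℝ := fun t => ∫ s in (0 : ℝ)..t, deriv P.U₁ (c s)
  have hΦ : ContinuousOn Φ (Ici 0) := by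
    simpa using continuousOn_primitive_Ici hgi 0
  have hΦsub : ∀ t δ, 0 ≤ t → 0 < δ →
      ∫ s in t..(t + δ), deriv P.U₁ (c s) = Φ (t + δ) - Φ t := fun t δ ht hδ =>
    (intervalIntegral.integral_interval_sub_left (locallyIntegrableOn_Ici_iff.1 hgi _ (by linarith))
      (locallyIntegrableOn_Ici_iff.1 hgi _ ht)).symm
  have hex : ∀ t, ∃ q, 0 ≤ t → P.IsSupergradient (X t) q := fun t => by
    by_cases ht : 0 ≤ t
    · obtain ⟨q, hq⟩ := exists_isSupergradient hs hu ((hX t ht).mem_HPlusPlus hη h ht)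
      exact ⟨q, fun _ => hq⟩
    · exact ⟨0, fun h => absurd h ht⟩
  choose p hp using hex
  have happ : ∀ S, 0 ≤ S → ∃ K δ₀ : ℝ, 0 < K ∧ 0 < δ₀ ∧ ∀ t ∈ Icc 0 S, ∀ q,
      P.IsSupergradient (X t) q → ∀ δ, 0 < δ → δ ≤ δ₀ →
        |q - 1 / δ * (Φ (t + δ) - Φ t)| ≤ K * δ ∧ 0 < q := fun S hS => by
    obtain ⟨K, δ₀, hK, hδ₀, hb⟩ := abs_supergradient_sub_le hs hu hη h hf hopt hm hS
    refine ⟨K, δ₀, hK, hδ₀, fun t ht q hq δ hδ hδ' => ?_⟩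
    rw [← hΦsub t δ ht.1 hδ]
    exact hb t ht (X t) (hX t ht.1) q hq δ hδ hδ'
  -- Two supergradients at `X t` lie within `K δ` of the same average, hence within `2 K δ` of each
  -- other for every small `δ`.
  have huniq : ∀ t, 0 ≤ t → ∀ q, P.IsSupergradient (X t) q → q = p t := fun t ht q hq => by
    obtain ⟨K, δ₀, hK, hδ₀, hb⟩ := happ t ht
    refine eq_of_forall_dist_le fun ε hε => ?_
    set δ := min δ₀ (ε / (2 * K))
    have hδ : 0 < δ := lt_min hδ₀ (by positivity)
    have h1 := abs_le.1 (hb t ⟨ht, le_rfl⟩ q hq δ hδ (min_le_left _ _)).1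
    have h2 := abs_le.1 (hb t ⟨ht, le_rfl⟩ (p t) (hp t ht) δ hδ (min_le_left _ _)).1
    have h3 : δ * (2 * K) ≤ ε := (le_div_iff₀ (by positivity)).1 (min_le_right _ _)
    rw [Real.dist_eq, abs_le]
    constructor <;> linarith
  refine ⟨p, ?_, fun t ht => ?_, fun t ht => ?_, ?_⟩
  · have hcont : ∀ S, 0 ≤ S → ContinuousOn p (Icc 0 S) := fun S hS => by
      obtain ⟨K, δ₀, hK, hδ₀, hb⟩ := happ S hS
      -- On `[0, S]` the function `p` is the uniform limit, as `δ → 0`, of the averages of `U₁'(c)`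
      -- over `[t, t + δ]`, which are continuous in `t`.
      refine continuousOn_of_uniform_approx_of_continuousOn fun u hu' => ?_
      obtain ⟨ε, hε, hsub⟩ := Metric.mem_uniformity_dist.1 hu'
      set δ := min δ₀ (ε / (2 * K))
      have hδ : 0 < δ := lt_min hδ₀ (by positivity)
      have h3 : δ * (2 * K) ≤ ε := (le_div_iff₀ (by positivity)).1 (min_le_right _ _)
      refine ⟨fun t => 1 / δ * (Φ (t + δ) - Φ t), ?_, fun t ht => hsub ?_⟩
      · refine continuousOn_const.mul (ContinuousOn.sub ?_ (hΦ.mono Icc_subset_Ici_self))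
        exact hΦ.comp (by fun_prop) fun t ht => show 0 ≤ t + δ by linarith [ht.1]
      · rw [Real.dist_eq]
        have := (hb t ht (p t) (hp t ht.1) δ hδ (min_le_left _ _)).1
        nlinarith
    intro t ht
    exact (hcont (t + 1) (by linarith [mem_Ici.1 ht]) t ⟨ht, by linarith⟩).mono_of_mem_nhdsWithin
      (mem_nhdsWithin.2 ⟨Iio (t + 1), isOpen_Iio, by simp, fun s hs' => ⟨hs'.2, hs'.1.le⟩⟩)
  · obtain ⟨K, δ₀, hK, hδ₀, hb⟩ := happ t ht
    exact (hb t ⟨ht, le_rfl⟩ (p t) (hp t ht) δ₀ hδ₀ le_rfl).2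
  · exact hasPresentDerivAt_of_unique hs hu ((hX t ht).mem_HPlusPlus hη h ht) (huniq t ht)
  · have hd : ∀ n : ℕ, ∀ᵐ t, t ∈ uIcc 0 (n : ℝ) →
        ∀ a ∈ uIcc 0 (n : ℝ), HasDerivAt (fun t => ∫ s in a..t, deriv P.U₁ (c s))
          (deriv P.U₁ (c t)) t := fun n =>
      (locallyIntegrableOn_Ici_iff.1 hgi n n.cast_nonneg).ae_hasDerivAt_integral
    filter_upwards [ae_all_iff.2 hd] with t ht ht0
    obtain ⟨n, hn⟩ := exists_nat_gt t
    have h1 : HasDerivAt Φ (deriv P.U₁ (c t)) t :=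
      ht n (by rw [uIcc_of_le n.cast_nonneg]; exact ⟨ht0.le, hn.le⟩) 0 left_mem_uIcc
    obtain ⟨K, δ₀, hK, hδ₀, hb⟩ := happ t ht0.le
    -- At almost every `t` the right difference quotients of `Φ` tend to `U₁'(c(t))` by Lebesgue
    -- differentiation, and always to `p t` by the estimate `K δ`.
    refine tendsto_nhds_unique h1.tendsto_slope_zero_right ?_
    have h2 : Tendsto (fun δ : ℝ => K * δ) (𝓝[>] 0) (𝓝 0) := by
      have : Tendsto (fun δ : ℝ => K * δ) (𝓝 0) (𝓝 (K * 0)) := tendsto_id.const_mul K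
      rw [mul_zero] at this
      exact this.mono_left nhdsWithin_le_nhds
    rw [tendsto_iff_dist_tendsto_zero]
    refine squeeze_zero' (Eventually.of_forall fun _ => dist_nonneg) ?_ h2
    have hev : ∀ᶠ δ in 𝓝[>] (0 : ℝ), δ < δ₀ := mem_nhdsWithin_of_mem_nhds (Iio_mem_nhds hδ₀)
    filter_upwards [self_mem_nhdsWithin, hev] with δ hδ hδ'
    have := (hb t ⟨ht0.le, le_rfl⟩ (p t) (hp t ht0.le) δ hδ hδ'.le).1
    rwa [dist_comm, Real.dist_eq, smul_eq_mul, ← one_div]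

end regularity

end Problem

end DelayControl

/-! ### The closed loop -/

namespace DelayControl

/-- The primitive on `[0, ∞)` of a continuous function is continuously differentiable. -/
theorem primitive_Ici_regular {g x : ℝ → ℝ} {x₀ : ℝ} (hg : ContinuousOn g (Ici 0))
    (hx : ∀ t, 0 ≤ t → x t = x₀ + ∫ s in (0 : ℝ)..t, g s) :
    ContDiffOn ℝ 1 x (Ici 0) ∧ ∀ t, 0 ≤ t → HasDerivWithinAt x (g t) (Ici 0) t := by
  -- The integrand is extended continuously to the whole line, so that the two-sided fundamental
  -- theorem of calculus covers the endpoint `0`.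
  have hG : Continuous fun t => g (max t 0) :=
    hg.comp_continuous (by fun_prop) fun t => le_max_right t 0
  have hd : ∀ t, HasDerivAt (fun t => x₀ + ∫ s in (0 : ℝ)..t, g (max s 0)) (g (max t 0)) t :=
    fun t => (hG.integral_hasStrictDerivAt 0 t).hasDerivAt.const_add x₀
  have he : ∀ t ∈ Ici (0 : ℝ), x t = x₀ + ∫ s in (0 : ℝ)..t, g (max s 0) := fun t ht => by
    rw [hx t ht]
    congr 1
    refine intervalIntegral.integral_congr fun s hs => ?_
    rw [uIcc_of_le ht] at hs
    simp only [max_eq_left hs.1]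
  have hC : ContDiff ℝ 1 fun t => x₀ + ∫ s in (0 : ℝ)..t, g (max s 0) := by
    rw [contDiff_one_iff_deriv]
    refine ⟨fun t => (hd t).differentiableAt, ?_⟩
    rw [funext fun t => (hd t).deriv]
    exact hG
  refine ⟨hC.contDiffOn.congr he, fun t ht => ?_⟩
  have := (hd t).hasDerivWithinAt (s := Ici 0)
  rw [max_eq_left ht] at this
  exact this.congr he (he t ht)

end DelayControl

theorem proposition3p9 (P : DelayControl.Problem)
    (hstate : P.StateHypotheses) (hutil : P.UtilityHypotheses)
    (hU₂ : ¬ IntegrableAtFilter P.U₂ (𝓝[>] (0 : ℝ)) volume)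
    (ha : ∀ ε : ℝ, 0 < ε → ε ≤ P.T → 0 < ∫ ξ in (-ε)..0, P.a ξ)
    (η : P.H) (hη : η ∈ P.HPlusPlus) :
    ∃ (x : ℝ → ℝ) (X : ℝ → P.H) (c : ℝ → ℝ),
      P.IsClosedLoopSolution η x X c ∧
      (∀ t, 0 ≤ t → 0 < x t) ∧
      (∀ t, 0 ≤ t → X t ∈ P.domV) ∧
      c ∈ P.admissible η ∧
      P.J η c = P.V η := by
  obtain ⟨c, x, h, hf, hopt, hm⟩ :=
    DelayControl.Problem.exists_optimal_pair_bounded_below hstate hutil hU₂ hη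
  have hseg : ∀ t, ∃ ζ, 0 ≤ t → P.IsSegment x t ζ := fun t => by
    by_cases ht : 0 ≤ t
    · obtain ⟨ζ, hζ⟩ := h.exists_segment hstate ht
      exact ⟨ζ, fun _ => hζ⟩
    · exact ⟨η, fun h => absurd h ht⟩
  choose X hX using hseg
  have hXm : ∀ t, 0 ≤ t → X t ∈ P.HPlusPlus := fun t ht => (hX t ht).mem_HPlusPlus hη h ht
  obtain ⟨p, hpc, hp0, hpd, hpae⟩ :=
    DelayControl.Problem.exists_presentDeriv hstate hutil hη h hf hopt hm hX
  obtain ⟨φ, hφc, hφ, hφinv⟩ := hutil.exists_inverse_deriv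
  -- The feedback control `φ (p t)`, with `φ` inverse to `U₁'`, is a continuous version of the
  -- optimal control. It drives the same trajectory with the same payoff, and the rate of `x`
  -- becomes continuous, which gives `C¹` regularity.
  have hcont : ContinuousOn (fun t => φ (p t)) (Ici 0) := hφc.comp hpc fun t ht => hp0 t ht
  have hae : ∀ᵐ t ∂volume.restrict (Ici (0 : ℝ)), c t = φ (p t) := by
    rw [← restrict_Ioi_eq_restrict_Ici, ae_restrict_iff' measurableSet_Ioi]
    filter_upwards [hpae] with t ht ht0
    obtain ⟨m, hm0, hmc⟩ := hm t
    rw [← ht ht0, hφinv _ (hm0.trans_le (hmc t ⟨le_of_lt ht0, le_rfl⟩))]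
  have h' : P.IsPair η (fun t => φ (p t)) x :=
    h.congr_control hae fun t ht => (hφ _ (hp0 t ht)).1.le
  have hpay : P.payoff₁ (fun t => φ (p t)) = P.payoff₁ c := by
    refine integral_congr_ae ?_
    filter_upwards [ae_restrict_of_ae_restrict_of_subset Ioi_subset_Ici_self hae] with t ht
    rw [ht]
  have hreg := DelayControl.primitive_Ici_regular
    ((h'.traj.drift_continuousOn hstate).sub hcont) fun t ht => h'.eq_primitive hstate ht
  have hdom : ∀ t, 0 ≤ t → X t ∈ P.domV := fun t ht =>
    DelayControl.Problem.mem_domV hstate hutil (hXm t ht)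
  refine ⟨x, X, fun t => φ (p t), ⟨h.traj.initial, hreg.1, hX, fun t ht => ?_, hreg.2⟩,
    h.traj.pos, hdom, h'.mem_admissible,
    DelayControl.Problem.J_eq_V_of_le hstate hutil hη h' hf (by rwa [hpay])⟩
  -- The first order condition `U₁'(φ(p)) = p` with `φ(p) > 0` makes `φ(p)` the unique maximizer,
  -- since a strictly concave function lies strictly below its tangent elsewhere.
  obtain ⟨h1, h2⟩ := hφ _ (hp0 t ht)
  refine ⟨hdom t ht, p t, hpd t ht, h1.le, fun c' hc' hne => ?_⟩
  have := hutil.sub_le_mul_deriv h1 hc' hne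
  rw [h2] at this
  linarith
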